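/- Let $\kappa,\kappa'\ge 0$ be real numbers and let $\mathbb N_0=\{0,1,2,\dots\}$. **Coordinates and pairings.** For $x\in\mathbb R^4$ put $y=(y_0,y_1,y_2,y_3)=Hx$ with $$H=\tfrac12\begin{pmatrix}1&1&1&1\\1&1&-1&-1\\1&-1&1&-1\\1&-1&-1&1\end{pmatrix},$$ with rows $v_0,v_1,v_2,v_3$. Permutations act on points by $(xw)_i=x_{w(i)}$ and on polynomials by $(wf)(x)=f(xw)$. For $N\ge1$ and real polynomials in $x_1,\dots,x_N$ let $$\mathcal D_if=\frac{\partial f}{\partial x_i}+\kappa\sum_{j\ne i}\frac{f-(i,j)f}{x_i-x_j}.$$ For polynomials in $y_1,y_2,y_3$ let $$\mathcal D^B_if=\frac{\partial f}{\partial y_i}+\kappa\sum_{j\neq i}\Big(\frac{f-\sigma_{ij}f}{y_i-y_j}+\frac{f-\tau_{ij}f}{y_i+y_j}\Big)\quad(1\le i\le3),$$ where $\sigma_{ij},\tau_{ij}$ are the reflections in $y_i-y_j=0$ and $y_i+y_j=0$. For polynomials in $x_1,\dots,x_4$ let $$\mathcal D_i'f=\mathcal D_if+\frac{\kappa'}{2y_0}\big(f(x)-f(x\sigma_0)\big),\qquad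 x\sigma_0=x-\Big(\sum_j x_j\Big)v_0 .$$ For polynomials in $x_1,\dots,x_4$ put $$\langle f,g\rangle_\kappa=f(\mathcal D_1,\dots,\mathcal D_4)g\,|_{x=0},\qquad \langle f,g\rangle_{\kappa,\kappa'}=f(\mathcal D'_1,\dots,\mathcal D'_4)g\,|_{x=0},$$ and for polynomials in $y_1,y_2,y_3$ put $\langle f,g\rangle_\kappa=f(\mathcal D^B_1,\mathcal D^B_2,\mathcal D^B_3)g\,|_{y=0}$. **Nonsymmetric Jack polynomials.** For $\alpha\in\mathbb N_0^N$ let $\alpha^+$ be its weakly decreasing rearrangement. Write $\alpha\succ\beta$ if $\alpha\ne\beta$ and $\sum_{i\le j}\alpha_i\ge\sum_{i\le j}\beta_i$ for all $j$. Write $\alpha\vartriangleright\beta$ if $|\alpha|=|\beta|$ and either $\alpha^+\succ\beta^+$, or $\alpha^+=\beta^+$ and $\alpha\succ\beta$. Let $$\mathcal U_if=\mathcal D_i(x_if)-\kappa\sum_{j<i}(j,i)f,\qquad \xi_i(\alpha)=(N-r(\alpha,i))\kappa+\alpha_i+1,$$ $$r(\alpha,i)=\#\{j:\alpha_j>\alpha_i\}+\#\{j\le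 i:\alpha_j=\alpha_i\}.$$ Let $N=3$. The nonsymmetric Jack polynomial $\zeta_\alpha$ is the polynomial with $\mathcal U_i\zeta_\alpha=\xi_i(\alpha)\zeta_\alpha$ for all $i$ and $\zeta_\alpha=x^\alpha+\sum_{\alpha\vartriangleright\beta}A_{\beta\alpha}x^\beta$ with real coefficients $A_{\beta\alpha}$. **The polynomials $p_\gamma$.** For $\gamma\in\mathbb N_0^3$ let $k$ be the number of odd entries of $\gamma$. Let $w\in\mathcal S_3$ be the permutation that maps $\{1,\dots,k\}$ onto $\{i:\gamma_i\text{ odd}\}$ and is increasing on $\{1,\dots,k\}$ and on $\{k+1,\dots,3\}$. Put $\beta_i=\gamma_{w(i)}$, $\alpha_i=\lfloor\beta_i/2\rfloor$, $y_{E_k}=y_1\cdots y_k$, and $$p_\gamma(y)=w\big(y_{E_k}\,\zeta_\alpha(y_1^2,y_2^2,y_3^2)\big).$$ **Norm constants.** Let $$L(\alpha;i,j)=\#\{l>i:j\le\alpha_l\le\alpha_i\}+\#\{l<i:j\le\alpha_l+1\le\alpha_i\},$$ $$h(\alpha,t)=\prod_i\prod_{j=1}^{\alpha_i}\big(\alpha_i-j+t+\kappa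 L(\alpha;i,j)\big),\qquad (t)_\lambda=\prod_i\prod_{j=0}^{\lambda_i-1}\big(t-(i-1)\kappa+j\big),$$ $$\nu_\gamma=2^{|\gamma|}\,(3\kappa+1)_{\alpha^+}\,\big(2\kappa+\tfrac12\big)_{(\beta-\alpha)^+}\,\frac{h(\alpha,1)}{h(\alpha,\kappa+1)},\qquad \nu'_n=2^n\,\lfloor n/2\rfloor!\prod_{j=0}^{\lceil n/2\rceil-1}\big(\kappa'+\tfrac12+j\big).$$ **Claim.** 1. $H$ is orthogonal. The coordinate $y_0$ is invariant under permutations of $x_1,\dots,x_4$, and the action of $\mathcal S_4$ on $x$ by $x\mapsto xw^{-1}$ becomes, in the coordinates $(y_1,y_2,y_3)$, an isomorphism of $\mathcal S_4$ onto the reflection group $D_3$ generated by the reflections along $(1,-1,0)$, $(0,1,-1)$, $(0,1,1)$. 2. For every $\alpha\in\mathbb N_0^3$ the polynomial $\zeta_\alpha$ exists and is unique. 3. $\{p_\gamma:\gamma\in\mathbb N_0^3\}$ is an orthogonal basis of the space of polynomials in $y_1,y_2,y_3$ for $\langle\cdot,\cdot\rangle_\kappa$, with $\langle p_\gamma,p_\gamma\rangle_\kappa=\nu_\gamma>0$.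 This holds both for the pairing given by the operators $\mathcal D^B_i$ and, after substituting $y=Hx$, for the pairing of $\mathcal S_4$ given by $\mathcal D_1,\dots,\mathcal D_4$. 4. $\{p_\gamma(y)\,y_0^n:\gamma\in\mathbb N_0^3,\ n\in\mathbb N_0\}$, with $y=Hx$, is an orthogonal basis of the space of all polynomials in $x_1,\dots,x_4$ for $\langle\cdot,\cdot\rangle_{\kappa,\kappa'}$, and the value of the pairing of $p_\gamma(y)y_0^n$ with itself is $\nu_\gamma\,\nu'_n>0$. -/

import Mathlib

noncomputable section

open MvPolynomial

namespace DunklFour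

/-! ### Reflections, divided differences and Dunkl operators on polynomials -/

/-- The linear form `⟨v, x⟩ = ∑ v i * x i` as a polynomial. -/
def linForm {N : ℕ} (v : Fin N → ℝ) : MvPolynomial (Fin N) ℝ :=
  ∑ i, C (v i) * X i

/-- The action `(s_v f)(x) = f(x s_v)` on polynomials of the orthogonal reflection
`x s_v = x - 2 (⟨x, v⟩ / ⟨v, v⟩) v`. -/
def reflect {N : ℕ} (v : Fin N → ℝ) : MvPolynomial (Fin N) ℝ →ₐ[ℝ] MvPolynomial (Fin N) ℝ :=
  aeval fun i => X i - C (2 * v i / ∑ j, v j ^ 2) * linForm v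

theorem linForm_dvd_sub_reflect {N : ℕ} (v : Fin N → ℝ) (f : MvPolynomial (Fin N) ℝ) :
    linForm v ∣ f - reflect v f := by
  induction f using MvPolynomial.induction_on with
  | C a => simp [reflect, MvPolynomial.algebraMap_eq]
  | add p q hp hq =>
    have h : p + q - reflect v (p + q) = (p - reflect v p) + (q - reflect v q) := by
      rw [map_add]; ring
    rw [h]; exact dvd_add hp hq
  | mul_X p i hp =>
    have h : p * X i - reflect v (p * X i) = (p - reflect v p) * X i
        + linForm v * (reflect v p * C (2 * v i / ∑ j, v j ^ 2)) := by
      rw [map_mul]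
      have : reflect v (X i) = X i - C (2 * v i / ∑ j, v j ^ 2) * linForm v := by
        simp [reflect]
      rw [this]; ring
    rw [h]
    exact dvd_add (Dvd.dvd.mul_right hp _) (dvd_mul_right _ _)

theorem linForm_ne_zero {N : ℕ} {v : Fin N → ℝ} (hv : v ≠ 0) : linForm v ≠ 0 := by
  intro h
  apply hv
  funext i
  have h1 := congrArg (MvPolynomial.eval (Pi.single i (1 : ℝ))) h
  simpa [linForm, Pi.single_apply] using h1

open Classical in
/-- The divided difference `f ↦ (f - s_v f) / ⟨v, x⟩`, for `v ≠ 0`, as a linear operator on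
polynomials: the value is the unique polynomial `q` with `⟨v, x⟩ * q = f - s_v f`. -/
def divDiff {N : ℕ} (v : Fin N → ℝ) : Module.End ℝ (MvPolynomial (Fin N) ℝ) where
  toFun f := if v = 0 then 0 else (linForm_dvd_sub_reflect v f).choose
  map_add' f g := by
    by_cases hv : v = 0
    · simp [hv]
    · simp only [hv, if_false]
      apply mul_left_cancel₀ (linForm_ne_zero hv)
      rw [mul_add, ← (linForm_dvd_sub_reflect v (f + g)).choose_spec,
        ← (linForm_dvd_sub_reflect v f).choose_spec,
        ← (linForm_dvd_sub_reflect v g).choose_spec, map_add]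
      ring
  map_smul' c f := by
    by_cases hv : v = 0
    · simp [hv]
    · simp only [hv, if_false, RingHom.id_apply]
      apply mul_left_cancel₀ (linForm_ne_zero hv)
      rw [mul_smul_comm, ← (linForm_dvd_sub_reflect v (c • f)).choose_spec,
        ← (linForm_dvd_sub_reflect v f).choose_spec, map_smul, smul_sub]

theorem linForm_mul_divDiff {N : ℕ} {v : Fin N → ℝ} (hv : v ≠ 0) (f : MvPolynomial (Fin N) ℝ) :
    linForm v * divDiff v f = f - reflect v f := by
  have h : divDiff v f = (linForm_dvd_sub_reflect v f).choose := by simp [divDiff, hv]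
  rw [h]
  exact (linForm_dvd_sub_reflect v f).choose_spec.symm

/-- The root `e_i - e_j`; its reflection is the transposition of the coordinates `i` and `j`. -/
def rootSub {N : ℕ} (i j : Fin N) : Fin N → ℝ := Pi.single i 1 - Pi.single j 1

/-- The root `e_i + e_j`; its reflection is `x_i ↦ -x_j`, `x_j ↦ -x_i`. -/
def rootAdd {N : ℕ} (i j : Fin N) : Fin N → ℝ := Pi.single i 1 + Pi.single j 1

theorem reflect_rootSub {N : ℕ} {i j : Fin N} (hij : i ≠ j) (f : MvPolynomial (Fin N) ℝ) :
    reflect (rootSub i j) f = rename (Equiv.swap i j) f := by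
  have hL : linForm (rootSub i j) = X i - X j := by
    simp [linForm, rootSub, Pi.single_apply, sub_mul, Finset.sum_sub_distrib, ite_mul, apply_ite C]
  have hS : ∑ l, (rootSub i j l : ℝ) ^ 2 = 2 := by
    have h : ∀ l, (rootSub i j l : ℝ) ^ 2 = (if l = i then 1 else 0) + (if l = j then 1 else 0) := by
      intro l
      by_cases h1 : l = i
      · subst h1; simp [rootSub, Pi.single_apply, hij]
      · by_cases h2 : l = j
        · subst h2; simp [rootSub, Pi.single_apply, h1]
        · simp [rootSub, Pi.single_apply, h1, h2]
    rw [Finset.sum_congr rfl fun l _ => h l, Finset.sum_add_distrib]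
    norm_num
  have h : reflect (rootSub i j) = rename (R := ℝ) (Equiv.swap i j) := by
    apply MvPolynomial.algHom_ext
    intro l
    simp only [reflect, aeval_X, rename_X, hS, hL]
    by_cases h1 : l = i
    · subst h1; simp [rootSub, Pi.single_apply, hij]
    · by_cases h2 : l = j
      · subst h2; simp [rootSub, Pi.single_apply, h1]
      · simp [rootSub, Pi.single_apply, h1, h2, Equiv.swap_apply_of_ne_of_ne h1 h2]
  rw [h]

/-- The Dunkl operators of the symmetric group `S_N`:
`D_i f = ∂f/∂x_i + κ ∑_{j ≠ i} (f(x) - f(x (i, j))) / (x_i - x_j)`. -/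
def dunklA {N : ℕ} (κ : ℝ) (i : Fin N) : Module.End ℝ (MvPolynomial (Fin N) ℝ) :=
  (pderiv i).toLinearMap + κ • ∑ j ∈ Finset.univ.erase i, divDiff (rootSub i j)

/-- The Dunkl operators of the group `D_3` (type `B_3` with the parameter of the sign changes
equal to zero), acting on polynomials in `y_1, y_2, y_3`:
`∂f/∂y_i + κ ∑_{j ≠ i} ((f - σ_ij f) / (y_i - y_j) + (f - τ_ij f) / (y_i + y_j))`. -/
def dunklD (κ : ℝ) (i : Fin 3) : Module.End ℝ (MvPolynomial (Fin 3) ℝ) :=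
  (pderiv i).toLinearMap
    + κ • ∑ j ∈ Finset.univ.erase i, (divDiff (rootSub i j) + divDiff (rootAdd i j))

/-- The Hadamard matrix `H`; row `k` is the vector `v_k`, `k = 0, 1, 2, 3`. -/
def hadamard : Matrix (Fin 4) (Fin 4) ℝ :=
  (1 / 2 : ℝ) • !![1, 1, 1, 1; 1, 1, -1, -1; 1, -1, 1, -1; 1, -1, -1, 1]

/-- The Dunkl operators of the group `S_4 × Z_2`:
`D_i' f = D_i f + κ' / (2 ⟨x, v_0⟩) * (f(x) - f(x σ_0))`, with `σ_0` the reflection along `v_0`. -/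
def dunklAZ (κ κ' : ℝ) (i : Fin 4) : Module.End ℝ (MvPolynomial (Fin 4) ℝ) :=
  dunklA κ i + (κ' / 2) • divDiff (hadamard 0)

/-- The pairing `f(D_1, …, D_N) g (x) |_{x = 0}` attached to a family of operators. -/
def pairing {N : ℕ} (D : Fin N → Module.End ℝ (MvPolynomial (Fin N) ℝ))
    (f g : MvPolynomial (Fin N) ℝ) : ℝ :=
  constantCoeff
    (∑ m ∈ f.support, coeff m f • (List.ofFn fun i => D i ^ m i).prod g)

/-! ### Nonsymmetric Jack polynomials -/

/-- The partition `α⁺` obtained by arranging the entries of `α` in weakly decreasing order. -/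
def sortDesc {N : ℕ} (α : Fin N → ℕ) : Fin N → ℕ :=
  fun i => α (Tuple.sort α (Fin.rev i))

theorem sortDesc_antitone {N : ℕ} (α : Fin N → ℕ) : Antitone (sortDesc α) := fun _ _ h =>
  Tuple.monotone_sort α (Fin.rev_le_rev.mpr h)

/-- The dominance order `α ≻ β`. -/
def Dominates {N : ℕ} (α β : Fin N → ℕ) : Prop :=
  α ≠ β ∧ ∀ j, ∑ i ∈ Finset.Iic j, β i ≤ ∑ i ∈ Finset.Iic j, α i

/-- The partial order `α ▷ β` on compositions. -/
def CompGT {N : ℕ} (α β : Fin N → ℕ) : Prop :=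
  ∑ i, α i = ∑ i, β i ∧
    (Dominates (sortDesc α) (sortDesc β) ∨ (sortDesc α = sortDesc β ∧ Dominates α β))

/-- The rank function `r(α, i) = #{j : α_j > α_i} + #{j : j ≤ i, α_j = α_i}`. -/
def rank {N : ℕ} (α : Fin N → ℕ) (i : Fin N) : ℕ :=
  (Finset.univ.filter fun j => α i < α j).card
    + (Finset.univ.filter fun j => j ≤ i ∧ α j = α i).card

/-- The eigenvalue `ξ_i(α) = (N - r(α, i)) κ + α_i + 1`. -/
def xi {N : ℕ} (κ : ℝ) (α : Fin N → ℕ) (i : Fin N) : ℝ :=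
  ((N : ℝ) - rank α i) * κ + α i + 1

/-- The Cherednik-type operator `U_i f = D_i (x_i f) - κ ∑_{j < i} (j, i) f`. -/
def opU {N : ℕ} (κ : ℝ) (i : Fin N) : Module.End ℝ (MvPolynomial (Fin N) ℝ) :=
  dunklA κ i ∘ₗ LinearMap.mulLeft ℝ (X i)
    - κ • ∑ j ∈ Finset.Iio i, (rename (R := ℝ) (Equiv.swap j i)).toLinearMap

/-- `ζ` is the `x`-monic nonsymmetric Jack polynomial with label `α`. -/
structure IsNSJack {N : ℕ} (κ : ℝ) (α : Fin N → ℕ) (ζ : MvPolynomial (Fin N) ℝ) : Prop where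
  eigen : ∀ i, opU κ i ζ = xi κ α i • ζ
  monic : coeff (Finsupp.equivFunOnFinite.symm α) ζ = 1
  triangular : ∀ β : Fin N →₀ ℕ, coeff β ζ ≠ 0 → (β : Fin N → ℕ) = α ∨ CompGT α β

open Classical in
/-- The nonsymmetric Jack polynomial `ζ_α`; it is characterized by `IsNSJack` whenever a
polynomial with that property exists. -/
def nsJack {N : ℕ} (κ : ℝ) (α : Fin N → ℕ) : MvPolynomial (Fin N) ℝ :=
  if h : ∃ ζ, IsNSJack κ α ζ then h.choose else 0

/-! ### Hook lengths and Pochhammer symbols -/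

/-- The leg length `L(α; i, j) = #{l > i : j ≤ α_l ≤ α_i} + #{l < i : j ≤ α_l + 1 ≤ α_i}`. -/
def legLength {N : ℕ} (α : Fin N → ℕ) (i : Fin N) (j : ℕ) : ℕ :=
  (Finset.univ.filter fun l => i < l ∧ j ≤ α l ∧ α l ≤ α i).card
    + (Finset.univ.filter fun l => l < i ∧ j ≤ α l + 1 ∧ α l + 1 ≤ α i).card

/-- The hook-length product `h(α, t) = ∏_i ∏_{j = 1}^{α_i} (α_i - j + t + κ L(α; i, j))`. -/
def hookProd {N : ℕ} (κ : ℝ) (α : Fin N → ℕ) (t : ℝ) : ℝ :=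
  ∏ i, ∏ j ∈ Finset.Icc 1 (α i), ((α i : ℝ) - j + t + κ * legLength α i j)

/-- The generalized Pochhammer symbol `(t)_λ = ∏_i ∏_{j = 0}^{λ_i - 1} (t - (i - 1) κ + j)`
(here `i` is counted from `0`). -/
def genPoch {N : ℕ} (κ t : ℝ) (l : Fin N → ℕ) : ℝ :=
  ∏ i : Fin N, ∏ j ∈ Finset.range (l i), (t - (i : ℕ) * κ + j)

/-! ### The polynomials `p_γ` -/

/-- The number `k` of odd entries of `γ`. -/
def oddCount (γ : Fin 3 → ℕ) : ℕ := (Finset.univ.filter fun i => Odd (γ i)).card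

/-- The permutation `w` with `γ = w β`, where `β_i` is odd exactly for the first `k` indices, and
`w` is increasing on the first `k` indices and on the remaining ones (stable sorting that puts
the odd entries first). -/
def oddFirst (γ : Fin 3 → ℕ) : Equiv.Perm (Fin 3) :=
  Tuple.sort fun i => (γ i + 1) % 2

theorem oddFirst_spec (γ : Fin 3 → ℕ) :
    (∀ i j, i < j → Odd (γ (oddFirst γ j)) → Odd (γ (oddFirst γ i))) ∧
    (∀ i j, i < j → (Odd (γ (oddFirst γ i)) ↔ Odd (γ (oddFirst γ j))) →
      oddFirst γ i < oddFirst γ j) := by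
  have h := (Tuple.eq_sort_iff (f := fun i => (γ i + 1) % 2) (σ := oddFirst γ)).1 rfl
  refine ⟨fun i j hij hj => ?_, fun i j hij hp => h.2 i j hij ?_⟩
  · have h1 : (γ (oddFirst γ i) + 1) % 2 ≤ (γ (oddFirst γ j) + 1) % 2 := h.1 hij.le
    rw [Nat.odd_iff] at hj ⊢
    omega
  · simp only [Nat.odd_iff] at hp
    omega

/-- `β = w⁻¹ γ`, that is `β_i = γ_{w(i)}`. -/
def betaOf (γ : Fin 3 → ℕ) : Fin 3 → ℕ := fun i => γ (oddFirst γ i)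

/-- `α_i = ⌊β_i / 2⌋`. -/
def alphaOf (γ : Fin 3 → ℕ) : Fin 3 → ℕ := fun i => betaOf γ i / 2

/-- The monomial `y_{E_k} = y_1 ⋯ y_k`. -/
def yE (k : ℕ) : MvPolynomial (Fin 3) ℝ :=
  ∏ i ∈ Finset.univ.filter (fun i : Fin 3 => (i : ℕ) < k), X i

/-- The polynomial `p_γ(y) = w (y_{E_k} ζ_α(y²))`, where `(w f)(y) = f(y w)`, `(y w)_i = y_{w(i)}`. -/
def p (κ : ℝ) (γ : Fin 3 → ℕ) : MvPolynomial (Fin 3) ℝ :=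
  rename (oddFirst γ)
    (yE (oddCount γ) * aeval (fun i => (X i : MvPolynomial (Fin 3) ℝ) ^ 2) (nsJack κ (alphaOf γ)))

/-- The squared norm of `p_γ`:
`2^|γ| (3κ+1)_{α⁺} (2κ+1/2)_{(β-α)⁺} h(α,1) / h(α,κ+1)`. The difference `β - α` is a composition,
since `α_i = ⌊β_i / 2⌋ ≤ β_i`. -/
def normP (κ : ℝ) (γ : Fin 3 → ℕ) : ℝ :=
  2 ^ (∑ i, γ i) * genPoch κ (3 * κ + 1) (sortDesc (alphaOf γ))
    * genPoch κ (2 * κ + 1 / 2) (sortDesc fun i => betaOf γ i - alphaOf γ i)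
    * (hookProd κ (alphaOf γ) 1 / hookProd κ (alphaOf γ) (κ + 1))

/-- The squared norm of `y_0^n`: `2^n ⌊n/2⌋! (κ' + 1/2)_{⌈n/2⌉}`. -/
def normY0 (κ' : ℝ) (n : ℕ) : ℝ :=
  2 ^ n * ((n / 2).factorial : ℝ) * ∏ j ∈ Finset.range ((n + 1) / 2), (κ' + 1 / 2 + j)

/-! ### The change of variables `y = H x` -/

/-- The linear form `y_k = ⟨x, v_k⟩` as a polynomial in `x`. -/
def yForm (k : Fin 4) : MvPolynomial (Fin 4) ℝ := linForm (hadamard k)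

/-- Substitution of `(y_1, y_2, y_3)` in terms of `x`. -/
def inX : MvPolynomial (Fin 3) ℝ →ₐ[ℝ] MvPolynomial (Fin 4) ℝ :=
  aeval fun i : Fin 3 => yForm i.succ

/-- The point `(y_1, y_2, y_3)` attached to `x`. -/
def yPoint (x : Fin 4 → ℝ) : EuclideanSpace ℝ (Fin 3) :=
  WithLp.toLp 2 fun i : Fin 3 => (hadamard.mulVec x) i.succ

/-- The reflection group `D_3` on `ℝ³`, generated by the reflections in the simple roots
`(1,-1,0)`, `(0,1,-1)`, `(0,1,1)`. -/
def groupD3 : Subgroup (EuclideanSpace ℝ (Fin 3) ≃ₗᵢ[ℝ] EuclideanSpace ℝ (Fin 3)) :=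
  Subgroup.closure
    {(ℝ ∙ (!₂[1, -1, 0] : EuclideanSpace ℝ (Fin 3)))ᗮ.reflection,
     (ℝ ∙ (!₂[0, 1, -1] : EuclideanSpace ℝ (Fin 3)))ᗮ.reflection,
     (ℝ ∙ (!₂[0, 1, 1] : EuclideanSpace ℝ (Fin 3)))ᗮ.reflection}

/-- The family `b` is a basis of the subspace `V` that consists of vectors pairwise orthogonal for
the form `B`, with `B (b a) (b a) = nrm a > 0`. -/
structure IsOrthoBasis {ι M : Type*} [AddCommGroup M] [Module ℝ M] (B : M → M → ℝ)
    (V : Submodule ℝ M) (b : ι → M) (nrm : ι → ℝ) : Prop where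
  linearIndependent : LinearIndependent ℝ b
  span_eq : Submodule.span ℝ (Set.range b) = V
  orthogonal : ∀ a a', a ≠ a' → B (b a) (b a') = 0
  norm_eq : ∀ a, B (b a) (b a) = nrm a
  norm_pos : ∀ a, 0 < nrm a

end DunklFour

end

noncomputable section

open MvPolynomial

namespace DunklFour

/-! ### Divided differences -/

/-! Everything reduces to type D_3. In the orthonormal coordinates y = Hx the forms x_i - x_j become
the forms ±y_a ± y_b with a, b ≥ 1, and y_0 is orthogonal to all of them. The Dunkl operators in the
directions v_k therefore act separately on the factors of f(y_1, y_2, y_3) y_0^n: those with k ≥ 1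
apply D^B_k to f (`dunklY_succ`), the one with k = 0 lowers the power of y_0 (`dunklY_zero`). Hence
the pairing of S_4 × Z_2 is a product of the D_3 pairing and a one-variable pairing
(`pairing_inX_mul_pow`), and κ' = 0 gives the pairing of S_4.

For D_3, the commutators of D_i with the variables are combinations of reflections (and the
identity). This yields commutativity (`dunklD_commute`) and the adjointness of D_i and
multiplication by y_i (`pairing_X_mul_right`). So the operators D_i y_i - κ ∑_{j<i} (σ_ij + τ_ij)
are self-adjoint, and on y_{E_k} f(y²) they act as 2 U_i - (0 or 1) acts on f (`opUD_yE_mul_sq`).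
Nonsymmetric Jack polynomials diagonalize them, with distinct spectral vectors because κ ≥ 0
(`xi_injective`); different parity classes are separated by sign changes, which preserve the
pairing. This is the orthogonality.

Existence and norms come together from a recursion that starts at the constant 1. Its steps are the
affine raising operator and the combination sζ + cζ with a transposition s. Each multiplies the norm
by an explicit factor (`pairing_sq_raise`, `pairing_swap_eigen`), and the closed formula obeys the
same rules (`jackNorm_raiseIdx`, `jackNorm_swap`); the odd variables enter through
`pairing_yE_succ`. Positivity of the norms gives linear independence, and triangularity of the U_i
gives uniqueness and spanning. -/

theorem reflect_X {N : ℕ} (v : Fin N → ℝ) (j : Fin N) :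
    reflect v (X j) = X j - C (2 * v j / ∑ l, v l ^ 2) * linForm v := by
  simp [reflect]

theorem divDiff_eq_of_mul_eq {N : ℕ} {v : Fin N → ℝ} (hv : v ≠ 0) {f q : MvPolynomial (Fin N) ℝ}
    (h : linForm v * q = f - reflect v f) : divDiff v f = q :=
  mul_left_cancel₀ (linForm_ne_zero hv) ((linForm_mul_divDiff hv f).trans h.symm)

theorem divDiff_X_mul {N : ℕ} {v : Fin N → ℝ} (hv : v ≠ 0) (j : Fin N)
    (f : MvPolynomial (Fin N) ℝ) :
    divDiff v (X j * f) = X j * divDiff v f + C (2 * v j / ∑ l, v l ^ 2) * reflect v f := by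
  apply divDiff_eq_of_mul_eq hv
  rw [map_mul, reflect_X]
  linear_combination X j * linForm_mul_divDiff hv f

theorem divDiff_C {N : ℕ} {v : Fin N → ℝ} (hv : v ≠ 0) (a : ℝ) : divDiff v (C a) = 0 := by
  apply divDiff_eq_of_mul_eq hv
  simp [reflect, MvPolynomial.algebraMap_eq]

theorem divDiff_mul_of_reflect_eq {N : ℕ} {v : Fin N → ℝ} (hv : v ≠ 0)
    {f g : MvPolynomial (Fin N) ℝ} (hg : reflect v g = g) :
    divDiff v (f * g) = divDiff v f * g := by
  apply divDiff_eq_of_mul_eq hv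
  rw [map_mul, hg]
  linear_combination g * linForm_mul_divDiff hv f

/-- The transport principle for divided differences: an algebra map that intertwines two reflections
and matches their linear forms up to a scalar also matches the quotients. It is applied to
permutations, to sign changes (where c = -1 occurs) and to the substitution y = Hx. -/
theorem divDiff_map {M N : ℕ} {v : Fin M → ℝ} {v' : Fin N → ℝ} (hv : v ≠ 0) (hv' : v' ≠ 0)
    (φ : MvPolynomial (Fin M) ℝ →ₐ[ℝ] MvPolynomial (Fin N) ℝ) (c : ℝ)
    (h1 : φ (linForm v) = C c * linForm v')
    (h2 : ∀ i, reflect v' (φ (X i)) = φ (reflect v (X i))) (f : MvPolynomial (Fin M) ℝ) :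
    divDiff v' (φ f) = C c * φ (divDiff v f) := by
  have h3 : (reflect v').comp φ = φ.comp (reflect v) := MvPolynomial.algHom_ext h2
  have h4 : reflect v' (φ f) = φ (reflect v f) := DFunLike.congr_fun h3 f
  apply divDiff_eq_of_mul_eq hv'
  rw [h4, ← map_sub, ← linForm_mul_divDiff hv f, map_mul, h1]
  ring

theorem rootSub_ne_zero {N : ℕ} {i j : Fin N} (h : i ≠ j) : rootSub i j ≠ 0 := by
  intro h0
  have := congrFun h0 i
  simp [rootSub, h] at this

theorem rootAdd_ne_zero {N : ℕ} {i j : Fin N} (h : i ≠ j) : rootAdd i j ≠ 0 := by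
  intro h0
  have := congrFun h0 i
  simp [rootAdd, h] at this

theorem linForm_rootSub {N : ℕ} (i j : Fin N) : linForm (rootSub i j) = X i - X j := by
  simp [linForm, rootSub, Pi.single_apply, sub_mul, Finset.sum_sub_distrib, ite_mul, apply_ite C]

theorem linForm_rootAdd {N : ℕ} (i j : Fin N) : linForm (rootAdd i j) = X i + X j := by
  simp [linForm, rootAdd, Pi.single_apply, add_mul, Finset.sum_add_distrib, ite_mul, apply_ite C]

theorem sum_sq_rootSub {N : ℕ} {i j : Fin N} (hij : i ≠ j) : ∑ l, (rootSub i j l) ^ 2 = 2 := by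
  have h : ∀ l, (rootSub i j l : ℝ) ^ 2 = (if l = i then 1 else 0) + (if l = j then 1 else 0) := by
    intro l
    by_cases h1 : l = i
    · subst h1; simp [rootSub, hij]
    · by_cases h2 : l = j
      · subst h2; simp [rootSub, h1]
      · simp [rootSub, h1, h2]
  rw [Finset.sum_congr rfl fun l _ => h l, Finset.sum_add_distrib]
  norm_num

theorem sum_sq_rootAdd {N : ℕ} {i j : Fin N} (hij : i ≠ j) : ∑ l, (rootAdd i j l) ^ 2 = 2 := by
  have h : ∀ l, (rootAdd i j l : ℝ) ^ 2 = (if l = i then 1 else 0) + (if l = j then 1 else 0) := by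
    intro l
    by_cases h1 : l = i
    · subst h1; simp [rootAdd, hij]
    · by_cases h2 : l = j
      · subst h2; simp [rootAdd, h1]
      · simp [rootAdd, h1, h2]
  rw [Finset.sum_congr rfl fun l _ => h l, Finset.sum_add_distrib]
  norm_num

/-- The reflection in `x_i + x_j = 0`. -/
def tau {N : ℕ} (i j : Fin N) : MvPolynomial (Fin N) ℝ →ₐ[ℝ] MvPolynomial (Fin N) ℝ :=
  aeval fun l => if l = i then -X j else if l = j then -X i else X l

theorem reflect_rootAdd {N : ℕ} {i j : Fin N} (hij : i ≠ j) (f : MvPolynomial (Fin N) ℝ) :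
    reflect (rootAdd i j) f = tau i j f := by
  have h : reflect (rootAdd i j) = tau i j := by
    apply MvPolynomial.algHom_ext
    intro l
    rw [reflect_X, sum_sq_rootAdd hij, linForm_rootAdd]
    by_cases h1 : l = i
    · subst h1; simp [rootAdd, tau, hij]
    · by_cases h2 : l = j
      · subst h2; simp [rootAdd, tau, h1]
      · simp [rootAdd, tau, h1, h2]
  rw [h]

/-- The change of sign of the coordinate `l`. -/
def signFlip {N : ℕ} (l : Fin N) : MvPolynomial (Fin N) ℝ →ₐ[ℝ] MvPolynomial (Fin N) ℝ :=
  aeval fun i => if i = l then -X i else X i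

theorem signFlip_X {N : ℕ} (l i : Fin N) :
    signFlip l (X i) = if i = l then -X i else (X i : MvPolynomial (Fin N) ℝ) := by
  simp [signFlip]

theorem tau_X {N : ℕ} (i j l : Fin N) :
    tau i j (X l) = if l = i then -X j else if l = j then -X i else X l := by
  simp [tau]

/-- Reduces facts about τ_ij to permutations and sign changes. A single sign change lies outside
D_3, but it normalizes that group. -/
theorem tau_eq {N : ℕ} {i j : Fin N} (hij : i ≠ j) (f : MvPolynomial (Fin N) ℝ) :
    tau i j f = signFlip i (signFlip j (rename (Equiv.swap i j) f)) := by
  have h : tau i j = (signFlip i).comp ((signFlip j).comp (rename (R := ℝ) (Equiv.swap i j))) := by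
    apply MvPolynomial.algHom_ext
    intro l
    simp only [tau_X, AlgHom.comp_apply, rename_X]
    by_cases h1 : l = i
    · subst h1; simp [signFlip_X, hij.symm]
    · by_cases h2 : l = j
      · subst h2; simp [signFlip_X, h1, hij]
      · simp [signFlip_X, h1, h2, Equiv.swap_apply_of_ne_of_ne h1 h2]
  rw [h]; rfl

theorem divDiff_rootSub_X_mul {N : ℕ} {i j : Fin N} (hij : i ≠ j) (l : Fin N)
    (f : MvPolynomial (Fin N) ℝ) :
    divDiff (rootSub i j) (X l * f) = X l * divDiff (rootSub i j) f
      + ((if l = i then 1 else 0) - (if l = j then 1 else 0) : ℝ)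
        • rename (Equiv.swap i j) f := by
  rw [divDiff_X_mul (rootSub_ne_zero hij), sum_sq_rootSub hij, reflect_rootSub hij,
    smul_eq_C_mul]
  congr 3
  simp [rootSub, Pi.single_apply]

theorem divDiff_rootAdd_X_mul {N : ℕ} {i j : Fin N} (hij : i ≠ j) (l : Fin N)
    (f : MvPolynomial (Fin N) ℝ) :
    divDiff (rootAdd i j) (X l * f) = X l * divDiff (rootAdd i j) f
      + ((if l = i then 1 else 0) + (if l = j then 1 else 0) : ℝ) • tau i j f := by
  rw [divDiff_X_mul (rootAdd_ne_zero hij), sum_sq_rootAdd hij, reflect_rootAdd hij,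
    smul_eq_C_mul]
  congr 3
  simp [rootAdd, Pi.single_apply]

theorem rename_divDiff_rootSub {N : ℕ} {i j : Fin N} (hij : i ≠ j) (w : Equiv.Perm (Fin N))
    (f : MvPolynomial (Fin N) ℝ) :
    rename w (divDiff (rootSub i j) f) = divDiff (rootSub (w i) (w j)) (rename w f) := by
  have hw : w i ≠ w j := w.injective.ne hij
  rw [divDiff_map (rootSub_ne_zero hij) (rootSub_ne_zero hw) (rename w) 1 (by simp [linForm_rootSub])]
  · simp
  · intro l
    simp only [reflect_rootSub hij, reflect_rootSub hw, rename_X]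
    rw [w.injective.swap_apply]

theorem rename_divDiff_rootAdd {N : ℕ} {i j : Fin N} (hij : i ≠ j) (w : Equiv.Perm (Fin N))
    (f : MvPolynomial (Fin N) ℝ) :
    rename w (divDiff (rootAdd i j) f) = divDiff (rootAdd (w i) (w j)) (rename w f) := by
  have hw : w i ≠ w j := w.injective.ne hij
  rw [divDiff_map (rootAdd_ne_zero hij) (rootAdd_ne_zero hw) (rename w) 1 (by simp [linForm_rootAdd])]
  · simp
  · intro l
    simp only [reflect_rootAdd hij, reflect_rootAdd hw, rename_X, tau_X, apply_ite (rename w),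
      map_neg, w.injective.eq_iff]

theorem rename_pderiv {N : ℕ} (w : Equiv.Perm (Fin N)) (i : Fin N) (f : MvPolynomial (Fin N) ℝ) :
    rename w (pderiv i f) = pderiv (w i) (rename w f) :=
  (pderiv_rename w.injective i f).symm

theorem sum_erase_perm {N : ℕ} {M : Type*} [AddCommMonoid M] (w : Equiv.Perm (Fin N)) (i : Fin N)
    (F : Fin N → M) :
    ∑ j ∈ Finset.univ.erase i, F (w j) = ∑ j ∈ Finset.univ.erase (w i), F j := by
  refine Finset.sum_bij (fun j _ => w j) ?_ ?_ ?_ ?_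
  · intro a ha; simpa using ha
  · intro a _ b _ h; exact w.injective h
  · intro b hb
    refine ⟨w.symm b, ?_, by simp⟩
    simp only [Finset.mem_erase, Finset.mem_univ, and_true] at hb ⊢
    intro h; apply hb; rw [← h]; simp
  · intro a _; rfl

/-! ### Dunkl operators: equivariance and commutation with multiplication by a variable. -/

theorem dunklA_apply {N : ℕ} (κ : ℝ) (i : Fin N) (f : MvPolynomial (Fin N) ℝ) :
    dunklA κ i f = pderiv i f + κ • ∑ j ∈ Finset.univ.erase i, divDiff (rootSub i j) f := by
  simp [dunklA, LinearMap.sum_apply]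

theorem dunklD_apply (κ : ℝ) (i : Fin 3) (f : MvPolynomial (Fin 3) ℝ) :
    dunklD κ i f = pderiv i f + κ • ∑ j ∈ Finset.univ.erase i,
      (divDiff (rootSub i j) f + divDiff (rootAdd i j) f) := by
  simp [dunklD, LinearMap.sum_apply]

theorem rename_dunklA {N : ℕ} (κ : ℝ) (w : Equiv.Perm (Fin N)) (i : Fin N)
    (f : MvPolynomial (Fin N) ℝ) :
    rename w (dunklA κ i f) = dunklA κ (w i) (rename w f) := by
  rw [dunklA_apply, dunklA_apply, map_add, map_smul, map_sum, rename_pderiv,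
    ← sum_erase_perm w i fun j => divDiff (rootSub (w i) j) (rename w f)]
  congr 2
  refine Finset.sum_congr rfl fun j hj => ?_
  exact rename_divDiff_rootSub (Finset.ne_of_mem_erase hj).symm w f

theorem rename_dunklD (κ : ℝ) (w : Equiv.Perm (Fin 3)) (i : Fin 3)
    (f : MvPolynomial (Fin 3) ℝ) :
    rename w (dunklD κ i f) = dunklD κ (w i) (rename w f) := by
  rw [dunklD_apply, dunklD_apply, map_add, map_smul, map_sum, rename_pderiv,
    ← sum_erase_perm w i fun j => divDiff (rootSub (w i) j) (rename w f)
      + divDiff (rootAdd (w i) j) (rename w f)]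
  congr 2
  refine Finset.sum_congr rfl fun j hj => ?_
  rw [map_add, rename_divDiff_rootSub (Finset.ne_of_mem_erase hj).symm w f,
    rename_divDiff_rootAdd (Finset.ne_of_mem_erase hj).symm w f]

theorem pderiv_signFlip {N : ℕ} (l i : Fin N) (f : MvPolynomial (Fin N) ℝ) :
    pderiv i (signFlip l f) = (if i = l then -1 else 1 : ℝ) • signFlip l (pderiv i f) := by
  induction f using MvPolynomial.induction_on with
  | C a => simp [signFlip, MvPolynomial.algebraMap_eq]
  | add p q hp hq => simp only [map_add, hp, hq, smul_add]
  | mul_X p j hp =>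
    simp only [map_mul, Derivation.leibniz, hp, signFlip_X, pderiv_X, smul_eq_mul, map_add]
    by_cases h1 : j = l <;> by_cases h2 : i = l <;> by_cases h3 : j = i <;>
      simp [h1, h2, h3]

theorem signFlip_signFlip {N : ℕ} (l : Fin N) (f : MvPolynomial (Fin N) ℝ) :
    signFlip l (signFlip l f) = f := by
  have h : (signFlip l).comp (signFlip l) = AlgHom.id ℝ (MvPolynomial (Fin N) ℝ) := by
    apply MvPolynomial.algHom_ext
    intro i
    by_cases h : i = l <;> simp [signFlip_X, h]
  exact DFunLike.congr_fun h f

theorem divDiff_signFlip_rootSub {N : ℕ} {i j : Fin N} (hij : i ≠ j) (l : Fin N)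
    (f : MvPolynomial (Fin N) ℝ) :
    divDiff (rootSub i j) (signFlip l f) =
      if l = i then -signFlip l (divDiff (rootAdd i j) f)
      else if l = j then signFlip l (divDiff (rootAdd i j) f)
      else signFlip l (divDiff (rootSub i j) f) := by
  split_ifs with h1 h2
  · subst h1
    rw [divDiff_map (rootAdd_ne_zero hij) (rootSub_ne_zero hij) (signFlip l) (-1)]
    · simp
    · simp [linForm_rootSub, linForm_rootAdd, signFlip_X, hij.symm]; ring
    · intro m
      simp only [reflect_rootAdd hij, reflect_rootSub hij, tau_X, signFlip_X, 
        apply_ite (rename (Equiv.swap l j)), map_neg, rename_X, apply_ite (signFlip l)]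
      by_cases ha : m = l
      · subst ha; simp [hij.symm]
      · by_cases hb : m = j
        · subst hb; simp [ha]
        · simp [ha, hb, Equiv.swap_apply_of_ne_of_ne ha hb]
  · subst h2
    rw [divDiff_map (rootAdd_ne_zero hij) (rootSub_ne_zero hij) (signFlip l) 1]
    · simp
    · simp [linForm_rootSub, linForm_rootAdd, signFlip_X, hij]; ring
    · intro m
      simp only [reflect_rootAdd hij, reflect_rootSub hij, tau_X, signFlip_X, 
        apply_ite (rename (Equiv.swap i l)), map_neg, rename_X, apply_ite (signFlip l)]
      by_cases ha : m = i
      · subst ha; simp [hij]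
      · by_cases hb : m = l
        · subst hb; simp [ha, hij]
        · simp [ha, hb, Equiv.swap_apply_of_ne_of_ne ha hb]
  · rw [divDiff_map (rootSub_ne_zero hij) (rootSub_ne_zero hij) (signFlip l) 1]
    · simp
    · simp [linForm_rootSub, signFlip_X, Ne.symm h1, Ne.symm h2]
    · intro m
      simp only [reflect_rootSub hij, signFlip_X, 
        apply_ite (rename (Equiv.swap i j)), map_neg, rename_X]
      by_cases ha : m = i
      · subst ha; simp [Ne.symm h1, Ne.symm h2]
      · by_cases hb : m = j
        · subst hb; simp [Ne.symm h1, Ne.symm h2]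
        · simp [Equiv.swap_apply_of_ne_of_ne ha hb]

theorem divDiff_signFlip_rootAdd {N : ℕ} {i j : Fin N} (hij : i ≠ j) (l : Fin N)
    (f : MvPolynomial (Fin N) ℝ) :
    divDiff (rootAdd i j) (signFlip l f) =
      if l = i then -signFlip l (divDiff (rootSub i j) f)
      else if l = j then signFlip l (divDiff (rootSub i j) f)
      else signFlip l (divDiff (rootAdd i j) f) := by
  split_ifs with h1 h2
  · have h := divDiff_signFlip_rootSub hij l (signFlip l f)
    rw [if_pos h1, signFlip_signFlip] at h
    rw [h, map_neg, signFlip_signFlip, neg_neg]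
  · have h := divDiff_signFlip_rootSub hij l (signFlip l f)
    rw [if_neg h1, if_pos h2, signFlip_signFlip] at h
    rw [h, signFlip_signFlip]
  · rw [divDiff_map (rootAdd_ne_zero hij) (rootAdd_ne_zero hij) (signFlip l) 1]
    · simp
    · simp [linForm_rootAdd, signFlip_X, Ne.symm h1, Ne.symm h2]
    · intro m
      simp only [reflect_rootAdd hij, signFlip_X, tau_X, map_neg, apply_ite (signFlip l),
        apply_ite (tau i j)]
      by_cases ha : m = i
      · subst ha; simp [Ne.symm h1, Ne.symm h2]
      · by_cases hb : m = j
        · subst hb; simp [Ne.symm h1, Ne.symm h2]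
        · simp [ha, hb]

/-- Sign changes permute the roots of D_3 up to sign, so the operators are equivariant under all of
B_3. This extra symmetry later separates the parity classes of the p_γ. -/
theorem dunklD_signFlip (κ : ℝ) (l i : Fin 3) (f : MvPolynomial (Fin 3) ℝ) :
    dunklD κ i (signFlip l f) = (if i = l then -1 else 1 : ℝ) • signFlip l (dunklD κ i f) := by
  rw [dunklD_apply, dunklD_apply, map_add, smul_add, pderiv_signFlip, map_smul, map_sum,
    smul_comm, Finset.smul_sum (r := (if i = l then -1 else 1 : ℝ))]
  congr 2
  refine Finset.sum_congr rfl fun j hj => ?_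
  have hij := (Finset.ne_of_mem_erase hj).symm
  rw [divDiff_signFlip_rootSub hij, divDiff_signFlip_rootAdd hij, map_add]
  by_cases h1 : l = i
  · subst h1; simp; ring
  · by_cases h2 : l = j
    · subst h2; simp [h1, hij]; ring
    · simp [h1, h2, Ne.symm h1]

theorem dunklD_C (κ : ℝ) (i : Fin 3) (a : ℝ) : dunklD κ i (C a) = 0 := by
  rw [dunklD_apply, Finset.sum_eq_zero]
  · simp
  · intro j hj
    rw [divDiff_C (rootSub_ne_zero (Finset.ne_of_mem_erase hj).symm) a,
      divDiff_C (rootAdd_ne_zero (Finset.ne_of_mem_erase hj).symm) a, add_zero]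

/-- Each divided difference obeys a twisted Leibniz rule, and every root of the sum has coefficient
1 at x_i, so every one leaves a reflection term. For a variable x_k with k ≠ i only the root e_i -
e_k does. -/
theorem dunklA_X_mul_self {N : ℕ} (κ : ℝ) (i : Fin N) (f : MvPolynomial (Fin N) ℝ) :
    dunklA κ i (X i * f) = X i * dunklA κ i f + f
      + κ • ∑ l ∈ Finset.univ.erase i, rename (Equiv.swap i l) f := by
  have h : ∑ j ∈ Finset.univ.erase i, divDiff (rootSub i j) (X i * f)
      = X i * ∑ j ∈ Finset.univ.erase i, divDiff (rootSub i j) f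
        + ∑ l ∈ Finset.univ.erase i, rename (Equiv.swap i l) f := by
    rw [Finset.mul_sum, ← Finset.sum_add_distrib]
    refine Finset.sum_congr rfl fun j hj => ?_
    have hij := (Finset.ne_of_mem_erase hj).symm
    rw [divDiff_rootSub_X_mul hij]; simp [hij]
  rw [dunklA_apply, dunklA_apply, h]
  simp only [Derivation.leibniz, pderiv_X_self, smul_eq_mul, smul_add, mul_add, mul_smul_comm]
  ring

theorem dunklA_X_mul_of_ne {N : ℕ} (κ : ℝ) {i k : Fin N} (hik : i ≠ k)
    (f : MvPolynomial (Fin N) ℝ) :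
    dunklA κ i (X k * f) = X k * dunklA κ i f - κ • rename (Equiv.swap i k) f := by
  have h : ∑ j ∈ Finset.univ.erase i, divDiff (rootSub i j) (X k * f)
      = X k * ∑ j ∈ Finset.univ.erase i, divDiff (rootSub i j) f
        - rename (Equiv.swap i k) f := by
    rw [Finset.mul_sum, sub_eq_add_neg]
    have : - rename (Equiv.swap i k) f = ∑ j ∈ Finset.univ.erase i,
        if j = k then - rename (Equiv.swap i j) f else 0 := by
      rw [Finset.sum_ite_eq']; simp [hik.symm]
    rw [this, ← Finset.sum_add_distrib]
    refine Finset.sum_congr rfl fun j hj => ?_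
    have hij := (Finset.ne_of_mem_erase hj).symm
    rw [divDiff_rootSub_X_mul hij]
    by_cases hjk : j = k
    · subst hjk; simp [hij.symm]
    · simp [hik.symm, hjk, Ne.symm hjk]
  rw [dunklA_apply, dunklA_apply, h]
  simp only [Derivation.leibniz, pderiv_X_of_ne hik.symm, smul_eq_mul, smul_sub, mul_add,
    mul_smul_comm]
  ring

theorem dunklD_X_mul_self (κ : ℝ) (i : Fin 3) (f : MvPolynomial (Fin 3) ℝ) :
    dunklD κ i (X i * f) = X i * dunklD κ i f + f
      + κ • ∑ l ∈ Finset.univ.erase i, (rename (Equiv.swap i l) f + tau i l f) := by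
  have h : ∑ j ∈ Finset.univ.erase i,
        (divDiff (rootSub i j) (X i * f) + divDiff (rootAdd i j) (X i * f))
      = X i * ∑ j ∈ Finset.univ.erase i, (divDiff (rootSub i j) f + divDiff (rootAdd i j) f)
        + ∑ l ∈ Finset.univ.erase i, (rename (Equiv.swap i l) f + tau i l f) := by
    rw [Finset.mul_sum, ← Finset.sum_add_distrib]
    refine Finset.sum_congr rfl fun j hj => ?_
    have hij := (Finset.ne_of_mem_erase hj).symm
    rw [divDiff_rootSub_X_mul hij, divDiff_rootAdd_X_mul hij]; simp [hij]; ring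
  rw [dunklD_apply, dunklD_apply, h]
  simp only [Derivation.leibniz, pderiv_X_self, smul_eq_mul, smul_add, mul_add, mul_smul_comm]
  ring

theorem dunklD_X_mul_of_ne (κ : ℝ) {i k : Fin 3} (hik : i ≠ k) (f : MvPolynomial (Fin 3) ℝ) :
    dunklD κ i (X k * f) = X k * dunklD κ i f
      + κ • (tau i k f - rename (Equiv.swap i k) f) := by
  have h : ∑ j ∈ Finset.univ.erase i,
        (divDiff (rootSub i j) (X k * f) + divDiff (rootAdd i j) (X k * f))
      = X k * ∑ j ∈ Finset.univ.erase i, (divDiff (rootSub i j) f + divDiff (rootAdd i j) f)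
        + (tau i k f - rename (Equiv.swap i k) f) := by
    rw [Finset.mul_sum]
    have : tau i k f - rename (Equiv.swap i k) f = ∑ j ∈ Finset.univ.erase i,
        if j = k then tau i j f - rename (Equiv.swap i j) f else 0 := by
      rw [Finset.sum_ite_eq']; simp [hik.symm]
    rw [this, ← Finset.sum_add_distrib]
    refine Finset.sum_congr rfl fun j hj => ?_
    have hij := (Finset.ne_of_mem_erase hj).symm
    rw [divDiff_rootSub_X_mul hij, divDiff_rootAdd_X_mul hij]
    by_cases hjk : j = k
    · subst hjk; simp [hij.symm]; ring
    · simp [hik.symm, hjk, Ne.symm hjk]; ring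
  rw [dunklD_apply, dunklD_apply, h]
  simp only [Derivation.leibniz, pderiv_X_of_ne hik.symm, smul_eq_mul, smul_add, mul_add,
    mul_smul_comm]
  ring

/-! ### The pairing of a commuting family of operators -/

/-- The pairing is defined through an ordered product. Commutativity is what allows one more factor
D_i to be moved to its right end, where it acts first. -/
theorem prod_ofFn_pow_add_single {M : Type*} [Monoid M] : ∀ {n : ℕ} (D : Fin n → M)
    (_ : ∀ i j, Commute (D i) (D j)) (m : Fin n → ℕ) (i : Fin n),
    (List.ofFn fun j => D j ^ (m j + if j = i then 1 else 0)).prod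
      = (List.ofFn fun j => D j ^ m j).prod * D i := by
  intro n
  induction n with
  | zero => intro D _ m i; exact i.elim0
  | succ n ih =>
    intro D hD m i
    rw [List.ofFn_succ, List.ofFn_succ, List.prod_cons, List.prod_cons]
    refine Fin.cases ?_ (fun i => ?_) i
    · have hc : Commute (D 0) (List.ofFn fun j : Fin n => D j.succ ^ m j.succ).prod := by
        refine Commute.list_prod_right _ _ fun x hx => ?_
        obtain ⟨j, rfl⟩ := (List.mem_ofFn' _ _).1 hx
        exact (hD _ _).pow_right _
      simp only [if_true, pow_succ, Fin.succ_ne_zero, if_false, add_zero]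
      rw [mul_assoc, mul_assoc, hc.eq]
    · have h := ih (fun j => D j.succ) (fun a b => hD _ _) (fun j => m j.succ) i
      simp only [Fin.succ_inj, (Fin.succ_ne_zero i).symm, if_false, add_zero]
      rw [h, mul_assoc]

/-- Evaluation of a polynomial at a family of operators. -/
def opEval {N : ℕ} (D : Fin N → Module.End ℝ (MvPolynomial (Fin N) ℝ)) :
    MvPolynomial (Fin N) ℝ →ₗ[ℝ] Module.End ℝ (MvPolynomial (Fin N) ℝ) :=
  (basisMonomials (Fin N) ℝ).constr ℝ fun m => (List.ofFn fun i => D i ^ m i).prod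

section Pairing

variable {N : ℕ} {D : Fin N → Module.End ℝ (MvPolynomial (Fin N) ℝ)}

theorem pairing_eq (D : Fin N → Module.End ℝ (MvPolynomial (Fin N) ℝ))
    (f g : MvPolynomial (Fin N) ℝ) : pairing D f g = constantCoeff (opEval D f g) := by
  rw [pairing, opEval, Module.Basis.constr_apply, Finsupp.sum, LinearMap.sum_apply]
  rfl

theorem pairing_add_left (f f' g : MvPolynomial (Fin N) ℝ) :
    pairing D (f + f') g = pairing D f g + pairing D f' g := by
  simp [pairing_eq]

theorem pairing_add_right (f g g' : MvPolynomial (Fin N) ℝ) :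
    pairing D f (g + g') = pairing D f g + pairing D f g' := by
  simp [pairing_eq]

theorem pairing_smul_left (a : ℝ) (f g : MvPolynomial (Fin N) ℝ) :
    pairing D (a • f) g = a * pairing D f g := by
  simp [pairing_eq]

theorem pairing_smul_right (a : ℝ) (f g : MvPolynomial (Fin N) ℝ) :
    pairing D f (a • g) = a * pairing D f g := by
  simp [pairing_eq]

/-- The pairing as a bilinear map. -/
def pairingForm (D : Fin N → Module.End ℝ (MvPolynomial (Fin N) ℝ)) :
    MvPolynomial (Fin N) ℝ →ₗ[ℝ] MvPolynomial (Fin N) ℝ →ₗ[ℝ] ℝ :=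
  LinearMap.mk₂ ℝ (pairing D) pairing_add_left pairing_smul_left pairing_add_right
    pairing_smul_right

theorem pairingForm_apply (f g : MvPolynomial (Fin N) ℝ) :
    pairingForm D f g = pairing D f g := rfl

theorem opEval_monomial (m : Fin N →₀ ℕ) (a : ℝ) :
    opEval D (monomial m a) = a • (List.ofFn fun i => D i ^ m i).prod := by
  have h1 : (monomial m a : MvPolynomial (Fin N) ℝ) = a • basisMonomials (Fin N) ℝ m := by
    rw [coe_basisMonomials, smul_monomial, smul_eq_mul, mul_one]
  rw [h1, map_smul, opEval, Module.Basis.constr_basis]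

theorem pairing_C_left (a : ℝ) (g : MvPolynomial (Fin N) ℝ) :
    pairing D (C a) g = a * constantCoeff g := by
  rw [pairing_eq, ← monomial_zero', opEval_monomial]
  simp

/-- The recursion in the left argument on which the later inductions rest. -/
theorem pairing_X_mul_left (hD : ∀ i j, Commute (D i) (D j)) (i : Fin N)
    (f g : MvPolynomial (Fin N) ℝ) :
    pairing D (X i * f) g = pairing D f (D i g) := by
  have h : ∀ f, opEval D (X i * f) = opEval D f * D i := by
    intro f
    induction f using MvPolynomial.induction_on' with
    | monomial m a =>
      rw [mul_comm, X, monomial_mul, mul_one, opEval_monomial, opEval_monomial, smul_mul_assoc,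
        ← prod_ofFn_pow_add_single D hD]
      congr 4
      funext j
      rw [Finsupp.add_apply, Finsupp.single_apply]
      simp only [eq_comm]
    | add p q hp hq => rw [mul_add, map_add, hp, hq, map_add, add_mul]
  rw [pairing_eq, pairing_eq, h]; rfl

end Pairing

/-! ### Commutativity of the Dunkl operators of type `D_3` -/

theorem erase_eq_pair : ∀ {i j : Fin 3}, i ≠ j → ∃ l, l ≠ i ∧ l ≠ j ∧
    Finset.univ.erase i = {j, l} ∧ Finset.univ.erase j = {i, l} := by
  decide

theorem tau_dunklD {a b : Fin 3} (hab : a ≠ b) (κ : ℝ) (j : Fin 3) (f : MvPolynomial (Fin 3) ℝ) :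
    tau a b (dunklD κ j f) = if j = a then -dunklD κ b (tau a b f)
      else if j = b then -dunklD κ a (tau a b f) else dunklD κ j (tau a b f) := by
  have hs : ∀ l i f, signFlip l (dunklD κ i f)
      = (if i = l then -1 else 1 : ℝ) • dunklD κ i (signFlip l f) := by
    intro l i f
    rw [dunklD_signFlip, smul_smul]
    split_ifs <;> simp
  simp only [tau_eq hab, rename_dunklD, hs, map_smul]
  by_cases h1 : j = a
  · subst h1; simp [hab.symm]
  · by_cases h2 : j = b
    · subst h2; simp [hab, h1]
    · simp [h1, h2, Equiv.swap_apply_of_ne_of_ne h1 h2]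

theorem tau_comm {N : ℕ} (a b : Fin N) (f : MvPolynomial (Fin N) ℝ) :
    tau a b f = tau b a f := by
  have h : tau a b = (tau b a : MvPolynomial (Fin N) ℝ →ₐ[ℝ] _) := by
    apply MvPolynomial.algHom_ext
    intro i
    by_cases h : i = a
    · by_cases h' : i = b
      · subst h; subst h'; rfl
      · subst h; simp [tau_X, h']
    · by_cases h' : i = b <;> simp [tau_X, h, h']
  exact DFunLike.congr_fun h f

/-- Applied to T = [D_i, D_j], this reduces commutativity to the vanishing of the double commutators
[[D_i, D_j], y_k]. -/
theorem end_eq_zero_of_commute_X {N : ℕ} (T : Module.End ℝ (MvPolynomial (Fin N) ℝ))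
    (h0 : ∀ a, T (C a) = 0) (hX : ∀ k f, T (X k * f) = X k * T f) : T = 0 := by
  refine LinearMap.ext fun f => ?_
  induction f using MvPolynomial.induction_on with
  | C a => exact h0 a
  | add p q hp hq => rw [map_add, hp, hq]; simp
  | mul_X p k hp => rw [mul_comm, hX, hp]; simp

/-- The commutators [D_i, y_k] and [D_j, y_k] are combinations of reflections and the identity.
Equivariance moves the reflections past the remaining Dunkl operator, and the resulting terms
cancel. The excluded case k = i is recovered by exchanging i and j. -/
theorem dunklD_commutator_X (κ : ℝ) {i j : Fin 3} (hij : i ≠ j) (k : Fin 3)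
    (f : MvPolynomial (Fin 3) ℝ) (hk : k ≠ i) :
    dunklD κ i (dunklD κ j (X k * f)) - dunklD κ j (dunklD κ i (X k * f))
      = X k * (dunklD κ i (dunklD κ j f) - dunklD κ j (dunklD κ i f)) := by
  have hki := hk.symm
  by_cases hkj : k = j
  · subst hkj
    obtain ⟨l, hli, hlk, -, h2⟩ := erase_eq_pair hij
    have hil := hli.symm
    have hkl := hlk.symm
    rw [dunklD_X_mul_self, dunklD_X_mul_of_ne κ hki, h2, Finset.sum_pair hli.symm]
    simp only [map_add, map_smul, map_sub, dunklD_X_mul_self, dunklD_X_mul_of_ne κ hki, h2,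
      Finset.sum_pair hli.symm, rename_dunklD, tau_dunklD hki, tau_dunklD hk, tau_dunklD hkl,
      Equiv.swap_apply_left, Equiv.swap_apply_right, if_true, hk, hki, hil, if_false,
      Equiv.swap_apply_of_ne_of_ne hki hil, Equiv.swap_comm k i]
    rw [tau_comm k i]
    simp only [mul_sub]
    module
  · have hjk := Ne.symm hkj
    have hji := hij.symm
    simp only [dunklD_X_mul_of_ne κ hki, dunklD_X_mul_of_ne κ hjk, map_add, map_smul, map_sub,
      rename_dunklD, tau_dunklD hki, tau_dunklD hjk, hij, hji, hki, hjk, if_false,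
      Equiv.swap_apply_of_ne_of_ne hji hjk, Equiv.swap_apply_of_ne_of_ne hij hki, mul_sub]
    module

theorem dunklD_commute (κ : ℝ) (i j : Fin 3) : Commute (dunklD κ i) (dunklD κ j) := by
  by_cases hij : i = j
  · rw [hij]
  have h : dunklD κ i * dunklD κ j - dunklD κ j * dunklD κ i = 0 := by
    apply end_eq_zero_of_commute_X
    · intro a
      simp only [LinearMap.sub_apply, Module.End.mul_apply, dunklD_C, map_zero, sub_zero]
    · intro k f
      simp only [LinearMap.sub_apply, Module.End.mul_apply]
      by_cases hk : k = i
      · rw [← neg_sub, dunklD_commutator_X κ (Ne.symm hij) k f (fun h => hij (hk.symm.trans h)),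
          ← mul_neg, neg_sub]
      · exact dunklD_commutator_X κ hij k f hk
  exact sub_eq_zero.1 h

/-! ### Symmetry and invariance of the pairing of type `D_3` -/

theorem pairing_rename (κ : ℝ) (w : Equiv.Perm (Fin 3)) (f g : MvPolynomial (Fin 3) ℝ) :
    pairing (dunklD κ) (rename w f) (rename w g) = pairing (dunklD κ) f g := by
  induction f using MvPolynomial.induction_on generalizing g with
  | C a => rw [rename_C, pairing_C_left, pairing_C_left, constantCoeff_rename]
  | add p q hp hq => rw [map_add, pairing_add_left, hp, hq, pairing_add_left]
  | mul_X p k hp =>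
    rw [mul_comm, map_mul, rename_X, pairing_X_mul_left (dunklD_commute κ),
      pairing_X_mul_left (dunklD_commute κ), ← rename_dunklD, hp]

theorem pairing_signFlip (κ : ℝ) (l : Fin 3) (f g : MvPolynomial (Fin 3) ℝ) :
    pairing (dunklD κ) (signFlip l f) (signFlip l g) = pairing (dunklD κ) f g := by
  induction f using MvPolynomial.induction_on generalizing g with
  | C a =>
    have h : constantCoeff (signFlip l g) = constantCoeff g := by
      induction g using MvPolynomial.induction_on with
      | C b => simp [signFlip, MvPolynomial.algebraMap_eq]
      | add p q hp hq => rw [map_add, map_add, hp, hq, map_add]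
      | mul_X p k hp => rw [map_mul, map_mul, signFlip_X]; split_ifs <;> simp
    rw [show signFlip l (C a) = C a from AlgHom.commutes _ a, pairing_C_left, pairing_C_left, h]
  | add p q hp hq => rw [map_add, pairing_add_left, hp, hq, pairing_add_left]
  | mul_X p k hp =>
    have h : signFlip l (X k) = (if k = l then -1 else 1 : ℝ) • X k := by
      rw [signFlip_X]; split_ifs <;> simp
    rw [mul_comm, map_mul, h, smul_mul_assoc, pairing_smul_left,
      pairing_X_mul_left (dunklD_commute κ), dunklD_signFlip, pairing_smul_right,
      pairing_X_mul_left (dunklD_commute κ), hp]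
    split_ifs <;> simp

theorem pairing_tau (κ : ℝ) {a b : Fin 3} (hab : a ≠ b) (f g : MvPolynomial (Fin 3) ℝ) :
    pairing (dunklD κ) (tau a b f) (tau a b g) = pairing (dunklD κ) f g := by
  rw [tau_eq hab, tau_eq hab, pairing_signFlip, pairing_signFlip, pairing_rename]

theorem rename_swap_rename_swap {N : ℕ} (a b : Fin N) (f : MvPolynomial (Fin N) ℝ) :
    rename (Equiv.swap a b) (rename (Equiv.swap a b) f) = f := by
  rw [rename_rename, ← Equiv.coe_trans, Equiv.swap_swap]
  simp

theorem tau_tau {N : ℕ} {a b : Fin N} (hab : a ≠ b) (f : MvPolynomial (Fin N) ℝ) :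
    tau a b (tau a b f) = f := by
  have h : (tau a b).comp (tau a b) = AlgHom.id ℝ (MvPolynomial (Fin N) ℝ) := by
    apply MvPolynomial.algHom_ext
    intro i
    by_cases h : i = a
    · simp [tau_X, h, hab.symm]
    · by_cases h' : i = b
      · subst h'; simp [tau_X, h]
      · simp [tau_X, h, h']
  exact DFunLike.congr_fun h f

theorem pairing_rename_swap (κ : ℝ) (a b : Fin 3) (f g : MvPolynomial (Fin 3) ℝ) :
    pairing (dunklD κ) (rename (Equiv.swap a b) f) g
      = pairing (dunklD κ) f (rename (Equiv.swap a b) g) := by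
  rw [← pairing_rename κ (Equiv.swap a b), rename_swap_rename_swap]

theorem pairing_tau_left (κ : ℝ) {a b : Fin 3} (hab : a ≠ b) (f g : MvPolynomial (Fin 3) ℝ) :
    pairing (dunklD κ) (tau a b f) g = pairing (dunklD κ) f (tau a b g) := by
  rw [← pairing_tau κ hab, tau_tau hab]

theorem pairing_sum_left {N : ℕ} {ι : Type*} {D : Fin N → Module.End ℝ (MvPolynomial (Fin N) ℝ)}
    (s : Finset ι) (F : ι → MvPolynomial (Fin N) ℝ) (g : MvPolynomial (Fin N) ℝ) :
    pairing D (∑ i ∈ s, F i) g = ∑ i ∈ s, pairing D (F i) g := by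
  simp only [← pairingForm_apply, map_sum, LinearMap.sum_apply]

theorem pairing_sum_right {N : ℕ} {ι : Type*} {D : Fin N → Module.End ℝ (MvPolynomial (Fin N) ℝ)}
    (s : Finset ι) (F : ι → MvPolynomial (Fin N) ℝ) (g : MvPolynomial (Fin N) ℝ) :
    pairing D g (∑ i ∈ s, F i) = ∑ i ∈ s, pairing D g (F i) := by
  simp only [← pairingForm_apply, map_sum]

theorem pairing_sub_right {N : ℕ} {D : Fin N → Module.End ℝ (MvPolynomial (Fin N) ℝ)}
    (f g h : MvPolynomial (Fin N) ℝ) : pairing D f (g - h) = pairing D f g - pairing D f h := by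
  simp only [← pairingForm_apply, map_sub]

theorem pairing_sub_left {N : ℕ} {D : Fin N → Module.End ℝ (MvPolynomial (Fin N) ℝ)}
    (f g h : MvPolynomial (Fin N) ℝ) : pairing D (f - g) h = pairing D f h - pairing D g h := by
  simp only [← pairingForm_apply, map_sub, LinearMap.sub_apply]

/-- By induction on f. Peeling y_k off the left puts D_k in front of y_i g, while the claim has D_i
in front of y_k p. The commutators [D_k, y_i] and [D_i, y_k] involve the same reflections, which are
self-adjoint for the pairing, so the two expansions agree. -/
theorem pairing_X_mul_right (κ : ℝ) (i : Fin 3) (f g : MvPolynomial (Fin 3) ℝ) :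
    pairing (dunklD κ) f (X i * g) = pairing (dunklD κ) (dunklD κ i f) g := by
  induction f using MvPolynomial.induction_on generalizing i g with
  | C a => rw [pairing_C_left, dunklD_C, ← C_0, pairing_C_left]; simp
  | add p q hp hq => rw [map_add, pairing_add_left, hp, hq, pairing_add_left]
  | mul_X p k hp =>
    rw [mul_comm, pairing_X_mul_left (dunklD_commute κ)]
    by_cases hki : k = i
    · subst hki
      rw [dunklD_X_mul_self, dunklD_X_mul_self]
      simp only [pairing_add_left, pairing_add_right, pairing_smul_left, pairing_smul_right,
        pairing_sum_left, pairing_sum_right, hp, pairing_X_mul_left (dunklD_commute κ)]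
      congr 2
      refine Finset.sum_congr rfl fun l hl => ?_
      have hkl := (Finset.ne_of_mem_erase hl).symm
      rw [pairing_rename_swap, pairing_tau_left κ hkl]
    · rw [dunklD_X_mul_of_ne κ hki, dunklD_X_mul_of_ne κ (Ne.symm hki)]
      simp only [pairing_add_left, pairing_add_right, pairing_smul_left, pairing_smul_right, hp,
        pairing_X_mul_left (dunklD_commute κ), pairing_sub_left, pairing_sub_right,
        pairing_rename_swap, Equiv.swap_comm i k, tau_comm i k, pairing_tau_left κ hki]

theorem pairing_comm (κ : ℝ) (f g : MvPolynomial (Fin 3) ℝ) :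
    pairing (dunklD κ) f g = pairing (dunklD κ) g f := by
  induction f using MvPolynomial.induction_on generalizing g with
  | C a =>
    rw [pairing_C_left]
    induction g using MvPolynomial.induction_on with
    | C b => rw [pairing_C_left]; simp [mul_comm]
    | add p q hp hq => rw [map_add, mul_add, hp, hq, pairing_add_left]
    | mul_X p k hp =>
      rw [mul_comm p, pairing_X_mul_left (dunklD_commute κ), dunklD_C]
      simp [pairing_eq]
  | add p q hp hq => rw [pairing_add_left, hp, hq, pairing_add_right]
  | mul_X p k hp =>
    rw [mul_comm, pairing_X_mul_left (dunklD_commute κ), hp, pairing_X_mul_right]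

/-! ### Even polynomials and the operators `U_i` -/

/-- Substitution of the squares of the variables. -/
def sq : MvPolynomial (Fin 3) ℝ →ₐ[ℝ] MvPolynomial (Fin 3) ℝ :=
  aeval fun i => (X i : MvPolynomial (Fin 3) ℝ) ^ 2

theorem sq_X (i : Fin 3) : sq (X i) = X i ^ 2 := by simp [sq]

theorem rename_sq (w : Equiv.Perm (Fin 3)) (f : MvPolynomial (Fin 3) ℝ) :
    rename w (sq f) = sq (rename w f) := by
  have h : (rename (R := ℝ) w).comp sq = sq.comp (rename w) := by
    apply MvPolynomial.algHom_ext; intro i; simp [sq_X]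
  exact DFunLike.congr_fun h f

theorem signFlip_sq (l : Fin 3) (f : MvPolynomial (Fin 3) ℝ) : signFlip l (sq f) = sq f := by
  have h : (signFlip l).comp sq = sq := by
    apply MvPolynomial.algHom_ext; intro i
    simp only [AlgHom.comp_apply, sq_X, map_pow, signFlip_X]
    split_ifs <;> ring
  exact DFunLike.congr_fun h f

theorem tau_sq {i j : Fin 3} (hij : i ≠ j) (f : MvPolynomial (Fin 3) ℝ) :
    tau i j (sq f) = sq (rename (Equiv.swap i j) f) := by
  rw [tau_eq hij, rename_sq, signFlip_sq, signFlip_sq]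

theorem pderiv_sq (i : Fin 3) (f : MvPolynomial (Fin 3) ℝ) :
    pderiv i (sq f) = 2 * X i * sq (pderiv i f) := by
  induction f using MvPolynomial.induction_on with
  | C a => simp [sq, MvPolynomial.algebraMap_eq]
  | add p q hp hq => simp only [map_add, hp, hq, mul_add]
  | mul_X p j hp =>
    simp only [map_mul, Derivation.leibniz, hp, sq_X, smul_eq_mul, map_add,
      Derivation.leibniz_pow]
    by_cases h : j = i
    · subst h; simp; ring
    · simp [pderiv_X_of_ne h]; ring

/-- The identity is checked after clearing both denominators y_i - y_j and y_i + y_j. -/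
theorem divDiff_rootSub_add_rootAdd {i j : Fin 3} (hij : i ≠ j) {F G : MvPolynomial (Fin 3) ℝ}
    (h : (X i + X j) * (F - rename (Equiv.swap i j) F) + (X i - X j) * (F - tau i j F)
      = (X i - X j) * (X i + X j) * G) :
    divDiff (rootSub i j) F + divDiff (rootAdd i j) F = G := by
  have h1 := linForm_mul_divDiff (rootSub_ne_zero hij) F
  have h2 := linForm_mul_divDiff (rootAdd_ne_zero hij) F
  have h3 := linForm_ne_zero (rootSub_ne_zero hij)
  have h4 := linForm_ne_zero (rootAdd_ne_zero hij)
  rw [linForm_rootSub] at h1 h3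
  rw [linForm_rootAdd] at h2 h4
  rw [reflect_rootSub hij] at h1
  rw [reflect_rootAdd hij] at h2
  apply mul_left_cancel₀ (mul_ne_zero h3 h4)
  linear_combination (X i + X j) * h1 + (X i - X j) * h2 + h

section Factor

variable {i j : Fin 3} (hij : i ≠ j) {M R : MvPolynomial (Fin 3) ℝ} {a b : Prop} [Decidable a]
  [Decidable b] (hR : rename (Equiv.swap i j) R = R) (hR' : tau i j R = R)
  (hM : M = R * (if a then X i else 1) * (if b then X j else 1)) (f : MvPolynomial (Fin 3) ℝ)

include hij hR hR' hM

/-- Squaring the variables turns x_i - x_j into (y_i - y_j)(y_i + y_j), so the two roots of D_3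
together imitate one root of type A. Here a and b record whether y_i and y_j divide M. The imitation
is off by a reflection term exactly when y_j divides M and y_i does not. -/
theorem divDiff_rootSub_add_rootAdd_sq :
    divDiff (rootSub i j) (X i * (M * sq f)) + divDiff (rootAdd i j) (X i * (M * sq f))
      = 2 * M * (sq (divDiff (rootSub i j) (X i * f))
        - if b ∧ ¬a then sq (rename (Equiv.swap i j) f) else 0) := by
  apply divDiff_rootSub_add_rootAdd hij
  have hq := congrArg sq (linForm_mul_divDiff (rootSub_ne_zero hij) (X i * f))
  rw [reflect_rootSub hij, linForm_rootSub] at hq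
  simp only [map_mul, map_sub, sq_X, rename_X, Equiv.swap_apply_left] at hq
  subst hM
  simp only [map_mul, hR, hR', rename_sq, tau_sq hij, rename_X, tau_X, if_true,
    Equiv.swap_apply_left]
  by_cases ha : a <;> by_cases hb : b <;> simp [ha, hb, tau_X, hij.symm]
  · linear_combination (-2 * R * X i * X j) * hq
  · linear_combination (-2 * R * X i) * hq
  · linear_combination (-2 * R * X j) * hq
  · linear_combination (-2 * R) * hq

/-- The two reflections agree on squares and on R; on y_i and y_j they differ by a sign. They cancel
when exactly one of these variables divides M and double otherwise. -/
theorem rename_swap_add_tau_sq :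
    rename (Equiv.swap i j) (M * sq f) + tau i j (M * sq f)
      = if a ↔ b then 2 * M * sq (rename (Equiv.swap i j) f) else 0 := by
  subst hM
  simp only [map_mul, hR, hR', rename_sq, tau_sq hij]
  by_cases ha : a <;> by_cases hb : b <;> simp [ha, hb, tau_X, hij.symm] <;> ring

end Factor

theorem pderiv_X_mul_sq {i : Fin 3} {M R : MvPolynomial (Fin 3) ℝ} {a : Prop} [Decidable a]
    (hR : pderiv i R = 0) (hM : M = R * (if a then X i else 1)) (f : MvPolynomial (Fin 3) ℝ) :
    pderiv i (X i * (M * sq f))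
      = M * (2 * sq (pderiv i (X i * f)) - if a then 0 else sq f) := by
  subst hM
  by_cases ha : a <;> simp [ha, hR, pderiv_sq, sq_X] <;> ring

theorem yE_eq_prod (k : ℕ) : yE k = ∏ i : Fin 3, if (i : ℕ) < k then X i else 1 := by
  rw [yE, Finset.prod_filter]

theorem prod_fin_three {M : Type*} [CommMonoid M] {i j l : Fin 3} (hij : i ≠ j) (hli : l ≠ i)
    (hlj : l ≠ j) (F : Fin 3 → M) : ∏ m, F m = F l * F i * F j := by
  have h : (Finset.univ : Finset (Fin 3)) = {l, i, j} := by
    revert hij hli hlj; revert i j l; decide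
  rw [h, Finset.prod_insert (by simp [hli, hlj]), Finset.prod_pair hij, mul_assoc]

theorem exists_third {i j : Fin 3} (hij : i ≠ j) : ∃ l, l ≠ i ∧ l ≠ j :=
  let ⟨l, h1, h2, _⟩ := erase_eq_pair hij
  ⟨l, h1, h2⟩

/-- The operator `D_i y_i - κ ∑_{j < i} (σ_ij + τ_ij)` of type `D_3`. -/
def opUD (κ : ℝ) (i : Fin 3) (P : MvPolynomial (Fin 3) ℝ) : MvPolynomial (Fin 3) ℝ :=
  dunklD κ i (X i * P) - κ • ∑ j ∈ Finset.Iio i, (rename (Equiv.swap j i) P + tau j i P)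

theorem sum_Iio_eq_sum_erase {M : Type*} [AddCommMonoid M] (i : Fin 3) (F : Fin 3 → M) :
    ∑ j ∈ Finset.Iio i, F j = ∑ j ∈ Finset.univ.erase i, if j < i then F j else 0 := by
  rw [← Finset.sum_filter]
  congr 1
  ext j
  simpa using fun h => ne_of_lt h

theorem opU_apply {N : ℕ} (κ : ℝ) (i : Fin N) (f : MvPolynomial (Fin N) ℝ) :
    opU κ i f = dunklA κ i (X i * f)
      - κ • ∑ j ∈ Finset.Iio i, rename (Equiv.swap j i) f := by
  simp [opU, LinearMap.sum_apply]

/-- The bridge between D_3 and the operators of Jack type. The divided differences lack a reflection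
term precisely for j < k ≤ i, and there σ_ij + τ_ij contributes nothing although j < i; so the two
defects compensate. This is why the odd variables must be the first k ones. The term without κ comes
from ∂_i: for even degree e in y_i, the factor e + 1 is 2(e/2 + 1) - 1; for odd degree e it is
exactly 2((e-1)/2 + 1). -/
theorem opUD_yE_mul_sq (κ : ℝ) (i : Fin 3) (k : ℕ) (f : MvPolynomial (Fin 3) ℝ) :
    opUD κ i (yE k * sq f)
      = yE k * (2 * sq (opU κ i f) - if (i : ℕ) < k then 0 else sq f) := by
  have hfac : ∀ j, i ≠ j → ∃ R : MvPolynomial (Fin 3) ℝ, rename (Equiv.swap i j) R = R ∧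
      tau i j R = R ∧ pderiv i R = 0 ∧
      yE k = R * (if (i : ℕ) < k then X i else 1) * (if (j : ℕ) < k then X j else 1) := by
    intro j hij
    obtain ⟨l, hli, hlj⟩ := exists_third hij
    refine ⟨if (l : ℕ) < k then X l else 1, ?_, ?_, ?_, ?_⟩
    · split_ifs <;> simp [Equiv.swap_apply_of_ne_of_ne hli hlj]
    · split_ifs <;> simp [tau_X, hli, hlj]
    · split_ifs <;> simp [hli]
    · rw [yE_eq_prod, prod_fin_three hij hli hlj]
  have hp : pderiv i (X i * (yE k * sq f))
      = yE k * (2 * sq (pderiv i (X i * f)) - if (i : ℕ) < k then 0 else sq f) := by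
    obtain ⟨j, hj⟩ := exists_ne i
    obtain ⟨R, -, -, h3, h4⟩ := hfac j hj.symm
    refine pderiv_X_mul_sq (R := R * (if (j : ℕ) < k then X j else 1)) ?_ (by rw [h4]; ring) f
    split_ifs <;> simp [h3, hj]
  have hs : ∑ j ∈ Finset.univ.erase i, (divDiff (rootSub i j) (X i * (yE k * sq f))
        + divDiff (rootAdd i j) (X i * (yE k * sq f)))
      - ∑ j ∈ Finset.Iio i, (rename (Equiv.swap j i) (yE k * sq f) + tau j i (yE k * sq f))
      = yE k * (2 * (∑ j ∈ Finset.univ.erase i, sq (divDiff (rootSub i j) (X i * f))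
        - ∑ j ∈ Finset.Iio i, sq (rename (Equiv.swap j i) f))) := by
    rw [sum_Iio_eq_sum_erase, sum_Iio_eq_sum_erase, ← Finset.sum_sub_distrib,
      ← Finset.sum_sub_distrib, Finset.mul_sum, Finset.mul_sum]
    refine Finset.sum_congr rfl fun j hj => ?_
    have hij := (Finset.ne_of_mem_erase hj).symm
    obtain ⟨R, h1, h2, -, h4⟩ := hfac j hij
    rw [divDiff_rootSub_add_rootAdd_sq hij h1 h2 h4, tau_comm j i, Equiv.swap_comm j i,
      rename_swap_add_tau_sq hij h1 h2 h4]
    -- The terms match except for i < k ≤ j < i and for j < k ≤ i ≤ j, which are impossible.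
    by_cases hik : (i : ℕ) < k <;> by_cases hjk : (j : ℕ) < k <;> by_cases hji : j < i <;>
      simp [hik, hjk, hji] <;> first | (exfalso; omega) | ring
  rw [opUD, dunklD_apply, opU_apply, dunklA_apply, hp]
  simp only [map_add, map_sub, map_smul, map_sum]
  rw [add_sub_assoc, ← smul_sub, hs]
  simp only [smul_eq_C_mul]
  ring

/-- D_i y_i is the product of multiplication by y_i and its adjoint, and reflections are
self-adjoint. -/
theorem pairing_opUD (κ : ℝ) (i : Fin 3) (f g : MvPolynomial (Fin 3) ℝ) :
    pairing (dunklD κ) (opUD κ i f) g = pairing (dunklD κ) f (opUD κ i g) := by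
  rw [opUD, opUD, pairing_sub_left, pairing_sub_right, pairing_smul_left, pairing_smul_right,
    pairing_sum_left, pairing_sum_right, ← pairing_X_mul_right,
    ← pairing_X_mul_left (dunklD_commute κ)]
  congr 2
  refine Finset.sum_congr rfl fun j hj => ?_
  rw [pairing_add_left, pairing_add_right, pairing_rename_swap,
    pairing_tau_left κ (ne_of_lt (Finset.mem_Iio.1 hj))]

theorem opUD_yE_mul_sq_of_eigen {κ a : ℝ} {i : Fin 3} {f : MvPolynomial (Fin 3) ℝ}
    (hf : opU κ i f = a • f) (k : ℕ) :
    opUD κ i (yE k * sq f) = (2 * a - if (i : ℕ) < k then 0 else 1) • (yE k * sq f) := by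
  rw [opUD_yE_mul_sq, hf, map_smul]
  have h2 : (C 2 : MvPolynomial (Fin 3) ℝ) = 2 := map_ofNat C 2
  simp only [smul_eq_C_mul]
  split_ifs <;> simp [h2] <;> ring

/-- Eigenvectors of a self-adjoint operator: with a common k the eigenvalues are 2a - ε and 2b - ε
for the same ε, so they differ. -/
theorem pairing_eq_zero_of_eigen {κ a b : ℝ} {i : Fin 3} {f g : MvPolynomial (Fin 3) ℝ}
    (hf : opU κ i f = a • f) (hg : opU κ i g = b • g) (hab : a ≠ b) (k : ℕ) :
    pairing (dunklD κ) (yE k * sq f) (yE k * sq g) = 0 := by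
  have h := pairing_opUD κ i (yE k * sq f) (yE k * sq g)
  rw [opUD_yE_mul_sq_of_eigen hf, opUD_yE_mul_sq_of_eigen hg, pairing_smul_left,
    pairing_smul_right] at h
  have h' : 2 * (a - b) * pairing (dunklD κ) (yE k * sq f) (yE k * sq g) = 0 := by
    linear_combination h
  rcases mul_eq_zero.1 h' with h'' | h''
  · exact absurd (sub_eq_zero.1 (by linarith)) hab
  · exact h''

/-! ### Intertwining relations for the operators `U_i` -/

theorem rename_perm_mul {N : ℕ} (v w : Equiv.Perm (Fin N)) (f : MvPolynomial (Fin N) ℝ) :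
    rename v (rename w f) = rename (v * w) f := by
  rw [rename_rename]; rfl

theorem opU_zero (κ : ℝ) (f : MvPolynomial (Fin 3) ℝ) : opU κ 0 f = dunklA κ 0 (X 0 * f) := by
  rw [opU_apply, show Finset.Iio (0 : Fin 3) = ∅ by decide]; simp

theorem opU_one (κ : ℝ) (f : MvPolynomial (Fin 3) ℝ) :
    opU κ 1 f = dunklA κ 1 (X 1 * f) - κ • rename (Equiv.swap (0 : Fin 3) 1) f := by
  rw [opU_apply, show Finset.Iio (1 : Fin 3) = {0} by decide]; simp

theorem opU_two (κ : ℝ) (f : MvPolynomial (Fin 3) ℝ) :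
    opU κ 2 f = dunklA κ 2 (X 2 * f)
      - κ • (rename (Equiv.swap (0 : Fin 3) 2) f + rename (Equiv.swap (1 : Fin 3) 2) f) := by
  rw [opU_apply, show Finset.Iio (2 : Fin 3) = {0, 1} by decide, Finset.sum_pair (by decide)]

theorem rename_dunklA_X_mul (κ : ℝ) (w : Equiv.Perm (Fin 3)) (i : Fin 3)
    (f : MvPolynomial (Fin 3) ℝ) :
    rename w (dunklA κ i (X i * f)) = dunklA κ (w i) (X (w i) * rename w f) := by
  rw [rename_dunklA, map_mul, rename_X]

/-- Relations of the degenerate affine Hecke algebra. Conjugation by the transposition exchanges the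
terms D_i x_i; only the sums over j < i are not symmetric, and they differ by the transposition
itself, whose square gives the term κ f. -/
theorem opU_swap_zero_one (κ : ℝ) (f : MvPolynomial (Fin 3) ℝ) :
    opU κ 0 (rename (Equiv.swap (0 : Fin 3) 1) f)
        = rename (Equiv.swap (0 : Fin 3) 1) (opU κ 1 f) + κ • f ∧
    opU κ 1 (rename (Equiv.swap (0 : Fin 3) 1) f)
        = rename (Equiv.swap (0 : Fin 3) 1) (opU κ 0 f) - κ • f ∧
    opU κ 2 (rename (Equiv.swap (0 : Fin 3) 1) f)
        = rename (Equiv.swap (0 : Fin 3) 1) (opU κ 2 f) := by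
  simp only [opU_zero, opU_one, opU_two, map_sub, map_smul, map_add, rename_dunklA_X_mul,
    Equiv.swap_apply_left, Equiv.swap_apply_right, rename_perm_mul, Equiv.swap_mul_self,
    Equiv.Perm.coe_one, rename_id_apply]
  refine ⟨by abel, trivial, ?_⟩
  rw [show Equiv.swap (0 : Fin 3) 1 * Equiv.swap 0 2 = Equiv.swap 1 2 * Equiv.swap 0 1 by decide,
    show Equiv.swap (0 : Fin 3) 1 * Equiv.swap 1 2 = Equiv.swap 0 2 * Equiv.swap 0 1 by decide,
    show Equiv.swap (0 : Fin 3) 1 2 = 2 by decide, add_comm (rename _ f)]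

theorem opU_swap_one_two (κ : ℝ) (f : MvPolynomial (Fin 3) ℝ) :
    opU κ 1 (rename (Equiv.swap (1 : Fin 3) 2) f)
        = rename (Equiv.swap (1 : Fin 3) 2) (opU κ 2 f) + κ • f ∧
    opU κ 2 (rename (Equiv.swap (1 : Fin 3) 2) f)
        = rename (Equiv.swap (1 : Fin 3) 2) (opU κ 1 f) - κ • f ∧
    opU κ 0 (rename (Equiv.swap (1 : Fin 3) 2) f)
        = rename (Equiv.swap (1 : Fin 3) 2) (opU κ 0 f) := by
  simp only [opU_zero, opU_one, opU_two, map_sub, map_smul, map_add, rename_dunklA_X_mul,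
    Equiv.swap_apply_left, Equiv.swap_apply_right, rename_perm_mul, Equiv.swap_mul_self,
    Equiv.Perm.coe_one, rename_id_apply]
  rw [show Equiv.swap (1 : Fin 3) 2 * Equiv.swap 0 2 = Equiv.swap 0 1 * Equiv.swap 1 2 by decide,
    show Equiv.swap (1 : Fin 3) 2 * Equiv.swap 0 1 = Equiv.swap 0 2 * Equiv.swap 1 2 by decide,
    show Equiv.swap (1 : Fin 3) 2 0 = 0 by decide]
  refine ⟨?_, ?_, rfl⟩ <;> module

/-- The cyclic shift `0 ↦ 2 ↦ 1 ↦ 0`. -/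
def cyc : Equiv.Perm (Fin 3) := (finRotate 3)⁻¹

/-- The affine raising operator `f ↦ x_3 f(x_3, x_1, x_2)`. -/
def raise (f : MvPolynomial (Fin 3) ℝ) : MvPolynomial (Fin 3) ℝ := X 2 * rename cyc f

theorem erase_two : Finset.univ.erase (2 : Fin 3) = {0, 1} := by decide

/-- Moving D_0 or D_1 past the factor `X 2` creates a transposition with 2, which is the term that
the cyclic relabelling requires in the shifted U. For D_2 the transpositions created cancel those
subtracted in U_2, and the derivative adds 1 to the eigenvalue. -/
theorem opU_raise (κ : ℝ) (f : MvPolynomial (Fin 3) ℝ) :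
    opU κ 0 (raise f) = raise (opU κ 1 f) ∧ opU κ 1 (raise f) = raise (opU κ 2 f) ∧
    opU κ 2 (raise f) = raise (opU κ 0 f + f) := by
  have c0 : cyc 0 = 2 := by decide
  have c1 : cyc 1 = 0 := by decide
  have c2 : cyc 2 = 1 := by decide
  simp only [raise, opU_zero, opU_one, opU_two, map_sub, map_smul, map_add, rename_dunklA_X_mul,
    c0, c1, c2, mul_left_comm _ (X 2 : MvPolynomial (Fin 3) ℝ), map_mul, rename_X,
    dunklA_X_mul_of_ne κ (show (0 : Fin 3) ≠ 2 by decide),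
    dunklA_X_mul_of_ne κ (show (1 : Fin 3) ≠ 2 by decide), rename_perm_mul]
  rw [dunklA_X_mul_self κ 2, erase_two, Finset.sum_pair (by decide)]
  simp only [map_mul, rename_X, rename_perm_mul, Equiv.swap_apply_left, Equiv.swap_apply_right,
    Equiv.swap_comm (2 : Fin 3) 0, Equiv.swap_comm (2 : Fin 3) 1,
    show Equiv.swap (0 : Fin 3) 1 2 = 2 by decide,
    show cyc * Equiv.swap 0 1 = Equiv.swap (0 : Fin 3) 2 * cyc by decide,
    show cyc * Equiv.swap 0 2 = Equiv.swap (1 : Fin 3) 2 * cyc by decide,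
    show cyc * Equiv.swap 1 2 = Equiv.swap (0 : Fin 3) 1 * cyc by decide, mul_add, mul_sub,
    mul_smul_comm, smul_add, true_and]
  refine ⟨?_, ?_⟩ 
  · abel
  · abel

/-! ### The partial order on compositions with three parts -/

theorem sortDesc_eq_comp {N : ℕ} (α : Fin N → ℕ) :
    ∃ w : Equiv.Perm (Fin N), sortDesc α = α ∘ w :=
  ⟨Fin.revPerm.trans (Tuple.sort α), rfl⟩

theorem sortDesc_three (α : Fin 3 → ℕ) :
    sortDesc α 0 = max (max (α 0) (α 1)) (α 2) ∧ sortDesc α 2 = min (min (α 0) (α 1)) (α 2) ∧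
      sortDesc α 0 + sortDesc α 1 + sortDesc α 2 = α 0 + α 1 + α 2 := by
  obtain ⟨w, hw⟩ := sortDesc_eq_comp α
  have h1 : ∀ i, α i ≤ sortDesc α 0 := by
    intro i
    have := sortDesc_antitone α (Fin.zero_le (w⁻¹ i))
    rw [hw] at this ⊢
    simpa using this
  have h2 : ∀ i, sortDesc α 2 ≤ α i := by
    intro i
    have := sortDesc_antitone α (Fin.le_last (w⁻¹ i))
    rw [hw] at this ⊢
    simpa using this
  have h3 : sortDesc α 0 = α (w 0) := by rw [hw]; rfl
  have h4 : sortDesc α 2 = α (w 2) := by rw [hw]; rfl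
  have h5 : ∑ i, sortDesc α i = ∑ i, α i := by rw [hw]; exact Equiv.sum_comp w α
  rw [Fin.sum_univ_three, Fin.sum_univ_three] at h5
  have e : ∀ i : Fin 3, i = 0 ∨ i = 1 ∨ i = 2 := by decide
  have a0 := h1 0
  have a1 := h1 1
  have a2 := h1 2
  have b0 := h2 0
  have b1 := h2 1
  have b2 := h2 2
  refine ⟨?_, ?_, h5⟩
  · rcases e (w 0) with h | h | h <;> rw [h] at h3 <;> omega
  · rcases e (w 2) with h | h | h <;> rw [h] at h4 <;> omega

/-- With equal sums the second partial sum is controlled by the last entry. Together with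
`sortDesc_three` this turns the order on compositions into linear arithmetic in maxima and minima.
-/
theorem dominates_three (α β : Fin 3 → ℕ) (h : α 0 + α 1 + α 2 = β 0 + β 1 + β 2) :
    Dominates α β ↔ (α 0 ≠ β 0 ∨ α 2 ≠ β 2) ∧ β 0 ≤ α 0 ∧ α 2 ≤ β 2 := by
  have e0 : Finset.Iic (0 : Fin 3) = {0} := by decide
  have e1 : Finset.Iic (1 : Fin 3) = {0, 1} := by decide
  have e2 : Finset.Iic (2 : Fin 3) = {0, 1, 2} := by decide
  rw [Dominates, Ne, funext_iff]
  simp only [Fin.forall_fin_succ]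
  simp [e0, e1, e2]
  omega

theorem compGT_iff (α β : Fin 3 → ℕ) : CompGT α β ↔
    α 0 + α 1 + α 2 = β 0 + β 1 + β 2 ∧
    ((max (max (β 0) (β 1)) (β 2) ≤ max (max (α 0) (α 1)) (α 2) ∧
      min (min (α 0) (α 1)) (α 2) ≤ min (min (β 0) (β 1)) (β 2) ∧
      (max (max (α 0) (α 1)) (α 2) ≠ max (max (β 0) (β 1)) (β 2) ∨
        min (min (α 0) (α 1)) (α 2) ≠ min (min (β 0) (β 1)) (β 2))) ∨
    (max (max (α 0) (α 1)) (α 2) = max (max (β 0) (β 1)) (β 2) ∧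
      min (min (α 0) (α 1)) (α 2) = min (min (β 0) (β 1)) (β 2) ∧
      (α 0 ≠ β 0 ∨ α 2 ≠ β 2) ∧ β 0 ≤ α 0 ∧ α 2 ≤ β 2)) := by
  rw [CompGT, Fin.sum_univ_three, Fin.sum_univ_three]
  refine and_congr_right fun h => ?_
  obtain ⟨a0, a2, as⟩ := sortDesc_three α
  obtain ⟨b0, b2, bs⟩ := sortDesc_three β
  have hs : sortDesc α 0 + sortDesc α 1 + sortDesc α 2
      = sortDesc β 0 + sortDesc β 1 + sortDesc β 2 := by omega
  rw [dominates_three _ _ hs, dominates_three _ _ h, funext_iff]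
  have : (∀ i, sortDesc α i = sortDesc β i) ↔
      (sortDesc α 0 = sortDesc β 0 ∧ sortDesc α 2 = sortDesc β 2) := by
    constructor
    · intro h; exact ⟨h 0, h 2⟩
    · rintro ⟨h0, h2⟩ i
      fin_cases i
      · exact h0
      · change sortDesc α 1 = sortDesc β 1
        omega
      · exact h2
  rw [this, a0, a2, b0, b2]
  generalize max (max (α 0) (α 1)) (α 2) = A
  generalize max (max (β 0) (β 1)) (β 2) = B
  generalize min (min (α 0) (α 1)) (α 2) = A'
  generalize min (min (β 0) (β 1)) (β 2) = B'
  omega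

theorem CompGT.trans {α β γ : Fin 3 → ℕ} (h1 : CompGT α β) (h2 : CompGT β γ) : CompGT α γ := by
  rw [compGT_iff] at *
  generalize max (max (α 0) (α 1)) (α 2) = A at *
  generalize max (max (β 0) (β 1)) (β 2) = B at *
  generalize max (max (γ 0) (γ 1)) (γ 2) = E at *
  generalize min (min (α 0) (α 1)) (α 2) = A' at *
  generalize min (min (β 0) (β 1)) (β 2) = B' at *
  generalize min (min (γ 0) (γ 1)) (γ 2) = E' at *
  omega

/-- The height of a composition in the partial order. -/
def compHeight (α : Fin 3 → ℕ) : ℕ ×ₗ ℕ :=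
  toLex (max (max (α 0) (α 1)) (α 2) + (α 0 + α 1 + α 2) - min (min (α 0) (α 1)) (α 2),
    2 * α 0 + α 1)

/-- A strictly monotone map to a well-order, which supplies maximal exponents and inductions. When
the sorted compositions agree, 2α_0 + α_1 decides, being the sum of the first two partial sums. -/
theorem CompGT.compHeight_lt {α β : Fin 3 → ℕ} (h : CompGT α β) : compHeight β < compHeight α := by
  rw [compGT_iff] at h
  rw [compHeight, compHeight, Prod.Lex.toLex_lt_toLex]
  -- These bounds ensure that the natural subtraction in `compHeight` does not truncate.
  have h1 : min (min (α 0) (α 1)) (α 2) ≤ α 2 := min_le_right _ _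
  have h2 : min (min (β 0) (β 1)) (β 2) ≤ β 2 := min_le_right _ _
  simp only
  generalize max (max (α 0) (α 1)) (α 2) = A at *
  generalize max (max (β 0) (β 1)) (β 2) = B at *
  generalize min (min (α 0) (α 1)) (α 2) = A' at *
  generalize min (min (β 0) (β 1)) (β 2) = B' at *
  omega

/-- A third entry z can hide the change of the maximum only if z ≥ max x y, and then it does not
hide the change of the minimum. -/
theorem max_max_min_min_pair {x y z u v : ℕ} (h : u + v = x + y) (h1 : max u v < max x y) :
    max (max u v) z ≤ max (max x y) z ∧ min (min x y) z ≤ min (min u v) z ∧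
      (max (max x y) z ≠ max (max u v) z ∨ min (min x y) z ≠ min (min u v) z) := by
  have h2 : min x y < min u v := by omega
  have h3 : min u v ≤ max u v := min_le_max
  have h4 : min x y ≤ max x y := min_le_max
  generalize max u v = A at *
  generalize max x y = B at *
  generalize min u v = A' at *
  generalize min x y = B' at *
  omega

theorem three_distinct : ∀ {i j l : Fin 3}, i ≠ j → l ≠ i → l ≠ j →
    (i = 0 ∧ j = 1 ∧ l = 2) ∨ (i = 0 ∧ j = 2 ∧ l = 1) ∨ (i = 1 ∧ j = 0 ∧ l = 2) ∨
    (i = 1 ∧ j = 2 ∧ l = 0) ∨ (i = 2 ∧ j = 0 ∧ l = 1) ∨ (i = 2 ∧ j = 1 ∧ l = 0) := by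
  decide

theorem max_three_perm {i j l : Fin 3} (hij : i ≠ j) (hli : l ≠ i) (hlj : l ≠ j)
    (α : Fin 3 → ℕ) : max (max (α 0) (α 1)) (α 2) = max (max (α i) (α j)) (α l) ∧
      min (min (α 0) (α 1)) (α 2) = min (min (α i) (α j)) (α l) ∧
      α 0 + α 1 + α 2 = α i + α j + α l := by
  rcases three_distinct hij hli hlj with h | h | h | h | h | h <;> obtain ⟨rfl, rfl, rfl⟩ := h <;>
    refine ⟨?_, ?_, ?_⟩ <;>
    first | ring | simp only [max_assoc, max_comm, max_left_comm] |
      simp only [min_assoc, min_comm, min_left_comm]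

theorem compGT_of_max_lt {i j l : Fin 3} (hij : i ≠ j) (hli : l ≠ i) (hlj : l ≠ j)
    {α β : Fin 3 → ℕ} (hl : β l = α l) (h : β i + β j = α i + α j)
    (h1 : max (β i) (β j) < max (α i) (α j)) : CompGT α β := by
  obtain ⟨a1, a2, a3⟩ := max_three_perm hij hli hlj α
  obtain ⟨b1, b2, b3⟩ := max_three_perm hij hli hlj β
  rw [compGT_iff, a1, a2, a3, b1, b2, b3, hl, h]
  exact ⟨rfl, Or.inl (max_max_min_min_pair h h1)⟩

theorem compGT_swap {i j : Fin 3} (hij : i < j) {α : Fin 3 → ℕ} (h : α j < α i) :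
    CompGT α (α ∘ Equiv.swap i j) := by
  rw [compGT_iff]
  fin_cases i <;> fin_cases j <;> first | (exfalso; simp at hij; done) | skip
  all_goals
    simp [Equiv.swap_apply_def] at *
    omega

/-! ### Spectral vectors -/

theorem rank_eq_card {N : ℕ} (α : Fin N → ℕ) (i : Fin N) :
    rank α i = (Finset.univ.filter fun j => α i < α j ∨ (j ≤ i ∧ α j = α i)).card := by
  rw [rank, Finset.filter_or, Finset.card_union_of_disjoint]
  rw [Finset.disjoint_filter]
  intro j _ h1 h2
  omega

theorem rank_le_rank {N : ℕ} {α : Fin N → ℕ} {i j : Fin N}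
    (h : α i < α j ∨ (j ≤ i ∧ α j = α i)) : rank α j ≤ rank α i := by
  rw [rank_eq_card, rank_eq_card]
  apply Finset.card_le_card
  intro l
  simp only [Finset.mem_filter, Finset.mem_univ, true_and]
  omega

theorem rank_lt_rank {N : ℕ} {α : Fin N → ℕ} {i j : Fin N}
    (h : α i < α j ∨ (j < i ∧ α j = α i)) : rank α j < rank α i := by
  rw [rank_eq_card, rank_eq_card]
  apply Finset.card_lt_card
  refine Finset.ssubset_iff_subset_ne.2 ⟨fun l => ?_, fun he => ?_⟩
  · simp only [Finset.mem_filter, Finset.mem_univ, true_and]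
    omega
  · have := Finset.ext_iff.1 he i
    simp only [Finset.mem_filter, Finset.mem_univ, true_and] at this
    have h' := this.2 (Or.inr ⟨le_refl _, trivial⟩)
    omega

theorem xi_lt_xi {N : ℕ} {κ : ℝ} (hκ : 0 ≤ κ) {α : Fin N → ℕ} {i j : Fin N} (h : α i < α j) :
    xi κ α i < xi κ α j := by
  have h1 : (rank α j : ℝ) ≤ rank α i := by exact_mod_cast rank_le_rank (Or.inl h)
  have h2 : (α i : ℝ) < α j := by exact_mod_cast h
  rw [xi, xi]
  nlinarith [mul_nonneg hκ (sub_nonneg.2 h1)]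

/-- For κ > 0 the order of the spectral values recovers the relation that the rank function counts.
-/
theorem xi_le_xi_iff {N : ℕ} {κ : ℝ} (hκ : 0 < κ) (α : Fin N → ℕ) (i j : Fin N) :
    xi κ α i ≤ xi κ α j ↔ α i < α j ∨ (j ≤ i ∧ α j = α i) := by
  constructor
  · intro h
    by_contra hc
    have h0 : α j < α i ∨ (i < j ∧ α i = α j) := by omega
    have h1 : (rank α i : ℝ) < rank α j := by exact_mod_cast rank_lt_rank h0
    have h2 : (α j : ℝ) ≤ α i := by exact_mod_cast (by omega : α j ≤ α i)
    rw [xi, xi] at h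
    nlinarith [mul_pos hκ (sub_pos.2 h1)]
  · intro h
    have h1 : (rank α j : ℝ) ≤ rank α i := by exact_mod_cast rank_le_rank h
    have h2 : (α i : ℝ) ≤ α j := by exact_mod_cast (by omega : α i ≤ α j)
    rw [xi, xi]
    nlinarith [mul_nonneg hκ.le (sub_nonneg.2 h1)]

/-- For κ = 0 the value ξ_i is α_i + 1. For κ > 0 the order of the ξ_i determines all ranks, and
then ξ_i determines α_i. -/
theorem xi_injective {N : ℕ} {κ : ℝ} (hκ : 0 ≤ κ) {α β : Fin N → ℕ}
    (h : ∀ i, xi κ α i = xi κ β i) : α = β := by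
  funext i
  have hi := h i
  rcases hκ.eq_or_lt with rfl | hκ
  · simpa [xi] using hi
  · have hr : rank α i = rank β i := by
      rw [rank_eq_card, rank_eq_card]
      simp only [← xi_le_xi_iff hκ, h]
    rw [xi, xi, hr] at hi
    exact_mod_cast add_left_cancel (add_right_cancel hi)

/-! ### Triangularity of the operators `U_i` -/

/-- The monomial with exponents `γ`. -/
def mon (γ : Fin 3 → ℕ) : MvPolynomial (Fin 3) ℝ := ∏ i, X i ^ γ i

theorem mon_eq_monomial (γ : Fin 3 → ℕ) :
    mon γ = monomial (Finsupp.equivFunOnFinite.symm γ) 1 := by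
  rw [mon, monomial_eq, Finsupp.prod_fintype _ _ (by simp)]
  simp

theorem monomial_eq_smul_mon (m : Fin 3 →₀ ℕ) (a : ℝ) : monomial m a = a • mon m := by
  rw [mon_eq_monomial, smul_monomial, smul_eq_mul, mul_one]
  congr 2
  ext i
  rfl

/-- The span of the monomials below `γ`. -/
def lowerSpan (γ : Fin 3 → ℕ) : Submodule ℝ (MvPolynomial (Fin 3) ℝ) :=
  Submodule.span ℝ (mon '' {β | CompGT γ β})

theorem mon_mem_lowerSpan {γ β : Fin 3 → ℕ} (h : CompGT γ β) : mon β ∈ lowerSpan γ :=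
  Submodule.subset_span ⟨β, h, rfl⟩

theorem coeff_mon (γ : Fin 3 → ℕ) (β : Fin 3 →₀ ℕ) :
    coeff β (mon γ) = if γ = β then 1 else 0 := by
  rw [mon_eq_monomial, coeff_monomial]
  congr 1
  rw [Equiv.symm_apply_eq, eq_iff_iff]
  rfl

theorem coeff_eq_zero_of_mem_lowerSpan {γ : Fin 3 → ℕ} {β : Fin 3 →₀ ℕ} (h : ¬CompGT γ β)
    {f : MvPolynomial (Fin 3) ℝ} (hf : f ∈ lowerSpan γ) : coeff β f = 0 := by
  have : lowerSpan γ ≤ LinearMap.ker (lcoeff ℝ β) := by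
    refine Submodule.span_le.2 ?_
    rintro _ ⟨δ, hδ, rfl⟩
    rw [SetLike.mem_coe, LinearMap.mem_ker, lcoeff_apply, coeff_mon, if_neg]
    rintro rfl
    exact h hδ
  exact this hf

theorem mon_eq {i j l : Fin 3} (hij : i ≠ j) (hli : l ≠ i) (hlj : l ≠ j) (γ : Fin 3 → ℕ) :
    mon γ = X l ^ γ l * X i ^ γ i * X j ^ γ j := by
  rw [mon, prod_fin_three hij hli hlj]

theorem rename_mon (w : Equiv.Perm (Fin 3)) (γ : Fin 3 → ℕ) :
    rename w (mon γ) = mon (γ ∘ ⇑w⁻¹) := by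
  rw [mon, mon, map_prod, ← Equiv.prod_comp w fun i => X i ^ (γ ∘ ⇑w⁻¹) i]
  simp

theorem pair_mem_lowerSpan {i j l : Fin 3} (hij : i ≠ j) (hli : l ≠ i) (hlj : l ≠ j)
    {γ : Fin 3 → ℕ} {u v : ℕ} (h : u + v = γ i + γ j) (h1 : max u v < max (γ i) (γ j)) :
    X l ^ γ l * X i ^ u * X j ^ v ∈ lowerSpan γ := by
  have : X l ^ γ l * X i ^ u * X j ^ v = mon (Function.update (Function.update γ i u) j v) := by
    rw [mon_eq hij hli hlj]
    simp [hij, hli, hlj]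
  rw [this]
  apply mon_mem_lowerSpan
  apply compGT_of_max_lt hij hli hlj <;> simp only [Function.update_self,
    Function.update_of_ne hij, Function.update_of_ne hli, Function.update_of_ne hlj, h, h1]

theorem rename_swap_mem_lowerSpan {i j : Fin 3} {γ : Fin 3 → ℕ}
    (h : (i < j ∧ γ j < γ i) ∨ (j < i ∧ γ i < γ j)) :
    rename (Equiv.swap i j) (mon γ) ∈ lowerSpan γ := by
  rw [rename_mon, Equiv.swap_inv]
  apply mon_mem_lowerSpan
  rcases h with h | h
  · exact compGT_swap h.1 h.2
  · rw [Equiv.swap_comm]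
    exact compGT_swap h.1 h.2

theorem divDiff_rootSub_pow {i j : Fin 3} (hij : i ≠ j) {R : MvPolynomial (Fin 3) ℝ}
    (hR : rename (Equiv.swap i j) R = R) (b d : ℕ) :
    divDiff (rootSub i j) (R * X i ^ (b + d) * X j ^ b)
      = ∑ t ∈ Finset.range d, R * X i ^ (b + t) * X j ^ (b + (d - 1 - t)) := by
  apply divDiff_eq_of_mul_eq (rootSub_ne_zero hij)
  have h := (Commute.all (X i : MvPolynomial (Fin 3) ℝ) (X j)).mul_geom_sum₂ d
  have h2 : ∑ t ∈ Finset.range d, R * X i ^ (b + t) * X j ^ (b + (d - 1 - t))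
      = R * X i ^ b * X j ^ b * ∑ t ∈ Finset.range d, X i ^ t * X j ^ (d - 1 - t) := by
    rw [Finset.mul_sum]
    refine Finset.sum_congr rfl fun t _ => ?_
    rw [pow_add, pow_add]; ring
  rw [h2, reflect_rootSub hij, linForm_rootSub]
  simp only [map_mul, map_pow, rename_X, hR, Equiv.swap_apply_left, Equiv.swap_apply_right]
  rw [pow_add, pow_add]
  linear_combination R * X i ^ b * X j ^ b * h

theorem divDiff_rootSub_pow' {i j : Fin 3} (hij : i ≠ j) {R : MvPolynomial (Fin 3) ℝ}
    (hR : rename (Equiv.swap i j) R = R) (b d : ℕ) :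
    divDiff (rootSub i j) (R * X i ^ b * X j ^ (b + d))
      = -∑ t ∈ Finset.range d, R * X i ^ (b + t) * X j ^ (b + (d - 1 - t)) := by
  rw [← divDiff_rootSub_pow hij hR]
  apply divDiff_eq_of_mul_eq (rootSub_ne_zero hij)
  have h := linForm_mul_divDiff (rootSub_ne_zero hij) (R * X i ^ (b + d) * X j ^ b)
  rw [reflect_rootSub hij] at h ⊢
  simp only [map_mul, map_pow, rename_X, hR, Equiv.swap_apply_left, Equiv.swap_apply_right] at h ⊢
  linear_combination -h

/-- The divided difference is a geometric sum. Its interior monomials have a smaller maximal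
exponent in positions i, j, hence lie below γ. If γ_j < γ_i, the ends are x^γ and its image under
(i, j); that image is below γ for i < j, and for j < i it is removed by the transposition in U_i. -/
theorem divDiff_X_mul_mon_sub_mem {i j : Fin 3} (hij : i ≠ j) (γ : Fin 3 → ℕ) :
    divDiff (rootSub i j) (X i * mon γ) - (if j < i then rename (Equiv.swap j i) (mon γ) else 0)
      - (if γ j < γ i ∨ (γ i = γ j ∧ i < j) then 1 else 0 : ℝ) • mon γ ∈ lowerSpan γ := by
  obtain ⟨l, hli, hlj⟩ := exists_third hij
  have hR : rename (Equiv.swap i j) (X l ^ γ l : MvPolynomial (Fin 3) ℝ) = X l ^ γ l := by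
    simp [Equiv.swap_apply_of_ne_of_ne hli hlj]
  have hX : X i * mon γ = X l ^ γ l * X i ^ (γ i + 1) * X j ^ γ j := by
    rw [mon_eq hij hli hlj]; ring
  have hs : rename (Equiv.swap i j) (mon γ) = X l ^ γ l * X i ^ γ j * X j ^ γ i := by
    rw [mon_eq hij hli hlj]
    simp only [map_mul, hR, map_pow, rename_X, Equiv.swap_apply_left, Equiv.swap_apply_right]
    ring
  rw [Equiv.swap_comm j i, hX]
  rcases lt_trichotomy (γ i) (γ j) with h | h | h
  · obtain ⟨m, hm⟩ := Nat.exists_eq_add_of_le (Nat.succ_le_of_lt h)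
    rw [if_neg (show ¬(γ j < γ i ∨ (γ i = γ j ∧ i < j)) by omega), zero_smul, sub_zero, hm,
      Nat.succ_eq_add_one, divDiff_rootSub_pow' hij hR]
    refine Submodule.sub_mem _ (Submodule.neg_mem _ (Submodule.sum_mem _ fun t ht => ?_)) ?_
    · have := Finset.mem_range.1 ht
      apply pair_mem_lowerSpan hij hli hlj <;> omega
    · split_ifs with hji
      · exact rename_swap_mem_lowerSpan (Or.inr ⟨hji, h⟩)
      · exact Submodule.zero_mem _
  · rw [← h, divDiff_rootSub_pow hij hR, Finset.sum_range_one]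
    rcases lt_or_gt_of_ne hij with hlt | hlt
    · rw [if_neg (not_lt.2 hlt.le), if_pos (Or.inr ⟨rfl, hlt⟩), mon_eq hij hli hlj, h]
      simp
    · rw [if_pos hlt, if_neg (by omega), hs, h]
      simp
  · obtain ⟨m, hm⟩ := Nat.exists_eq_add_of_lt h
    -- The geometric sum has m + 2 terms: the two ends and m interior ones.
    have hd : γ i + 1 = γ j + (m + 2) := by omega
    rw [hd, divDiff_rootSub_pow hij hR, Finset.sum_range_succ, Finset.sum_range_succ',
      if_pos (Or.inl h), one_smul]
    have e1 : (X l ^ γ l * X i ^ (γ j + 0) * X j ^ (γ j + (m + 2 - 1 - 0)) : MvPolynomial _ ℝ)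
        = rename (Equiv.swap i j) (mon γ) := by
      rw [hs]; congr 2; omega
    have e2 : (X l ^ γ l * X i ^ (γ j + (m + 1)) * X j ^ (γ j + (m + 2 - 1 - (m + 1))) :
        MvPolynomial _ ℝ) = mon γ := by
      rw [mon_eq hij hli hlj]; congr 2
      · congr 1; omega
      · omega
    rw [e1, e2]
    have hsum : ∑ t ∈ Finset.range m, (X l ^ γ l * X i ^ (γ j + (t + 1))
        * X j ^ (γ j + (m + 2 - 1 - (t + 1))) : MvPolynomial _ ℝ) ∈ lowerSpan γ := by
      refine Submodule.sum_mem _ fun t ht => ?_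
      have := Finset.mem_range.1 ht
      apply pair_mem_lowerSpan hij hli hlj <;> omega
    rcases lt_or_gt_of_ne hij with hlt | hlt
    · rw [if_neg (not_lt.2 hlt.le)]
      have := Submodule.add_mem _ hsum (rename_swap_mem_lowerSpan (Or.inl ⟨hlt, h⟩))
      convert this using 1
      ring
    · rw [if_pos hlt]
      convert hsum using 1
      ring

/-- N - r(γ, i) counts the indices that the rank leaves out, which are those whose divided
difference reproduces x^γ. This explains the coefficient of κ in ξ_i. -/
theorem three_sub_rank (γ : Fin 3 → ℕ) (i : Fin 3) :
    (3 : ℝ) - rank γ i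
      = ∑ j ∈ Finset.univ.erase i, if γ j < γ i ∨ (γ i = γ j ∧ i < j) then 1 else 0 := by
  have h : (rank γ i : ℝ) + ∑ j ∈ Finset.univ.erase i,
      (if γ j < γ i ∨ (γ i = γ j ∧ i < j) then 1 else 0) = 3 := by
    rw [rank_eq_card, Finset.card_filter, Nat.cast_sum,
      ← Finset.add_sum_erase _ _ (Finset.mem_univ i), add_assoc, ← Finset.sum_add_distrib]
    rw [Finset.sum_congr rfl (g := fun _ => (1 : ℝ))]
    · simp; norm_num
    · intro j hj
      have hne := Finset.ne_of_mem_erase hj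
      by_cases h1 : γ i < γ j ∨ (j ≤ i ∧ γ j = γ i)
      · rw [if_pos h1, if_neg (by omega)]; simp
      · rw [if_neg h1, if_pos (by omega)]; simp
  linarith

theorem pderiv_X_mul_mon (i : Fin 3) (γ : Fin 3 → ℕ) :
    pderiv i (X i * mon γ) = ((γ i : ℝ) + 1) • mon γ := by
  obtain ⟨j, hj⟩ := exists_ne i
  obtain ⟨l, hli, hlj⟩ := exists_third hj.symm
  have : X i * mon γ = X l ^ γ l * X j ^ γ j * X i ^ (γ i + 1) := by
    rw [mon_eq hj.symm hli hlj]; ring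
  rw [this, mon_eq hj.symm hli hlj, smul_eq_C_mul]
  simp [pderiv_X_of_ne hj, pderiv_X_of_ne hli, Derivation.leibniz_pow]
  ring

theorem opU_mon_sub_mem (κ : ℝ) (i : Fin 3) (γ : Fin 3 → ℕ) :
    opU κ i (mon γ) - xi κ γ i • mon γ ∈ lowerSpan γ := by
  have h : opU κ i (mon γ) - xi κ γ i • mon γ = κ • ∑ j ∈ Finset.univ.erase i,
      (divDiff (rootSub i j) (X i * mon γ)
        - (if j < i then rename (Equiv.swap j i) (mon γ) else 0)
        - (if γ j < γ i ∨ (γ i = γ j ∧ i < j) then 1 else 0 : ℝ) • mon γ) := by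
    rw [opU_apply, dunklA_apply, sum_Iio_eq_sum_erase, Finset.sum_sub_distrib,
      Finset.sum_sub_distrib, ← Finset.sum_smul, ← three_sub_rank, pderiv_X_mul_mon, xi]
    push_cast
    module
  rw [h]
  exact Submodule.smul_mem _ _ (Submodule.sum_mem _ fun j hj =>
    divDiff_X_mul_mon_sub_mem (Finset.ne_of_mem_erase hj).symm γ)

/-- The other monomials of f feed only exponents below themselves, so at a maximal exponent the
operator acts by its diagonal entry. -/
theorem coeff_opU_of_maximal (κ : ℝ) (i : Fin 3) {f : MvPolynomial (Fin 3) ℝ} {β : Fin 3 →₀ ℕ}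
    (h : ∀ γ : Fin 3 →₀ ℕ, coeff γ f ≠ 0 → ¬CompGT γ β) :
    coeff β (opU κ i f) = xi κ β i * coeff β f := by
  have key : ∀ γ ∈ f.support, coeff β (opU κ i (monomial γ (coeff γ f)))
      = xi κ β i * coeff β (monomial γ (coeff γ f)) := by
    intro γ hγ
    have h1 := coeff_eq_zero_of_mem_lowerSpan (h γ (mem_support_iff.1 hγ)) (opU_mon_sub_mem κ i γ)
    rw [coeff_sub, coeff_smul, smul_eq_mul, sub_eq_zero] at h1
    rw [monomial_eq_smul_mon, map_smul, coeff_smul, coeff_smul, h1, coeff_mon]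
    split_ifs with he
    · rw [he]; simp; ring
    · simp
  conv_lhs => rw [f.as_sum]
  conv_rhs => rw [f.as_sum]
  rw [map_sum, coeff_sum, coeff_sum, Finset.mul_sum]
  exact Finset.sum_congr rfl key

/-- A joint eigenvector of the `U_i` is supported below the composition of its spectral vector. -/
theorem triangular_of_eigen {κ : ℝ} (hκ : 0 ≤ κ) {α : Fin 3 → ℕ} {f : MvPolynomial (Fin 3) ℝ}
    (hf : ∀ i, opU κ i f = xi κ α i • f) (β : Fin 3 →₀ ℕ) (hβ : coeff β f ≠ 0) :
    (β : Fin 3 → ℕ) = α ∨ CompGT α β := by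
  classical
  by_contra hc
  -- Take δ of maximal height among the exponents that violate the claim. By transitivity no
  -- exponent of f lies above δ, so the diagonal entries at δ equal the eigenvalues, and δ = α by
  -- injectivity of the spectrum.
  obtain ⟨δ, hδ, hmax⟩ := (f.support.filter fun γ : Fin 3 →₀ ℕ =>
    ¬((γ : Fin 3 → ℕ) = α ∨ CompGT α γ)).exists_max_image (fun γ => compHeight γ)
    ⟨β, by rw [Finset.mem_filter]; exact ⟨mem_support_iff.2 hβ, hc⟩⟩
  rw [Finset.mem_filter, mem_support_iff] at hδ
  have hm : ∀ γ : Fin 3 →₀ ℕ, coeff γ f ≠ 0 → ¬CompGT γ δ := by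
    intro γ hγ hgt
    refine absurd (hmax γ ?_) (not_le.2 hgt.compHeight_lt)
    rw [Finset.mem_filter, mem_support_iff]
    refine ⟨hγ, fun h => hδ.2 ?_⟩
    rcases h with h | h
    · right; rwa [← h]
    · right; exact h.trans hgt
  apply hδ.2
  left
  apply xi_injective hκ
  intro i
  have h1 := coeff_opU_of_maximal κ i hm
  rw [hf, coeff_smul, smul_eq_mul] at h1
  exact (mul_right_cancel₀ hδ.1 h1).symm

/-! ### Norms under the recursion steps -/

theorem yE_zero : yE 0 = 1 := by simp [yE]

theorem yE_succ (k : Fin 3) : yE (k + 1) = X k * yE k := by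
  rw [yE_eq_prod, yE_eq_prod]
  fin_cases k <;> simp [Fin.prod_univ_three] <;> ring

/-- For j < k the monomial y_{E_k} contains y_j but not y_k, so σ_jk + τ_jk annihilates the
polynomial. Thus D_k y_k acts here like the self-adjoint operator `opUD`, with eigenvalue 2a - 1. -/
theorem pairing_yE_succ {κ a : ℝ} {k : Fin 3} {f : MvPolynomial (Fin 3) ℝ}
    (hf : opU κ k f = a • f) :
    pairing (dunklD κ) (yE (k + 1) * sq f) (yE (k + 1) * sq f)
      = (2 * a - 1) * pairing (dunklD κ) (yE k * sq f) (yE k * sq f) := by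
  have h : dunklD κ k (X k * (yE k * sq f)) = opUD κ k (yE k * sq f) := by
    rw [opUD, Finset.sum_eq_zero, smul_zero, sub_zero]
    intro j hj
    have hjk := Finset.mem_Iio.1 hj
    obtain ⟨l, hli, hlj⟩ := exists_third hjk.ne'
    rw [Equiv.swap_comm, tau_comm, rename_swap_add_tau_sq hjk.ne'
      (R := if (l : ℕ) < k then X l else 1) (a := (k : ℕ) < k) (b := (j : ℕ) < k), if_neg]
    · simpa using hjk
    · split_ifs <;> simp [Equiv.swap_apply_of_ne_of_ne hli hlj]
    · split_ifs <;> simp [tau_X, hli, hlj]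
    · rw [yE_eq_prod, prod_fin_three hjk.ne' hli hlj]
  rw [yE_succ, mul_assoc, pairing_X_mul_left (dunklD_commute κ), h, opUD_yE_mul_sq_of_eigen hf,
    pairing_smul_right, if_neg (lt_irrefl _)]

/-- Raising multiplies by the square of a variable, which is split into two steps through the odd
class k = 1. -/
theorem sq_raise (f : MvPolynomial (Fin 3) ℝ) :
    sq (raise f) = rename cyc (X 0 * (yE 1 * sq f)) := by
  have h : yE 1 = X 0 * yE 0 := yE_succ 0
  rw [raise, map_mul, sq_X, ← rename_sq, map_mul, h, yE_zero, map_mul, map_mul, map_one, rename_X,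
    show cyc 0 = 2 by decide]
  ring

/-- The first factor y_0 contributes 2a - 1. The second contributes 2a, because y_0 already divides
the polynomial. -/
theorem pairing_sq_raise {κ a : ℝ} {f : MvPolynomial (Fin 3) ℝ} (hf : opU κ 0 f = a • f) :
    pairing (dunklD κ) (sq (raise f)) (sq (raise f))
      = 2 * a * (2 * a - 1) * pairing (dunklD κ) (sq f) (sq f) := by
  have h : dunklD κ 0 (X 0 * (yE 1 * sq f)) = opUD κ 0 (yE 1 * sq f) := by
    rw [opUD, show Finset.Iio (0 : Fin 3) = ∅ by decide]; simp
  have h2 := pairing_yE_succ hf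
  simp only [Fin.coe_ofNat_eq_mod, Nat.zero_mod, zero_add, yE_zero, one_mul] at h2
  rw [sq_raise, pairing_rename, pairing_X_mul_left (dunklD_commute κ), h,
    opUD_yE_mul_sq_of_eigen hf, pairing_smul_right, h2]
  simp
  ring

section Swap

variable {κ a b : ℝ} {i j : Fin 3} {s : Equiv.Perm (Fin 3)} (hab : a ≠ b)
  (hi : ∀ f, opU κ i (rename s f) = rename s (opU κ j f) + κ • f)
  (hj : ∀ f, opU κ j (rename s f) = rename s (opU κ i f) - κ • f)
  {f : MvPolynomial (Fin 3) ℝ} (hfi : opU κ i f = a • f) (hfj : opU κ j f = b • f)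

include hab hi hj hfi hfj

/-- The coefficient c = κ/(b - a) is forced: c f must absorb the κ f of the Hecke relation, that is
κ + c a = c b. -/
theorem opU_swap_eigen :
    opU κ i (rename s f + (κ / (b - a)) • f) = b • (rename s f + (κ / (b - a)) • f) ∧
    opU κ j (rename s f + (κ / (b - a)) • f) = a • (rename s f + (κ / (b - a)) • f) := by
  have hc : κ = κ / (b - a) * (b - a) := by
    rw [div_mul_cancel₀]; exact sub_ne_zero.2 hab.symm
  set c := κ / (b - a)
  rw [map_add, map_add, map_smul, map_smul, hi, hj, hfi, hfj, map_smul, map_smul, hc]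
  constructor <;> module

/-- With g = sf + c f, the vectors f and g are orthogonal, since U_i has eigenvalues a and b on
them. As s preserves the pairing, Pythagoras for sf = g - c f gives the norm of g. -/
theorem pairing_swap_eigen :
    pairing (dunklD κ) (sq (rename s f + (κ / (b - a)) • f)) (sq (rename s f + (κ / (b - a)) • f))
      = (1 - (κ / (b - a)) ^ 2) * pairing (dunklD κ) (sq f) (sq f) := by
  have h1 := (opU_swap_eigen hab hi hj hfi hfj).1
  set c := κ / (b - a)
  set g := rename s f + c • f with hg
  have h2 := pairing_eq_zero_of_eigen h1 hfi hab.symm 0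
  have h3 : rename s f = g - c • f := by rw [hg]; abel
  have h4 := pairing_rename κ s (sq f) (sq f)
  rw [yE_zero, one_mul, one_mul] at h2
  rw [rename_sq, h3, map_sub, map_smul, pairing_sub_left, pairing_sub_right, pairing_sub_right,
    pairing_smul_left, pairing_smul_left, pairing_smul_right, pairing_smul_right, h2,
    pairing_comm κ (sq f) (sq g), h2] at h4
  linear_combination h4

end Swap

/-! ### Pochhammer symbols and hook products under the recursion steps -/

theorem sortDesc_comp {N : ℕ} (α : Fin N → ℕ) (w : Equiv.Perm (Fin N)) :
    sortDesc (α ∘ w) = sortDesc α := by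
  have h := Tuple.unique_monotone (f := α) (σ := Tuple.sort α) (τ := (Tuple.sort (α ∘ w)).trans w)
    (Tuple.monotone_sort α) (Tuple.monotone_sort (α ∘ w))
  funext i
  exact (congrFun h (Fin.rev i)).symm

theorem sortDesc_eq_of_antitone {N : ℕ} {α : Fin N → ℕ} {w : Equiv.Perm (Fin N)}
    (h : Antitone (α ∘ w)) : sortDesc α = α ∘ w := by
  have h := Tuple.unique_monotone (f := α) (σ := Tuple.sort α) (τ := Fin.revPerm.trans w)
    (Tuple.monotone_sort α) (fun i j hij => h (Fin.rev_le_rev.2 hij))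
  funext i
  have := congrFun h (Fin.rev i)
  simpa [sortDesc] using this

theorem rank_pos {N : ℕ} (α : Fin N → ℕ) (i : Fin N) : 0 < rank α i := by
  rw [rank_eq_card]
  exact Finset.card_pos.2 ⟨i, by simp⟩

theorem rank_le {N : ℕ} (α : Fin N → ℕ) (i : Fin N) : rank α i ≤ N := by
  rw [rank_eq_card]
  exact (Finset.card_le_univ _).trans (by simp)

/-- The generalized Pochhammer symbol of the sorted composition `β`, with its factors labelled by
the ranks of the parts of `α`. -/
def rankPoch {N : ℕ} (κ t : ℝ) (α β : Fin N → ℕ) : ℝ :=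
  ∏ i, ∏ j ∈ Finset.range (β i), (t - ((rank α i : ℝ) - 1) * κ + j)

/-- The map i ↦ r(α, i) - 1 is a permutation, and the hypothesis says that it sorts β. Besides β = α
this covers α plus the indicator of the first k indices, since ranks break ties in favour of smaller
indices. -/
theorem genPoch_sortDesc {N : ℕ} (κ t : ℝ) {α β : Fin N → ℕ}
    (hαβ : ∀ i j, β i < β j → rank α j < rank α i) :
    genPoch κ t (sortDesc β) = rankPoch κ t α β := by
  have hlt : ∀ i, rank α i - 1 < N := fun i => by
    have := rank_pos α i
    have := rank_le α i
    omega
  let f : Fin N → Fin N := fun i => ⟨rank α i - 1, hlt i⟩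
  have hf : ∀ i j, rank α j < rank α i → f j < f i := by
    intro i j h
    have := rank_pos α j
    rw [Fin.lt_def]
    change rank α j - 1 < rank α i - 1
    omega
  have hinj : Function.Injective f := by
    intro i j hij
    by_contra hne
    by_cases h : α i < α j ∨ (j < i ∧ α j = α i)
    · exact (hf i j (rank_lt_rank h)).ne' hij
    · exact (hf j i (rank_lt_rank (by omega))).ne hij
  let e := Equiv.ofBijective f (Finite.injective_iff_bijective.1 hinj)
  have hanti : Antitone (β ∘ e.symm) := by
    intro i j hij
    by_contra hc
    have h1 : f (e.symm j) < f (e.symm i) := hf _ _ (hαβ _ _ (not_le.1 hc))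
    have h2 : ∀ m, f (e.symm m) = m := fun m => e.apply_symm_apply m
    rw [h2, h2] at h1
    exact absurd hij (not_le.2 h1)
  rw [sortDesc_eq_of_antitone hanti, genPoch, rankPoch, ← Equiv.prod_comp e]
  refine Finset.prod_congr rfl fun i _ => ?_
  have h1 : ((e i : Fin N) : ℕ) = rank α i - 1 := rfl
  have h2 : (((e i : Fin N) : ℕ) : ℝ) = (rank α i : ℝ) - 1 := by
    rw [h1, Nat.cast_sub (rank_pos α i), Nat.cast_one]
  rw [Function.comp_apply, e.symm_apply_apply, h2]

/-- The composition `(α_2, α_3, α_1 + 1)`. -/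
def raiseIdx (α : Fin 3 → ℕ) : Fin 3 → ℕ := ![α 1, α 2, α 0 + 1]

theorem rank_raiseIdx (α : Fin 3 → ℕ) : rank (raiseIdx α) 0 = rank α 1 ∧
    rank (raiseIdx α) 1 = rank α 2 ∧ rank (raiseIdx α) 2 = rank α 0 := by
  simp only [rank, Finset.card_filter, Fin.sum_univ_three]
  simp only [raiseIdx, Matrix.cons_val]
  simp
  refine ⟨?_, ?_, ?_⟩ <;> grind

theorem xi_raiseIdx (κ : ℝ) (α : Fin 3 → ℕ) : xi κ (raiseIdx α) 0 = xi κ α 1 ∧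
    xi κ (raiseIdx α) 1 = xi κ α 2 ∧ xi κ (raiseIdx α) 2 = xi κ α 0 + 1 := by
  obtain ⟨h0, h1, h2⟩ := rank_raiseIdx α
  simp only [xi, h0, h1, h2]
  simp only [raiseIdx, Matrix.cons_val]
  refine ⟨trivial, trivial, ?_⟩
  push_cast
  ring

theorem rankPoch_raiseIdx (κ t : ℝ) (α : Fin 3 → ℕ) :
    rankPoch κ t (raiseIdx α) (raiseIdx α)
      = rankPoch κ t α α * (t - ((rank α 0 : ℝ) - 1) * κ + α 0) := by
  obtain ⟨h0, h1, h2⟩ := rank_raiseIdx α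
  simp only [rankPoch, Fin.prod_univ_three, h0, h1, h2]
  simp only [raiseIdx, Matrix.cons_val, Finset.prod_range_succ]
  ring

theorem prod_Icc_one (n : ℕ) (F : ℕ → ℝ) :
    ∏ j ∈ Finset.Icc 1 n, F j = ∏ j ∈ Finset.range n, F (j + 1) := by
  induction n with
  | zero => simp
  | succ n ih => rw [Finset.prod_Icc_succ_top (by omega), ih, Finset.prod_range_succ]

/-- The shift by one for l < i in the leg length is made for this: the row that moves from first to
last place gains one box on the left, and its old legs reappear one column further. -/
theorem legLength_raiseIdx (α : Fin 3 → ℕ) (j : ℕ) :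
    legLength (raiseIdx α) 0 j = legLength α 1 j ∧ legLength (raiseIdx α) 1 j = legLength α 2 j ∧
    legLength (raiseIdx α) 2 (j + 1) = legLength α 0 j := by
  simp only [legLength, Finset.card_filter, Fin.sum_univ_three]
  simp only [raiseIdx, Matrix.cons_val]
  simp

/-- Column 0 is outside the diagram of α; it becomes the new box j = 1 after raising. -/
theorem legLength_zero_zero (α : Fin 3 → ℕ) : (legLength α 0 0 : ℝ) = 3 - rank α 0 := by
  rw [eq_sub_iff_add_eq]
  norm_cast
  simp only [legLength, rank, Finset.card_filter, Fin.sum_univ_three]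
  simp
  split_ifs <;> omega

theorem hookProd_raiseIdx (κ t : ℝ) (α : Fin 3 → ℕ) :
    hookProd κ (raiseIdx α) t
      = hookProd κ α t * (α 0 + t + κ * (3 - rank α 0)) := by
  have e0 : raiseIdx α 0 = α 1 := rfl
  have e1 : raiseIdx α 1 = α 2 := rfl
  have e2 : raiseIdx α 2 = α 0 + 1 := rfl
  rw [← legLength_zero_zero]
  simp only [hookProd, Fin.prod_univ_three, prod_Icc_one, (legLength_raiseIdx α _).1,
    (legLength_raiseIdx α _).2.1, (legLength_raiseIdx α _).2.2, e0, e1, e2,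
    Finset.prod_range_succ' _ (α 0)]
  push_cast
  have : ∀ x ∈ Finset.range (α 0), (α 0 : ℝ) + 1 - ((x : ℝ) + 1 + 1) + t
      + κ * legLength α 0 (x + 1) = α 0 - (x + 1) + t + κ * legLength α 0 (x + 1) := by
    intro x _; ring
  rw [Finset.prod_congr rfl this]
  ring

theorem xi_sub_xi_one_two (κ : ℝ) (a m : ℕ) :
    xi κ ![a, 0, m + 1] 2 - xi κ ![a, 0, m + 1] 1
      = m + 1 + κ * ((if a < m + 1 then 1 else 0 : ℕ) + 1) := by
  have h : rank ![a, 0, m + 1] 1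
      = rank ![a, 0, m + 1] 2 + (if a < m + 1 then 1 else 0) + 1 := by
    simp only [rank, Finset.card_filter, Fin.sum_univ_three]
    simp only [Matrix.cons_val]
    simp
    grind
  simp only [xi, h, Matrix.cons_val]
  push_cast
  ring

theorem xi_sub_xi_zero_one (κ : ℝ) (m : ℕ) :
    xi κ ![0, m + 1, 0] 1 - xi κ ![0, m + 1, 0] 0 = m + 1 + κ := by
  have h : rank ![0, m + 1, 0] 0 = rank ![0, m + 1, 0] 1 + 1 := by
    simp only [rank, Finset.card_filter, Fin.sum_univ_three]
    simp only [Matrix.cons_val]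
    simp
  simp only [xi, h, Matrix.cons_val]
  push_cast
  ring

theorem legLength_swap_one_two (a m j : ℕ) :
    legLength ![a, m + 1, 0] 0 (j + 1) = legLength ![a, 0, m + 1] 0 (j + 1) ∧
    legLength ![a, m + 1, 0] 1 (j + 2) = legLength ![a, 0, m + 1] 2 (j + 2) ∧
    legLength ![a, m + 1, 0] 1 1 = (if a < m + 1 then 1 else 0) ∧
    legLength ![a, 0, m + 1] 2 1 = (if a < m + 1 then 1 else 0) + 1 := by
  simp only [legLength, Finset.card_filter, Fin.sum_univ_three]
  simp only [Matrix.cons_val]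
  simp

theorem legLength_swap_zero_one (m j : ℕ) :
    legLength ![m + 1, 0, 0] 0 (j + 2) = legLength ![0, m + 1, 0] 1 (j + 2) ∧
    legLength ![m + 1, 0, 0] 0 1 = 0 ∧ legLength ![0, m + 1, 0] 1 1 = 1 := by
  simp only [legLength, Finset.card_filter, Fin.sum_univ_three]
  simp only [Matrix.cons_val]
  simp

/-- Only the first box of the moved row changes its leg, which drops by one. Its factor before the
swap is x - 1 + t, where x is the difference of the spectral values, and afterwards it is smaller by
κ. -/
theorem hookProd_swap_one_two (κ t : ℝ) (a m : ℕ) :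
    hookProd κ ![a, m + 1, 0] t
        * (xi κ ![a, 0, m + 1] 2 - xi κ ![a, 0, m + 1] 1 - 1 + t)
      = hookProd κ ![a, 0, m + 1] t
        * (xi κ ![a, 0, m + 1] 2 - xi κ ![a, 0, m + 1] 1 - 1 + t - κ) := by
  rw [xi_sub_xi_one_two]
  simp only [hookProd, Fin.prod_univ_three, prod_Icc_one, Matrix.cons_val,
    Finset.prod_range_succ' _ m, zero_add, (legLength_swap_one_two a m 0).2.2.1,
    (legLength_swap_one_two a m 0).2.2.2, (legLength_swap_one_two a m _).1, add_assoc, one_add_one_eq_two,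
    (legLength_swap_one_two a m _).2.1]
  push_cast
  ring

theorem hookProd_swap_zero_one (κ t : ℝ) (m : ℕ) :
    hookProd κ ![m + 1, 0, 0] t
        * (xi κ ![0, m + 1, 0] 1 - xi κ ![0, m + 1, 0] 0 - 1 + t)
      = hookProd κ ![0, m + 1, 0] t
        * (xi κ ![0, m + 1, 0] 1 - xi κ ![0, m + 1, 0] 0 - 1 + t - κ) := by
  rw [xi_sub_xi_zero_one]
  simp only [hookProd, Fin.prod_univ_three, prod_Icc_one, Matrix.cons_val,
    Finset.prod_range_succ' _ m, zero_add, (legLength_swap_zero_one m 0).2.1,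
    (legLength_swap_zero_one m 0).2.2, add_assoc, one_add_one_eq_two,
    (legLength_swap_zero_one m _).1]
  push_cast
  ring

/-! ### Existence of the nonsymmetric Jack polynomials and their norms -/

/-- The squared norm of `y_{E_k} ζ_α(y²)`. -/
def jackNorm (κ : ℝ) (k : ℕ) (α : Fin 3 → ℕ) : ℝ :=
  2 ^ (∑ i, (2 * α i + if (i : ℕ) < k then 1 else 0)) * genPoch κ (3 * κ + 1) (sortDesc α)
    * genPoch κ (2 * κ + 1 / 2) (sortDesc fun i => α i + if (i : ℕ) < k then 1 else 0)
    * (hookProd κ α 1 / hookProd κ α (κ + 1))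

theorem hookProd_pos {κ t : ℝ} (hκ : 0 ≤ κ) (ht : 0 < t) {N : ℕ} (α : Fin N → ℕ) :
    0 < hookProd κ α t := by
  refine Finset.prod_pos fun i _ => Finset.prod_pos fun j hj => ?_
  have h1 : (j : ℝ) ≤ α i := by exact_mod_cast (Finset.mem_Icc.1 hj).2
  have h2 : 0 ≤ κ * legLength α i j := by positivity
  linarith

theorem genPoch_pos {κ t : ℝ} (hκ : 0 ≤ κ) (ht : 0 < t - 2 * κ) (l : Fin 3 → ℕ) :
    0 < genPoch κ t l := by
  refine Finset.prod_pos fun i _ => Finset.prod_pos fun j _ => ?_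
  have h1 : ((i : ℕ) : ℝ) ≤ 2 := by exact_mod_cast Nat.lt_succ_iff.1 i.isLt
  have h2 : ((i : ℕ) : ℝ) * κ ≤ 2 * κ := mul_le_mul_of_nonneg_right h1 hκ
  have h3 : (0 : ℝ) ≤ j := Nat.cast_nonneg j
  linarith

theorem jackNorm_pos {κ : ℝ} (hκ : 0 ≤ κ) (k : ℕ) (α : Fin 3 → ℕ) : 0 < jackNorm κ k α := by
  have h1 := genPoch_pos hκ (t := 3 * κ + 1) (by linarith) (sortDesc α)
  have h2 := genPoch_pos hκ (t := 2 * κ + 1 / 2) (by linarith)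
    (sortDesc fun i => α i + if (i : ℕ) < k then 1 else 0)
  have h3 := hookProd_pos hκ one_pos α
  have h4 := hookProd_pos hκ (t := κ + 1) (by linarith) α
  unfold jackNorm
  positivity

/-- One part of the second Pochhammer symbol grows by one. Its new factor is ξ_k - 1/2, and the
power of 2 doubles it. -/
theorem jackNorm_succ (κ : ℝ) (k : Fin 3) (α : Fin 3 → ℕ) :
    jackNorm κ (k + 1) α = (2 * xi κ α k - 1) * jackNorm κ k α := by
  have hr : ∀ k : ℕ, ∀ i j : Fin 3, (α i + if (i : ℕ) < k then 1 else 0)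
      < (α j + if (j : ℕ) < k then 1 else 0) → rank α j < rank α i := by
    intro k i j h
    apply rank_lt_rank
    rw [Fin.lt_def]
    split_ifs at h <;> omega
  have h1 : ∑ i : Fin 3, (2 * α i + if (i : ℕ) < (k : ℕ) + 1 then 1 else 0)
      = (∑ i : Fin 3, (2 * α i + if (i : ℕ) < (k : ℕ) then 1 else 0)) + 1 := by
    fin_cases k <;> simp [Fin.sum_univ_three] <;> ring
  have h2 : rankPoch κ (2 * κ + 1 / 2) α (fun i => α i + if (i : ℕ) < (k : ℕ) + 1 then 1 else 0)
      = rankPoch κ (2 * κ + 1 / 2) α (fun i => α i + if (i : ℕ) < (k : ℕ) then 1 else 0)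
        * (xi κ α k - 1 / 2) := by
    fin_cases k <;> simp [rankPoch, Fin.prod_univ_three, xi, Finset.prod_range_succ] <;> ring
  rw [jackNorm, jackNorm, genPoch_sortDesc κ _ (hr _), genPoch_sortDesc κ _ (hr _), h1, h2,
    pow_succ]
  ring

theorem jackNorm_zero_eq (κ : ℝ) (α : Fin 3 → ℕ) : jackNorm κ 0 α = 2 ^ (2 * (α 0 + α 1 + α 2))
    * genPoch κ (3 * κ + 1) (sortDesc α) * genPoch κ (2 * κ + 1 / 2) (sortDesc α)
    * (hookProd κ α 1 / hookProd κ α (κ + 1)) := by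
  have : ∑ i, 2 * α i = 2 * (α 0 + α 1 + α 2) := by rw [Fin.sum_univ_three]; ring
  simp [jackNorm, this]

/-- With ξ = ξ_0(α), the two Pochhammer symbols gain ξ + κ and ξ - 1/2, the hook quotient gains ξ/(ξ
+ κ), and the power of 2 gains 4. -/
theorem jackNorm_raiseIdx {κ : ℝ} (hκ : 0 ≤ κ) (α : Fin 3 → ℕ) :
    jackNorm κ 0 (raiseIdx α) = 2 * xi κ α 0 * (2 * xi κ α 0 - 1) * jackNorm κ 0 α := by
  have hr : ∀ α : Fin 3 → ℕ, ∀ i j : Fin 3, α i < α j → rank α j < rank α i :=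
    fun α i j h => rank_lt_rank (Or.inl h)
  have hs : 2 * (raiseIdx α 0 + raiseIdx α 1 + raiseIdx α 2) = 2 * (α 0 + α 1 + α 2) + 2 := by
    simp only [raiseIdx, Matrix.cons_val]; ring
  have h4 := (hookProd_pos hκ (t := κ + 1) (by linarith) α).ne'
  have h5 := (hookProd_pos hκ (t := κ + 1) (by linarith) (raiseIdx α)).ne'
  rw [hookProd_raiseIdx] at h5
  have h6 := right_ne_zero_of_mul h5
  rw [jackNorm_zero_eq, jackNorm_zero_eq, hs, genPoch_sortDesc κ _ (hr _),
    genPoch_sortDesc κ _ (hr _), genPoch_sortDesc κ _ (hr _), genPoch_sortDesc κ _ (hr _),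
    rankPoch_raiseIdx, rankPoch_raiseIdx, hookProd_raiseIdx, hookProd_raiseIdx, xi]
  push_cast
  field_simp
  ring

/-- The Pochhammer symbols see only the sorted composition. The hook relation at t = 1 and t = κ + 1
changes the hook quotient by (x - κ)(x + κ)/x². -/
theorem jackNorm_swap {κ x : ℝ} (hκ : 0 ≤ κ) {α β : Fin 3 → ℕ} (w : Equiv.Perm (Fin 3))
    (hw : β = α ∘ w) (hx : 0 < x)
    (h : ∀ t, hookProd κ β t * (x - 1 + t) = hookProd κ α t * (x - 1 + t - κ)) :
    jackNorm κ 0 β = (1 - (κ / x) ^ 2) * jackNorm κ 0 α := by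
  have hs : β 0 + β 1 + β 2 = α 0 + α 1 + α 2 := by
    rw [← Fin.sum_univ_three, ← Fin.sum_univ_three, hw]
    exact Equiv.sum_comp w α
  have h1 := h 1
  have h2 := h (κ + 1)
  have p1 := hookProd_pos hκ (t := κ + 1) (by linarith) α
  have p2 := hookProd_pos hκ (t := κ + 1) (by linarith) β
  have key : hookProd κ β 1 / hookProd κ β (κ + 1)
      = (1 - (κ / x) ^ 2) * (hookProd κ α 1 / hookProd κ α (κ + 1)) := by
    have e1 : hookProd κ β 1 = hookProd κ α 1 * (x - κ) / x := by
      rw [eq_div_iff hx.ne']; linear_combination h1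
    have e2 : hookProd κ β (κ + 1) = hookProd κ α (κ + 1) * x / (x + κ) := by
      rw [eq_div_iff (by positivity)]; linear_combination h2
    have hxk : x + κ ≠ 0 := by positivity
    rw [e1, e2]
    field_simp
    ring
  rw [jackNorm_zero_eq, jackNorm_zero_eq, hs, key, hw, sortDesc_comp]
  ring

/-- Triangularity follows from the eigenvalue equations, so the recursion has to track only the
eigenvalues and one coefficient. -/
theorem isNSJack_of_eigen {κ : ℝ} (hκ : 0 ≤ κ) {α : Fin 3 → ℕ} {ζ : MvPolynomial (Fin 3) ℝ}
    (h : ∀ i, opU κ i ζ = xi κ α i • ζ)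
    (h1 : coeff (Finsupp.equivFunOnFinite.symm α) ζ = 1) : IsNSJack κ α ζ :=
  ⟨h, h1, triangular_of_eigen hκ h⟩

/-- A nonsymmetric Jack polynomial with the expected norm exists. -/
def HasJack (κ : ℝ) (α : Fin 3 → ℕ) : Prop :=
  ∃ ζ, IsNSJack κ α ζ ∧ pairing (dunklD κ) (sq ζ) (sq ζ) = jackNorm κ 0 α

theorem hasJack_zero {κ : ℝ} (hκ : 0 ≤ κ) : HasJack κ 0 := by
  have h0 : mon 0 = 1 := by simp [mon]
  have hl : lowerSpan 0 = ⊥ := by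
    rw [lowerSpan, Submodule.span_eq_bot]
    rintro _ ⟨β, hβ, rfl⟩
    exfalso
    rw [Set.mem_ofPred_eq, compGT_iff] at hβ
    simp only [Pi.zero_apply, add_zero] at hβ
    obtain ⟨h1, h2⟩ := hβ
    have e0 : β 0 = 0 := by omega
    have e1 : β 1 = 0 := by omega
    have e2 : β 2 = 0 := by omega
    simp [e0, e1, e2] at h2
  refine ⟨1, isNSJack_of_eigen hκ (fun i => ?_) ?_, ?_⟩
  · have := opU_mon_sub_mem κ i 0
    rw [hl, Submodule.mem_bot, h0] at this
    exact sub_eq_zero.1 this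
  · rw [← h0, coeff_mon, if_pos]; rfl
  · have hs : sortDesc (0 : Fin 3 → ℕ) = 0 := rfl
    rw [map_one, ← C_1, pairing_C_left, jackNorm_zero_eq, hs]
    simp [genPoch, hookProd]

theorem hasJack_raiseIdx {κ : ℝ} (hκ : 0 ≤ κ) {α : Fin 3 → ℕ} (h : HasJack κ α) :
    HasJack κ (raiseIdx α) := by
  obtain ⟨ζ, hζ, hn⟩ := h
  obtain ⟨u0, u1, u2⟩ := opU_raise κ ζ
  obtain ⟨x0, x1, x2⟩ := xi_raiseIdx κ α
  have hsmul : ∀ c : ℝ, raise (c • ζ) = c • raise ζ := by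
    intro c; rw [raise, map_smul, mul_smul_comm]; rfl
  refine ⟨raise ζ, isNSJack_of_eigen hκ (fun i => ?_) ?_, ?_⟩
  · fin_cases i
    · change opU κ 0 _ = xi κ _ 0 • _
      rw [u0, x0, hζ.eigen, hsmul]
    · change opU κ 1 _ = xi κ _ 1 • _
      rw [u1, x1, hζ.eigen, hsmul]
    · change opU κ 2 _ = xi κ _ 2 • _
      rw [u2, x2, hζ.eigen, ← hsmul, add_smul, one_smul]
  · have : Finsupp.equivFunOnFinite.symm (raiseIdx α) = Finsupp.single 2 1
        + Finsupp.mapDomain cyc (Finsupp.equivFunOnFinite.symm α) := by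
      ext i
      rw [Finsupp.add_apply, Finsupp.mapDomain_equiv_apply]
      fin_cases i
      · rw [show cyc.symm ((fun i => i) ⟨0, _⟩) = 1 by decide]; simp [raiseIdx]
      · rw [show cyc.symm ((fun i => i) ⟨1, _⟩) = 2 by decide]; simp [raiseIdx]
      · rw [show cyc.symm ((fun i => i) ⟨2, _⟩) = 0 by decide]; simp [raiseIdx, add_comm]
    rw [this, raise, coeff_X_mul, coeff_rename_mapDomain _ cyc.injective, hζ.monic]
  · rw [pairing_sq_raise (hζ.eigen 0), hn, jackNorm_raiseIdx hκ]

theorem hasJack_swap {κ : ℝ} (hκ : 0 ≤ κ) {i j : Fin 3} {α : Fin 3 → ℕ}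
    (hα : xi κ α i < xi κ α j)
    (hi : ∀ f, opU κ i (rename (Equiv.swap i j) f)
      = rename (Equiv.swap i j) (opU κ j f) + κ • f)
    (hj : ∀ f, opU κ j (rename (Equiv.swap i j) f)
      = rename (Equiv.swap i j) (opU κ i f) - κ • f)
    (hl : ∀ l f, l ≠ i → l ≠ j → opU κ l (rename (Equiv.swap i j) f)
      = rename (Equiv.swap i j) (opU κ l f))
    (hgt : CompGT (α ∘ Equiv.swap i j) α)
    (hxi : ∀ l, xi κ (α ∘ Equiv.swap i j) l = xi κ α (Equiv.swap i j l))
    (hhook : ∀ t, hookProd κ (α ∘ Equiv.swap i j) t * (xi κ α j - xi κ α i - 1 + t)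
      = hookProd κ α t * (xi κ α j - xi κ α i - 1 + t - κ))
    (h : HasJack κ α) : HasJack κ (α ∘ Equiv.swap i j) := by
  obtain ⟨ζ, hζ, hn⟩ := h
  have hij : i ≠ j := by rintro rfl; exact lt_irrefl _ hα
  obtain ⟨e1, e2⟩ := opU_swap_eigen hα.ne hi hj (hζ.eigen i) (hζ.eigen j)
  refine ⟨_, isNSJack_of_eigen hκ (fun l => ?_) ?_,
    (pairing_swap_eigen hα.ne hi hj (hζ.eigen i) (hζ.eigen j)).trans ?_⟩
  · rw [hxi]
    by_cases h1 : l = i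
    · rw [h1, e1, Equiv.swap_apply_left]
    · by_cases h2 : l = j
      · rw [h2, e2, Equiv.swap_apply_right]
      · rw [map_add, hl l _ h1 h2, map_smul, hζ.eigen, map_smul,
          Equiv.swap_apply_of_ne_of_ne h1 h2, smul_add, smul_comm (xi κ α l)]
  · have h1 : Finsupp.equivFunOnFinite.symm (α ∘ Equiv.swap i j)
        = Finsupp.mapDomain (Equiv.swap i j) (Finsupp.equivFunOnFinite.symm α) := by
      ext l
      rw [Finsupp.mapDomain_equiv_apply]
      simp
    -- The swapped composition lies above α, so ζ_α has no such monomial, and the leading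
    -- coefficient comes from the transposed copy of ζ_α alone.
    have h2 : coeff (Finsupp.equivFunOnFinite.symm (α ∘ Equiv.swap i j)) ζ = 0 := by
      by_contra hc
      rcases hζ.triangular _ hc with h | h
      · have h3 := hgt.compHeight_lt
        exact h3.ne (congrArg compHeight h).symm
      · exact lt_asymm hgt.compHeight_lt h.compHeight_lt
    rw [coeff_add, coeff_smul, h2, h1, coeff_rename_mapDomain _ (Equiv.swap i j).injective,
      hζ.monic]
    simp
  · rw [hn, jackNorm_swap hκ _ rfl (sub_pos.2 hα) hhook]

theorem rank_swap_one_two (a m : ℕ) (l : Fin 3) :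
    rank ![a, m + 1, 0] l = rank ![a, 0, m + 1] (Equiv.swap 1 2 l) := by
  simp only [rank, Finset.card_filter, Fin.sum_univ_three]
  simp only [Matrix.cons_val]
  fin_cases l <;> simp [Equiv.swap_apply_def] <;> grind

theorem rank_swap_zero_one (m : ℕ) (l : Fin 3) :
    rank ![m + 1, 0, 0] l = rank ![0, m + 1, 0] (Equiv.swap 0 1 l) := by
  simp only [rank, Finset.card_filter, Fin.sum_univ_three]
  simp only [Matrix.cons_val]
  fin_cases l <;> simp [Equiv.swap_apply_def]

/-- Induction on the degree. A composition with positive last part is raised from degree n. One with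
last part 0 is reached by moving its last nonzero part to the left past a zero, at most twice; only
the shapes (a, 0, m+1) and (0, m+1, 0) are ever swapped. -/
theorem hasJack {κ : ℝ} (hκ : 0 ≤ κ) : ∀ (n : ℕ) (α : Fin 3 → ℕ), α 0 + α 1 + α 2 = n →
    HasJack κ α := by
  intro n
  induction n with
  | zero =>
    intro α h
    have : α = 0 := by ext i; fin_cases i <;> simp <;> omega
    rw [this]; exact hasJack_zero hκ
  | succ n ih =>
    have h1 : ∀ α : Fin 3 → ℕ, α 0 + α 1 + α 2 = n + 1 → 0 < α 2 → HasJack κ α := by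
      intro α h h2
      have := hasJack_raiseIdx hκ (ih ![α 2 - 1, α 0, α 1] (by simp; omega))
      convert this using 1
      ext i; fin_cases i <;> simp [raiseIdx]; omega
    have h2 : ∀ a m, a + (m + 1) = n + 1 → HasJack κ ![a, m + 1, 0] := by
      intro a m h
      have e : ![a, m + 1, 0] = ![a, 0, m + 1] ∘ Equiv.swap (1 : Fin 3) 2 := by
        ext i; fin_cases i <;> simp [Equiv.swap_apply_def]
      rw [e]
      apply hasJack_swap hκ
      · exact xi_lt_xi hκ (by simp)
      · exact fun f => (opU_swap_one_two κ f).1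
      · exact fun f => (opU_swap_one_two κ f).2.1
      · intro l f hl1 hl2
        have : l = 0 := by omega
        rw [this]; exact (opU_swap_one_two κ f).2.2
      · rw [← e, compGT_iff]
        simp only [Matrix.cons_val]
        omega
      · intro l
        rw [xi, xi, ← rank_swap_one_two, ← e, e]; rfl
      · rw [← e]; exact fun t => hookProd_swap_one_two κ t a m
      · exact h1 _ (by simpa using h) (by simp)
    have h3 : HasJack κ ![n + 1, 0, 0] := by
      have e : ![n + 1, 0, 0] = ![0, n + 1, 0] ∘ Equiv.swap (0 : Fin 3) 1 := by
        ext i; fin_cases i <;> simp [Equiv.swap_apply_def]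
      rw [e]
      apply hasJack_swap hκ
      · exact xi_lt_xi hκ (by simp)
      · exact fun f => (opU_swap_zero_one κ f).1
      · exact fun f => (opU_swap_zero_one κ f).2.1
      · intro l f hl1 hl2
        have : l = 2 := by omega
        rw [this]; exact (opU_swap_zero_one κ f).2.2
      · rw [← e, compGT_iff]
        simp only [Matrix.cons_val]
        omega
      · intro l
        rw [xi, xi, ← rank_swap_zero_one, ← e, e]; rfl
      · rw [← e]; exact fun t => hookProd_swap_zero_one κ t n
      · exact h2 0 n (by simp)
    intro α hα
    by_cases c2 : 0 < α 2
    · exact h1 α hα c2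
    by_cases c1 : 0 < α 1
    · have e : α = ![α 0, α 1 - 1 + 1, 0] := by
        ext i; fin_cases i <;> simp <;> omega
      rw [e]; exact h2 _ _ (by omega)
    · have e : α = ![n + 1, 0, 0] := by
        ext i; fin_cases i <;> simp <;> omega
      rw [e]; exact h3

/-! ### Spanning, uniqueness and orthogonality -/

theorem xi_ne_of_ne {κ : ℝ} (hκ : 0 ≤ κ) {α β : Fin 3 → ℕ} (h : α ≠ β) :
    ∃ i, xi κ α i ≠ xi κ β i := by
  by_contra! hc
  exact h (xi_injective hκ hc)

theorem pairing_eq_zero_of_isNSJack {κ : ℝ} (hκ : 0 ≤ κ) {α β : Fin 3 → ℕ} (h : α ≠ β)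
    {ζ η : MvPolynomial (Fin 3) ℝ} (hζ : IsNSJack κ α ζ) (hη : IsNSJack κ β η) (k : ℕ) :
    pairing (dunklD κ) (yE k * sq ζ) (yE k * sq η) = 0 :=
  let ⟨i, hi⟩ := xi_ne_of_ne hκ h
  pairing_eq_zero_of_eigen (hζ.eigen i) (hη.eigen i) hi k

theorem isNSJack_nsJack {κ : ℝ} (hκ : 0 ≤ κ) (α : Fin 3 → ℕ) : IsNSJack κ α (nsJack κ α) := by
  obtain ⟨ζ, hζ, -⟩ := hasJack hκ _ α rfl
  have h : ∃ ζ, IsNSJack κ α ζ := ⟨ζ, hζ⟩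
  rw [nsJack, dif_pos h]
  exact h.choose_spec

/-- Unitriangularity expresses x^α by ζ_α and monomials of smaller height. -/
theorem mon_mem_span_nsJack {κ : ℝ} (hκ : 0 ≤ κ) (α : Fin 3 → ℕ) :
    mon α ∈ Submodule.span ℝ (Set.range (nsJack κ : (Fin 3 → ℕ) → _)) := by
  induction hn : compHeight α using WellFoundedLT.induction generalizing α with
  | ind n ih =>
    subst hn
    have hα := isNSJack_nsJack hκ α
    have h1 : nsJack κ α ∈ Submodule.span ℝ (Set.range (nsJack κ : (Fin 3 → ℕ) → _)) :=
      Submodule.subset_span ⟨α, rfl⟩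
    have h2 : mon α = nsJack κ α - ∑ β ∈ (nsJack κ α).support.erase
        (Finsupp.equivFunOnFinite.symm α), monomial β (coeff β (nsJack κ α)) := by
      rw [eq_sub_iff_add_eq, mon_eq_monomial, ← hα.monic, Finset.add_sum_erase _
        (fun β => monomial β (coeff β (nsJack κ α))), ← as_sum]
      rw [mem_support_iff, hα.monic]; exact one_ne_zero
    rw [h2]
    refine Submodule.sub_mem _ h1 (Submodule.sum_mem _ fun β hβ => ?_)
    rw [Finset.mem_erase, mem_support_iff] at hβ
    rw [monomial_eq_smul_mon]
    refine Submodule.smul_mem _ _ ?_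
    rcases hα.triangular β hβ.2 with h | h
    · exact absurd (by ext i; simp [← h]) hβ.1
    · exact ih _ h.compHeight_lt _ rfl

theorem span_nsJack {κ : ℝ} (hκ : 0 ≤ κ) :
    Submodule.span ℝ (Set.range (nsJack κ : (Fin 3 → ℕ) → _)) = ⊤ := by
  rw [eq_top_iff]
  intro f _
  rw [f.as_sum]
  refine Submodule.sum_mem _ fun β _ => ?_
  rw [monomial_eq_smul_mon]
  exact Submodule.smul_mem _ _ (mon_mem_span_nsJack hκ _)

theorem linearIndependent_of_pairing {ι M : Type*} [AddCommGroup M] [Module ℝ M]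
    (B : M →ₗ[ℝ] M →ₗ[ℝ] ℝ) (b : ι → M) (h0 : ∀ a a', a ≠ a' → B (b a) (b a') = 0)
    (h1 : ∀ a, B (b a) (b a) ≠ 0) : LinearIndependent ℝ b := by
  rw [linearIndependent_iff']
  intro s g hg i hi
  have h := congrArg (fun m => B m (b i)) hg
  simp only [map_sum, LinearMap.sum_apply, map_smul, LinearMap.smul_apply, map_zero,
    LinearMap.zero_apply, smul_eq_mul] at h
  rw [Finset.sum_eq_single_of_mem i hi fun j _ hj => by rw [h0 j i hj, mul_zero]] at h
  exact (mul_eq_zero.1 h).resolve_right (h1 i)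

theorem pairing_yE_mul_sq_of_zero {κ : ℝ} {α : Fin 3 → ℕ} {ζ : MvPolynomial (Fin 3) ℝ}
    (hζ : IsNSJack κ α ζ) (h : pairing (dunklD κ) (sq ζ) (sq ζ) = jackNorm κ 0 α) :
    ∀ k ≤ 3, pairing (dunklD κ) (yE k * sq ζ) (yE k * sq ζ) = jackNorm κ k α := by
  intro k
  induction k with
  | zero => intro _; rw [yE_zero, one_mul, h]
  | succ k ih =>
    intro hk
    have h1 := pairing_yE_succ (hζ.eigen ⟨k, hk⟩)
    have h2 := jackNorm_succ κ ⟨k, hk⟩ α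
    simp only at h1 h2
    rw [h1, h2, ih (by omega)]

/-- An exponent of maximal height carries the spectral vector of α and so equals α. Uniqueness
follows: the difference of two candidates has coefficient 0 at α and must vanish. -/
theorem coeff_ne_zero_of_eigen {κ : ℝ} (hκ : 0 ≤ κ) {α : Fin 3 → ℕ} {f : MvPolynomial (Fin 3) ℝ}
    (hf : ∀ i, opU κ i f = xi κ α i • f) (h0 : f ≠ 0) :
    coeff (Finsupp.equivFunOnFinite.symm α) f ≠ 0 := by
  obtain ⟨δ, hδ, hmax⟩ := f.support.exists_max_image (fun γ => compHeight γ)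
    (support_nonempty.2 h0)
  rw [mem_support_iff] at hδ
  have hm : ∀ γ : Fin 3 →₀ ℕ, coeff γ f ≠ 0 → ¬CompGT γ δ := fun γ hγ hgt =>
    absurd (hmax γ (mem_support_iff.2 hγ)) (not_le.2 hgt.compHeight_lt)
  have : α = δ := by
    apply xi_injective hκ
    intro i
    have h1 := coeff_opU_of_maximal κ i hm
    rw [hf, coeff_smul, smul_eq_mul] at h1
    exact mul_right_cancel₀ hδ h1
  rw [this]
  convert hδ
  ext i; rfl

theorem existsUnique_isNSJack {κ : ℝ} (hκ : 0 ≤ κ) (α : Fin 3 → ℕ) :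
    ∃! ζ, IsNSJack κ α ζ := by
  refine ⟨nsJack κ α, isNSJack_nsJack hκ α, fun ζ hζ => ?_⟩
  have hη := isNSJack_nsJack hκ α
  by_contra hne
  refine coeff_ne_zero_of_eigen hκ (f := ζ - nsJack κ α) (α := α) (fun i => ?_)
    (sub_ne_zero.2 hne) ?_
  · rw [map_sub, hζ.eigen, hη.eigen, smul_sub]
  · rw [coeff_sub, hζ.monic, hη.monic, sub_self]

theorem pairing_yE_mul_sq_nsJack {κ : ℝ} (hκ : 0 ≤ κ) (α : Fin 3 → ℕ) {k : ℕ} (hk : k ≤ 3) :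
    pairing (dunklD κ) (yE k * sq (nsJack κ α)) (yE k * sq (nsJack κ α)) = jackNorm κ k α := by
  obtain ⟨ζ, hζ, hn⟩ := hasJack hκ _ α rfl
  rw [(existsUnique_isNSJack hκ α).unique (isNSJack_nsJack hκ α) hζ]
  exact pairing_yE_mul_sq_of_zero hζ hn k hk

/-! ### The orthogonal basis `p_γ` -/

theorem oddFirst_congr {γ γ' : Fin 3 → ℕ} (h : ∀ i, Odd (γ i) ↔ Odd (γ' i)) :
    oddFirst γ = oddFirst γ' := by
  have : (fun i => (γ i + 1) % 2) = fun i => (γ' i + 1) % 2 := by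
    funext i
    have := h i
    rw [Nat.odd_iff, Nat.odd_iff] at this
    omega
  rw [oddFirst, oddFirst, this]

theorem oddCount_congr {γ γ' : Fin 3 → ℕ} (h : ∀ i, Odd (γ i) ↔ Odd (γ' i)) :
    oddCount γ = oddCount γ' := by
  rw [oddCount, oddCount]
  simp only [h]

theorem oddCount_le (γ : Fin 3 → ℕ) : oddCount γ ≤ 3 :=
  (Finset.card_le_univ _).trans (by simp)

theorem odd_oddFirst_iff (γ : Fin 3 → ℕ) (i : Fin 3) :
    Odd (γ (oddFirst γ i)) ↔ (i : ℕ) < oddCount γ := by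
  have hc : oddCount γ = (Finset.univ.filter fun i => Odd (γ (oddFirst γ i))).card := by
    rw [oddCount, Finset.card_filter, Finset.card_filter]
    exact (Equiv.sum_comp (oddFirst γ) fun i => if Odd (γ i) then 1 else 0).symm
  have hs := (oddFirst_spec γ).1
  rw [hc]
  constructor
  · intro h
    have : Finset.Iic i ⊆ Finset.univ.filter fun i => Odd (γ (oddFirst γ i)) := by
      intro j hj
      rw [Finset.mem_filter]
      refine ⟨Finset.mem_univ _, ?_⟩
      rcases (Finset.mem_Iic.1 hj).eq_or_lt with rfl | hlt
      · exact h
      · exact hs _ _ hlt h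
    have := Finset.card_le_card this
    rw [Fin.card_Iic] at this
    omega
  · intro h
    by_contra hi
    have : (Finset.univ.filter fun i => Odd (γ (oddFirst γ i))) ⊆ Finset.Iio i := by
      intro j hj
      rw [Finset.mem_filter] at hj
      rw [Finset.mem_Iio]
      by_contra hij
      rcases (not_lt.1 hij).eq_or_lt with rfl | hlt
      · exact hi hj.2
      · exact hi (hs _ _ hlt hj.2)
    have := Finset.card_le_card this
    rw [Fin.card_Iio] at this
    omega

theorem betaOf_eq (γ : Fin 3 → ℕ) (i : Fin 3) :
    betaOf γ i = 2 * alphaOf γ i + if (i : ℕ) < oddCount γ then 1 else 0 := by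
  have h := odd_oddFirst_iff γ i
  rw [Nat.odd_iff] at h
  rw [alphaOf, betaOf]
  split_ifs <;> omega

theorem normP_eq_jackNorm (κ : ℝ) (γ : Fin 3 → ℕ) :
    normP κ γ = jackNorm κ (oddCount γ) (alphaOf γ) := by
  have h1 : ∑ i, γ i = ∑ i, (2 * alphaOf γ i + if (i : ℕ) < oddCount γ then 1 else 0) := by
    simp only [← betaOf_eq]
    exact (Equiv.sum_comp (oddFirst γ) γ).symm
  have h2 : (fun i => betaOf γ i - alphaOf γ i)
      = fun i => alphaOf γ i + if (i : ℕ) < oddCount γ then 1 else 0 := by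
    funext i
    rw [betaOf_eq]
    omega
  rw [normP, jackNorm, h1, h2]

theorem p_eq (κ : ℝ) (γ : Fin 3 → ℕ) :
    p κ γ = rename (oddFirst γ) (yE (oddCount γ) * sq (nsJack κ (alphaOf γ))) := rfl

theorem signFlip_rename {N : ℕ} (w : Equiv.Perm (Fin N)) (l : Fin N)
    (f : MvPolynomial (Fin N) ℝ) :
    signFlip (w l) (rename w f) = rename w (signFlip l f) := by
  have h : (signFlip (w l)).comp (rename (R := ℝ) w) = (rename w).comp (signFlip l) := by
    apply MvPolynomial.algHom_ext
    intro i
    by_cases h : i = l <;> simp [signFlip_X, h]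
  exact DFunLike.congr_fun h f

theorem signFlip_yE (l : Fin 3) (k : ℕ) :
    signFlip l (yE k) = (if (l : ℕ) < k then -1 else 1 : ℝ) • yE k := by
  obtain ⟨i, hi⟩ := exists_ne l
  obtain ⟨j, hji, hjl⟩ := exists_third hi
  rw [yE_eq_prod, prod_fin_three hi hji hjl, map_mul, map_mul]
  have h : ∀ m : Fin 3, m ≠ l → signFlip l (if (m : ℕ) < k then X m else 1)
      = if (m : ℕ) < k then X m else 1 := by
    intro m hm; split_ifs <;> simp [signFlip_X, hm]
  have h' : signFlip l (if (l : ℕ) < k then X l else 1)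
      = (if (l : ℕ) < k then -1 else 1 : ℝ) • (if (l : ℕ) < k then X l else 1) := by
    split_ifs <;> simp [signFlip_X]
  rw [h i hi, h j hjl, h', mul_smul_comm]

/-- The parities of γ are joint eigenvalues of the sign changes, which preserve the pairing;
polynomials of different parity are therefore orthogonal. -/
theorem signFlip_p (κ : ℝ) (l : Fin 3) (γ : Fin 3 → ℕ) :
    signFlip l (p κ γ) = (if Odd (γ l) then -1 else 1 : ℝ) • p κ γ := by
  obtain ⟨m, rfl⟩ := (oddFirst γ).surjective l
  rw [p_eq, signFlip_rename, map_mul, signFlip_sq, signFlip_yE, smul_mul_assoc, map_smul]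
  simp only [odd_oddFirst_iff]

theorem pairing_p_eq_zero {κ : ℝ} (hκ : 0 ≤ κ) {γ γ' : Fin 3 → ℕ} (hne : γ ≠ γ') :
    pairing (dunklD κ) (p κ γ) (p κ γ') = 0 := by
  by_cases h : ∀ i, Odd (γ i) ↔ Odd (γ' i)
  · rw [p_eq, p_eq, oddFirst_congr h, oddCount_congr h, pairing_rename]
    refine pairing_eq_zero_of_isNSJack hκ (fun ha => hne ?_) (isNSJack_nsJack hκ _)
      (isNSJack_nsJack hκ _) _
    funext l
    obtain ⟨m, rfl⟩ := (oddFirst γ').surjective l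
    have h1 := betaOf_eq γ m
    rw [ha, oddCount_congr h, ← betaOf_eq, betaOf, betaOf, oddFirst_congr h] at h1
    exact h1
  · push Not at h
    obtain ⟨l, hl⟩ := h
    have h1 := pairing_signFlip κ l (p κ γ) (p κ γ')
    rw [signFlip_p, signFlip_p, pairing_smul_left, pairing_smul_right] at h1
    rcases hl with ⟨ha, hb⟩ | ⟨ha, hb⟩
    · rw [if_pos ha, if_neg (by simpa using hb)] at h1
      linarith
    · rw [if_neg (by simpa using ha), if_pos hb] at h1
      linarith

theorem pairing_p_self {κ : ℝ} (hκ : 0 ≤ κ) (γ : Fin 3 → ℕ) :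
    pairing (dunklD κ) (p κ γ) (p κ γ) = normP κ γ := by
  rw [p_eq, pairing_rename, pairing_yE_mul_sq_nsJack hκ _ (oddCount_le γ), normP_eq_jackNorm]

theorem normP_pos {κ : ℝ} (hκ : 0 ≤ κ) (γ : Fin 3 → ℕ) : 0 < normP κ γ := by
  rw [normP_eq_jackNorm]; exact jackNorm_pos hκ _ _

/-- Every α occurs in the parity class of γ: the index γ' has the parities of γ and the halved
entries α. -/
theorem rename_yE_mul_sq_nsJack (κ : ℝ) (γ α : Fin 3 → ℕ) :
    ∃ γ', p κ γ' = rename (oddFirst γ) (yE (oddCount γ) * sq (nsJack κ α)) := by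
  set w := oddFirst γ with hw
  let γ' : Fin 3 → ℕ := fun i =>
    2 * α (w.symm i) + if ((w.symm i : Fin 3) : ℕ) < oddCount γ then 1 else 0
  have h : ∀ i, Odd (γ' i) ↔ Odd (γ i) := by
    intro i
    obtain ⟨m, rfl⟩ := w.surjective i
    rw [hw, odd_oddFirst_iff, ← hw, Nat.odd_iff]
    simp only [γ', w.symm_apply_apply]
    split_ifs <;> omega
  have ha : alphaOf γ' = α := by
    funext i
    rw [alphaOf, betaOf, oddFirst_congr h]
    simp only [γ', ← hw, w.symm_apply_apply]
    split_ifs <;> omega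
  exact ⟨γ', by rw [p_eq, oddFirst_congr h, oddCount_congr h, ha]⟩

theorem mon_eq_rename (γ : Fin 3 → ℕ) :
    mon γ = rename (oddFirst γ) (yE (oddCount γ) * sq (mon (alphaOf γ))) := by
  have h : yE (oddCount γ) * sq (mon (alphaOf γ)) = mon (betaOf γ) := by
    rw [yE_eq_prod, mon, mon, map_prod, ← Finset.prod_mul_distrib]
    refine Finset.prod_congr rfl fun i _ => ?_
    rw [betaOf_eq, pow_add, pow_mul, map_pow, sq_X, mul_comm]
    split_ifs <;> simp
  rw [h, rename_mon]
  congr 1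
  funext i
  simp [betaOf]

theorem span_p {κ : ℝ} (hκ : 0 ≤ κ) : Submodule.span ℝ (Set.range (p κ)) = ⊤ := by
  rw [eq_top_iff]
  intro f _
  rw [f.as_sum]
  refine Submodule.sum_mem _ fun γ _ => ?_
  rw [monomial_eq_smul_mon, mon_eq_rename]
  refine Submodule.smul_mem _ _ ?_
  -- T embeds all polynomials as the parity class of γ. It sends Jack polynomials to members of the
  -- family p, so spanning carries over class by class.
  let T : MvPolynomial (Fin 3) ℝ →ₗ[ℝ] MvPolynomial (Fin 3) ℝ :=
    (rename (oddFirst γ)).toLinearMap ∘ₗ LinearMap.mulLeft ℝ (yE (oddCount γ)) ∘ₗ sq.toLinearMap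
  have h : (⊤ : Submodule ℝ _) ≤ (Submodule.span ℝ (Set.range (p κ))).comap T := by
    rw [← span_nsJack hκ, Submodule.span_le]
    rintro _ ⟨α, rfl⟩
    obtain ⟨γ', h'⟩ := rename_yE_mul_sq_nsJack κ γ α
    exact Submodule.subset_span ⟨γ', h'⟩
  exact h (Submodule.mem_top (x := mon (alphaOf γ)))

theorem isOrthoBasis_p {κ : ℝ} (hκ : 0 ≤ κ) :
    IsOrthoBasis (pairing (dunklD κ)) ⊤ (p κ) (normP κ) where
  linearIndependent := linearIndependent_of_pairing (pairingForm (dunklD κ)) (p κ)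
    (fun _ _ h => pairing_p_eq_zero hκ h)
    (fun γ => by rw [pairingForm_apply, pairing_p_self hκ]; exact (normP_pos hκ γ).ne')
  span_eq := span_p hκ
  orthogonal _ _ h := pairing_p_eq_zero hκ h
  norm_eq := pairing_p_self hκ
  norm_pos := normP_pos hκ

/-! ### The change of variables `y = H x` -/

theorem hadamard_apply_zero (i : Fin 4) : hadamard 0 i = 1 / 2 := by
  fin_cases i <;> simp [hadamard]

theorem hadamard_mul_transpose : hadamard * hadamard.transpose = 1 := by
  ext i j
  rw [Matrix.mul_apply, Fin.sum_univ_four]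
  fin_cases i <;> fin_cases j <;> simp [hadamard] <;> norm_num

theorem hadamard_transpose_mul : hadamard.transpose * hadamard = 1 :=
  mul_eq_one_comm.1 hadamard_mul_transpose

theorem sum_hadamard_mul (k l : Fin 4) :
    ∑ i, hadamard k i * hadamard l i = if k = l then 1 else 0 := by
  have := congrFun (congrFun hadamard_mul_transpose k) l
  rwa [Matrix.mul_apply, Matrix.one_apply] at this

theorem sum_hadamard_mul' (i j : Fin 4) :
    ∑ k, hadamard k i * hadamard k j = if i = j then 1 else 0 := by
  have := congrFun (congrFun hadamard_transpose_mul i) j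
  rwa [Matrix.mul_apply, Matrix.one_apply] at this

theorem yForm_eq (k : Fin 4) : yForm k = ∑ i, C (hadamard k i) * X i := rfl

theorem yForm_one : yForm 1 = C (1 / 2) * (X 0 + X 1 - X 2 - X 3) := by
  rw [yForm_eq, Fin.sum_univ_four]; simp [hadamard]; ring

theorem yForm_two : yForm 2 = C (1 / 2) * (X 0 - X 1 + X 2 - X 3) := by
  rw [yForm_eq, Fin.sum_univ_four]; simp [hadamard]; ring

theorem yForm_three : yForm 3 = C (1 / 2) * (X 0 - X 1 - X 2 + X 3) := by
  rw [yForm_eq, Fin.sum_univ_four]; simp [hadamard]; ring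

theorem X_eq_sum_yForm (i : Fin 4) : X i = ∑ k, C (hadamard k i) * yForm k := by
  simp only [yForm_eq, Finset.mul_sum]
  rw [Finset.sum_comm]
  have : ∀ j, ∑ k, C (hadamard k i) * (C (hadamard k j) * X j)
      = (C (if i = j then 1 else 0) * X j : MvPolynomial (Fin 4) ℝ) := by
    intro j
    rw [← sum_hadamard_mul', map_sum, Finset.sum_mul]
    refine Finset.sum_congr rfl fun k _ => ?_
    rw [map_mul, mul_assoc]
  simp [this]

theorem inX_X (j : Fin 3) : inX (X j) = yForm j.succ := by simp [inX]

theorem inX_C (a : ℝ) : inX (C a) = C a := AlgHom.commutes _ a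

theorem constantCoeff_yForm (k : Fin 4) : constantCoeff (yForm k) = 0 := by
  simp [yForm_eq]

theorem constantCoeff_inX (f : MvPolynomial (Fin 3) ℝ) :
    constantCoeff (inX f) = constantCoeff f := by
  induction f using MvPolynomial.induction_on with
  | C a => rw [inX_C]; simp
  | add p q hp hq => rw [map_add, map_add, hp, hq, map_add]
  | mul_X p j hp => rw [map_mul, map_mul, inX_X, constantCoeff_yForm]; simp

/-- The span is stable under multiplication by every y_k, hence by every x_i. Operator identities
can then be tested on products f(y_1, y_2, y_3) y_0^n. -/
theorem span_inX_mul_pow :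
    Submodule.span ℝ (Set.range fun q : MvPolynomial (Fin 3) ℝ × ℕ => inX q.1 * yForm 0 ^ q.2)
      = ⊤ := by
  set S := Submodule.span ℝ
    (Set.range fun q : MvPolynomial (Fin 3) ℝ × ℕ => inX q.1 * yForm 0 ^ q.2) with hS
  have hy : ∀ k F, F ∈ S → yForm k * F ∈ S := by
    intro k F hF
    have : S ≤ S.comap (LinearMap.mulLeft ℝ (yForm k)) := by
      conv_lhs => rw [hS]
      rw [Submodule.span_le]
      rintro _ ⟨⟨f, n⟩, rfl⟩
      refine Fin.cases ?_ (fun j => ?_) k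
      · exact Submodule.subset_span ⟨(f, n + 1), by simp only [LinearMap.mulLeft_apply]; ring⟩
      · exact Submodule.subset_span ⟨(X j * f, n), by
          simp only [LinearMap.mulLeft_apply, map_mul, inX_X]; ring⟩
    exact this hF
  rw [eq_top_iff]
  intro F _
  induction F using MvPolynomial.induction_on with
  | C a => exact Submodule.subset_span ⟨(C a, 0), by simp⟩
  | add p q hp hq => exact Submodule.add_mem _ (hp trivial) (hq trivial)
  | mul_X p i hp =>
    rw [mul_comm, X_eq_sum_yForm, Finset.sum_mul]
    refine Submodule.sum_mem _ fun k _ => ?_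
    rw [mul_assoc, ← smul_eq_C_mul]
    exact Submodule.smul_mem _ _ (hy k p (hp trivial))

theorem end_ext_inX_mul_pow {S T : Module.End ℝ (MvPolynomial (Fin 4) ℝ)}
    (h : ∀ f n, S (inX f * yForm 0 ^ n) = T (inX f * yForm 0 ^ n)) : S = T := by
  apply LinearMap.ext_on span_inX_mul_pow
  rintro _ ⟨⟨f, n⟩, rfl⟩
  exact h f n

/-! ### The Dunkl operators in the coordinates `y` -/

/-- The Dunkl operator in the direction of the row `k` of the Hadamard matrix. -/
def dunklY (κ κ' : ℝ) (k : Fin 4) : Module.End ℝ (MvPolynomial (Fin 4) ℝ) :=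
  ∑ i, hadamard k i • dunklAZ κ κ' i

theorem dunklAZ_eq_sum (κ κ' : ℝ) (i : Fin 4) :
    dunklAZ κ κ' i = ∑ k, hadamard k i • dunklY κ κ' k := by
  simp only [dunklY, Finset.smul_sum, smul_smul]
  rw [Finset.sum_comm]
  simp only [← Finset.sum_smul, sum_hadamard_mul']
  simp

theorem divDiff_rootSub_symm {N : ℕ} {i j : Fin N} (hij : i ≠ j) (f : MvPolynomial (Fin N) ℝ) :
    divDiff (rootSub j i) f = -divDiff (rootSub i j) f := by
  apply divDiff_eq_of_mul_eq (rootSub_ne_zero hij.symm)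
  have h := linForm_mul_divDiff (rootSub_ne_zero hij) f
  rw [reflect_rootSub hij, linForm_rootSub] at h
  rw [reflect_rootSub hij.symm, linForm_rootSub, Equiv.swap_comm]
  linear_combination h

theorem rootAdd_comm {N : ℕ} (i j : Fin N) : rootAdd i j = rootAdd j i := add_comm _ _

theorem divDiff_inX_of_sub {i j : Fin 4} {a b : Fin 3} (hij : i ≠ j) (hab : a ≠ b)
    (h1 : yForm a.succ - yForm b.succ = X i - X j)
    (h2 : ∀ m : Fin 3, rename (Equiv.swap i j) (yForm m.succ)
      = yForm (Equiv.swap a b m).succ) (f : MvPolynomial (Fin 3) ℝ) :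
    divDiff (rootSub i j) (inX f) = inX (divDiff (rootSub a b) f) := by
  rw [divDiff_map (rootSub_ne_zero hab) (rootSub_ne_zero hij) inX 1]
  · simp
  · rw [linForm_rootSub, linForm_rootSub, map_sub, inX_X, inX_X, h1, C_1, one_mul]
  · intro m
    rw [reflect_rootSub hij, reflect_rootSub hab, inX_X, rename_X, inX_X, h2]

theorem divDiff_inX_of_add {i j : Fin 4} {a b : Fin 3} (hij : i ≠ j) (hab : a ≠ b)
    (h1 : yForm a.succ + yForm b.succ = X i - X j)
    (h2 : ∀ m : Fin 3, rename (Equiv.swap i j) (yForm m.succ) = inX (tau a b (X m)))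
    (f : MvPolynomial (Fin 3) ℝ) :
    divDiff (rootSub i j) (inX f) = inX (divDiff (rootAdd a b) f) := by
  rw [divDiff_map (rootAdd_ne_zero hab) (rootSub_ne_zero hij) inX 1]
  · simp
  · rw [linForm_rootAdd, linForm_rootSub, map_add, inX_X, inX_X, h1, C_1, one_mul]
  · intro m
    rw [reflect_rootSub hij, reflect_rootAdd hab, inX_X, h2]

theorem C_half_add : (C (1 / 2) : MvPolynomial (Fin 4) ℝ) + C (1 / 2) = 1 := by
  rw [← C_add, ← C_1]; norm_num

/-- The dictionary between the six positive roots of A_3 and those of D_3: roots that involve x_0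
become sums of two y's, the others become differences. -/
theorem divDiff_rootSub_inX (f : MvPolynomial (Fin 3) ℝ) :
    divDiff (rootSub (0 : Fin 4) 1) (inX f) = inX (divDiff (rootAdd 1 2) f) ∧
    divDiff (rootSub (0 : Fin 4) 2) (inX f) = inX (divDiff (rootAdd 0 2) f) ∧
    divDiff (rootSub (0 : Fin 4) 3) (inX f) = inX (divDiff (rootAdd 0 1) f) ∧
    divDiff (rootSub (1 : Fin 4) 2) (inX f) = inX (divDiff (rootSub 0 1) f) ∧
    divDiff (rootSub (1 : Fin 4) 3) (inX f) = inX (divDiff (rootSub 0 2) f) ∧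
    divDiff (rootSub (2 : Fin 4) 3) (inX f) = inX (divDiff (rootSub 1 2) f) := by
  have s0 : Fin.succ (0 : Fin 3) = 1 := rfl
  have s1 : Fin.succ (1 : Fin 3) = 2 := rfl
  have s2 : Fin.succ (2 : Fin 3) = 3 := rfl
  refine ⟨divDiff_inX_of_add (by decide) (by decide) ?_ ?_ f,
    divDiff_inX_of_add (by decide) (by decide) ?_ ?_ f,
    divDiff_inX_of_add (by decide) (by decide) ?_ ?_ f,
    divDiff_inX_of_sub (by decide) (by decide) ?_ ?_ f,
    divDiff_inX_of_sub (by decide) (by decide) ?_ ?_ f,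
    divDiff_inX_of_sub (by decide) (by decide) ?_ ?_ f⟩
  all_goals first
    | intro m
      fin_cases m <;>
        simp [s0, s1, s2, inX_X, tau_X, yForm_one, yForm_two, yForm_three,
          Equiv.swap_apply_def] <;> ring
    | rw [s1, s2, yForm_two, yForm_three]; linear_combination (X 0 - X 1) * C_half_add
    | rw [s1, s2, yForm_two, yForm_three]; linear_combination (X 2 - X 3) * C_half_add
    | rw [s0, s2, yForm_one, yForm_three]; linear_combination (X 0 - X 2) * C_half_add
    | rw [s0, s2, yForm_one, yForm_three]; linear_combination (X 1 - X 3) * C_half_add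
    | rw [s0, s1, yForm_one, yForm_two]; linear_combination (X 0 - X 3) * C_half_add
    | rw [s0, s1, yForm_one, yForm_two]; linear_combination (X 1 - X 2) * C_half_add

theorem rename_yForm_zero (w : Equiv.Perm (Fin 4)) : rename w (yForm 0) = yForm 0 := by
  simp only [yForm_eq, hadamard_apply_zero, ← Finset.mul_sum, map_mul, map_sum, rename_X, rename_C]
  rw [Equiv.sum_comp w fun i => (X i : MvPolynomial (Fin 4) ℝ)]

theorem hadamard_zero_ne_zero : hadamard 0 ≠ 0 := by
  intro h
  have := congrFun h 0
  rw [hadamard_apply_zero] at this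
  norm_num at this

theorem reflect_hadamard_zero_yForm (k : Fin 4) :
    reflect (hadamard 0) (yForm k) = if k = 0 then -yForm 0 else yForm k := by
  have h1 : ∑ j, hadamard 0 j ^ 2 = 1 := by simp [hadamard_apply_zero]; norm_num
  have h2 : reflect (hadamard 0) (yForm k)
      = yForm k - C (∑ i, hadamard k i * (2 * hadamard 0 i)) * yForm 0 := by
    conv_lhs => rw [yForm_eq, map_sum]
    conv_rhs => rw [yForm_eq, map_sum, Finset.sum_mul, ← Finset.sum_sub_distrib]
    refine Finset.sum_congr rfl fun i _ => ?_
    rw [map_mul, reflect_X, h1, div_one, ← yForm, map_mul,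
      show reflect (hadamard 0) (C (hadamard k i)) = C (hadamard k i) from AlgHom.commutes _ _]
    simp only [map_mul]
    ring
  have h3 : ∑ i, hadamard k i * (2 * hadamard 0 i) = if k = 0 then 2 else 0 := by
    have h4 : ∀ i, hadamard k i * (2 * hadamard 0 i) = 2 * (hadamard k i * hadamard 0 i) := by
      intro i; ring
    simp only [h4, ← Finset.mul_sum, sum_hadamard_mul]
    simp
  rw [h2, h3]
  split_ifs with h
  · rw [h, map_ofNat]; ring
  · simp

theorem reflect_hadamard_zero_inX (f : MvPolynomial (Fin 3) ℝ) :
    reflect (hadamard 0) (inX f) = inX f := by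
  have h : (reflect (hadamard 0)).comp inX = inX := by
    apply MvPolynomial.algHom_ext
    intro i
    rw [AlgHom.comp_apply, inX_X, reflect_hadamard_zero_yForm, if_neg (Fin.succ_ne_zero i)]
  exact DFunLike.congr_fun h f

/-- Only odd powers of y_0 change under σ_0, and they change sign, whence the 2. At n = 0 the
truncated exponent is harmless because the coefficient is 0. -/
theorem divDiff_hadamard_zero (f : MvPolynomial (Fin 3) ℝ) (n : ℕ) :
    divDiff (hadamard 0) (inX f * yForm 0 ^ n)
      = (if Odd n then 2 else 0 : ℝ) • (inX f * yForm 0 ^ (n - 1)) := by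
  apply divDiff_eq_of_mul_eq hadamard_zero_ne_zero
  rw [map_mul, map_pow, reflect_hadamard_zero_inX, reflect_hadamard_zero_yForm, if_pos rfl,
    ← yForm]
  split_ifs with h
  · obtain ⟨m, rfl⟩ := h
    rw [Odd.neg_pow ⟨m, rfl⟩, smul_eq_C_mul, map_ofNat, Nat.add_sub_cancel]
    ring
  · rw [Even.neg_pow (Nat.not_odd_iff_even.1 h)]
    simp

theorem dunklAZ_apply (κ κ' : ℝ) (i : Fin 4) (F : MvPolynomial (Fin 4) ℝ) :
    dunklAZ κ κ' i F = pderiv i F + κ • ∑ j ∈ Finset.univ.erase i, divDiff (rootSub i j) F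
      + (κ' / 2) • divDiff (hadamard 0) F := by
  rw [dunklAZ, LinearMap.add_apply, dunklA_apply]; rfl

/-- The directional derivative along the row `k` of the Hadamard matrix. -/
def pderivY (k : Fin 4) : Derivation ℝ (MvPolynomial (Fin 4) ℝ) (MvPolynomial (Fin 4) ℝ) :=
  ∑ i, hadamard k i • pderiv i

theorem pderivY_apply (k : Fin 4) (F : MvPolynomial (Fin 4) ℝ) :
    pderivY k F = ∑ i, hadamard k i • pderiv i F := by
  simp [pderivY, Fin.sum_univ_four]

theorem pderivY_yForm (k l : Fin 4) : pderivY k (yForm l) = if k = l then 1 else 0 := by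
  have h : ∀ i, pderiv i (yForm l) = C (hadamard l i) := by
    intro i
    rw [yForm_eq, map_sum, Finset.sum_eq_single i]
    · simp
    · intro j _ hj; simp [pderiv_X_of_ne hj]
    · simp
  have h2 := congrArg (C : ℝ → MvPolynomial (Fin 4) ℝ) (sum_hadamard_mul k l)
  rw [map_sum] at h2
  simp only [pderivY_apply, h, smul_eq_C_mul]
  simp only [map_mul] at h2
  rw [h2]
  split_ifs <;> simp

theorem pderivY_succ_inX (k : Fin 3) (f : MvPolynomial (Fin 3) ℝ) :
    pderivY k.succ (inX f) = inX (pderiv k f) := by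
  induction f using MvPolynomial.induction_on with
  | C a => rw [inX_C, ← algebraMap_eq, Derivation.map_algebraMap]; simp
  | add p q hp hq => simp only [map_add, hp, hq]
  | mul_X p j hp =>
    simp only [map_mul, Derivation.leibniz, hp, inX_X, pderivY_yForm, smul_eq_mul, map_add,
      pderiv_X, Fin.succ_inj]
    by_cases h : k = j
    · subst h; simp
    · simp [h, Ne.symm h]

theorem pderivY_zero_inX (f : MvPolynomial (Fin 3) ℝ) : pderivY 0 (inX f) = 0 := by
  induction f using MvPolynomial.induction_on with
  | C a => rw [inX_C, ← algebraMap_eq, Derivation.map_algebraMap]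
  | add p q hp hq => simp only [map_add, hp, hq, add_zero]
  | mul_X p j hp =>
    simp [Derivation.leibniz, hp, inX_X, pderivY_yForm, (Fin.succ_ne_zero j).symm]

/-- The direction v_0 is orthogonal to every root and collects nothing; in the other directions the
roots of A_3 regroup into the sum of type D_3. -/
theorem sum_rootSub_inX (k : Fin 4) (f : MvPolynomial (Fin 3) ℝ) :
    ∑ i, hadamard k i • ∑ j ∈ Finset.univ.erase i, divDiff (rootSub i j) (inX f)
      = Fin.cases (motive := fun _ => MvPolynomial (Fin 4) ℝ) 0
          (fun k => inX (∑ j ∈ Finset.univ.erase k,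
            (divDiff (rootSub k j) f + divDiff (rootAdd k j) f))) k := by
  obtain ⟨h01, h02, h03, h12, h13, h23⟩ := divDiff_rootSub_inX f
  have e0 : Finset.univ.erase (0 : Fin 4) = {1, 2, 3} := by decide
  have e1 : Finset.univ.erase (1 : Fin 4) = {0, 2, 3} := by decide
  have e2 : Finset.univ.erase (2 : Fin 4) = {0, 1, 3} := by decide
  have e3 : Finset.univ.erase (3 : Fin 4) = {0, 1, 2} := by decide
  have d0 : Finset.univ.erase (0 : Fin 3) = {1, 2} := by decide
  have d1 : Finset.univ.erase (1 : Fin 3) = {0, 2} := by decide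
  have d2 : Finset.univ.erase (2 : Fin 3) = {0, 1} := by decide
  rw [Fin.sum_univ_four, e0, e1, e2, e3]
  simp only [Finset.sum_insert, Finset.sum_singleton, Finset.mem_insert, Finset.mem_singleton,
    Fin.reduceEq, or_self, not_false_eq_true,
    divDiff_rootSub_symm (show (0 : Fin 4) ≠ 1 by decide),
    divDiff_rootSub_symm (show (0 : Fin 4) ≠ 2 by decide),
    divDiff_rootSub_symm (show (0 : Fin 4) ≠ 3 by decide),
    divDiff_rootSub_symm (show (1 : Fin 4) ≠ 2 by decide),
    divDiff_rootSub_symm (show (1 : Fin 4) ≠ 3 by decide),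
    divDiff_rootSub_symm (show (2 : Fin 4) ≠ 3 by decide), h01, h02, h03, h12, h13, h23]
  refine Fin.cases ?_ (fun k => ?_) k
  · simp only [hadamard_apply_zero, Fin.cases_zero]
    module
  · rw [Fin.cases_succ]
    obtain rfl | rfl | rfl : k = 0 ∨ k = 1 ∨ k = 2 := by omega
    · rw [d0, Finset.sum_pair (by decide)]
      simp [hadamard]
      module
    · rw [d1, Finset.sum_pair (by decide),
        divDiff_rootSub_symm (show (0 : Fin 3) ≠ 1 by decide), rootAdd_comm (1 : Fin 3) 0]
      simp [hadamard]
      module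
    · rw [d2, Finset.sum_pair (by decide),
        divDiff_rootSub_symm (show (0 : Fin 3) ≠ 2 by decide),
        divDiff_rootSub_symm (show (1 : Fin 3) ≠ 2 by decide), rootAdd_comm (2 : Fin 3) 0,
        rootAdd_comm (2 : Fin 3) 1]
      simp [hadamard]
      module

/-- The power of y_0 is invariant under S_4 and leaves the divided differences. The κ' term has
coefficient κ'/2 = κ' `hadamard 0 i` in each direction x_i, so orthogonality of the rows confines it
to k = 0. -/
theorem dunklY_apply (κ κ' : ℝ) (k : Fin 4) (f : MvPolynomial (Fin 3) ℝ) (n : ℕ) :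
    dunklY κ κ' k (inX f * yForm 0 ^ n) = pderivY k (inX f * yForm 0 ^ n)
      + κ • ((∑ i, hadamard k i • ∑ j ∈ Finset.univ.erase i, divDiff (rootSub i j) (inX f))
        * yForm 0 ^ n)
      + (if k = 0 then κ' else 0) • divDiff (hadamard 0) (inX f * yForm 0 ^ n) := by
  have h1 : ∀ i : Fin 4, ∑ j ∈ Finset.univ.erase i, divDiff (rootSub i j) (inX f * yForm 0 ^ n)
      = (∑ j ∈ Finset.univ.erase i, divDiff (rootSub i j) (inX f)) * yForm 0 ^ n := by
    intro i
    rw [Finset.sum_mul]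
    refine Finset.sum_congr rfl fun j hj => ?_
    have hij := (Finset.ne_of_mem_erase hj).symm
    apply divDiff_mul_of_reflect_eq (rootSub_ne_zero hij)
    rw [reflect_rootSub hij, map_pow, rename_yForm_zero]
  have h2 : ∑ i, hadamard k i * (κ' / 2) = if k = 0 then κ' else 0 := by
    have h3 : ∀ i, hadamard k i * (κ' / 2) = κ' * (hadamard k i * hadamard 0 i) := by
      intro i; rw [hadamard_apply_zero]; ring
    simp only [h3, ← Finset.mul_sum, sum_hadamard_mul]
    simp
  rw [dunklY, LinearMap.sum_apply]
  simp only [LinearMap.smul_apply, dunklAZ_apply, h1, smul_add, Finset.sum_add_distrib, smul_smul,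
    ← Finset.sum_smul, h2, pderivY_apply]
  congr 2
  rw [Finset.sum_mul, Finset.smul_sum]
  refine Finset.sum_congr rfl fun i _ => ?_
  rw [smul_mul_assoc, smul_smul, mul_comm]

theorem dunklY_succ (κ κ' : ℝ) (k : Fin 3) (f : MvPolynomial (Fin 3) ℝ) (n : ℕ) :
    dunklY κ κ' k.succ (inX f * yForm 0 ^ n) = inX (dunklD κ k f) * yForm 0 ^ n := by
  rw [dunklY_apply, sum_rootSub_inX, Fin.cases_succ, if_neg (Fin.succ_ne_zero k), zero_smul,
    add_zero, Derivation.leibniz, Derivation.leibniz_pow, pderivY_yForm,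
    if_neg (Fin.succ_ne_zero k), pderivY_succ_inX, dunklD_apply, map_add, map_smul]
  simp only [smul_eq_mul, smul_eq_C_mul]
  ring

/-- The factor by which the Dunkl operator along `v_0` lowers `y_0^n`. -/
def lowerFactor (κ' : ℝ) (n : ℕ) : ℝ := n + if Odd n then 2 * κ' else 0

theorem dunklY_zero (κ κ' : ℝ) (f : MvPolynomial (Fin 3) ℝ) (n : ℕ) :
    dunklY κ κ' 0 (inX f * yForm 0 ^ n)
      = lowerFactor κ' n • (inX f * yForm 0 ^ (n - 1)) := by
  rw [dunklY_apply, sum_rootSub_inX, Fin.cases_zero, if_pos rfl, divDiff_hadamard_zero,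
    Derivation.leibniz, Derivation.leibniz_pow, pderivY_yForm, if_pos rfl, pderivY_zero_inX,
    lowerFactor]
  have h : (C (n : ℝ) : MvPolynomial (Fin 4) ℝ) = n := map_natCast C n
  simp only [smul_zero, zero_mul, add_zero, smul_eq_mul, mul_one, nsmul_eq_mul,
    smul_eq_C_mul, map_add, h]
  split_ifs
  · simp only [map_mul]; ring
  · simp; ring

/-! ### Commutativity for S_4 × Z_2 and factorization of its pairing. -/

theorem dunklY_commute_zero_succ (κ κ' : ℝ) (k : Fin 3) :
    Commute (dunklY κ κ' 0) (dunklY κ κ' k.succ) := by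
  have h : dunklY κ κ' 0 * dunklY κ κ' k.succ = dunklY κ κ' k.succ * dunklY κ κ' 0 := by
    refine end_ext_inX_mul_pow fun f n => ?_
    rw [Module.End.mul_apply, Module.End.mul_apply, dunklY_succ κ κ' k f n,
      dunklY_zero κ κ' f n, dunklY_zero κ κ' (dunklD κ k f) n, map_smul,
      dunklY_succ κ κ' k f (n - 1)]
  exact h

theorem dunklY_commute_succ_succ (κ κ' : ℝ) (k l : Fin 3) :
    Commute (dunklY κ κ' k.succ) (dunklY κ κ' l.succ) := by
  have h : dunklY κ κ' k.succ * dunklY κ κ' l.succ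
      = dunklY κ κ' l.succ * dunklY κ κ' k.succ := by
    refine end_ext_inX_mul_pow fun f n => ?_
    have h1 : dunklD κ k (dunklD κ l f) = dunklD κ l (dunklD κ k f) :=
      LinearMap.congr_fun (dunklD_commute κ k l).eq f
    rw [Module.End.mul_apply, Module.End.mul_apply, dunklY_succ κ κ' k f n,
      dunklY_succ κ κ' l f n, dunklY_succ κ κ' k (dunklD κ l f) n,
      dunklY_succ κ κ' l (dunklD κ k f) n, h1]
  exact h

theorem dunklY_commute (κ κ' : ℝ) (k l : Fin 4) :
    Commute (dunklY κ κ' k) (dunklY κ κ' l) := by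
  obtain rfl | ⟨k, rfl⟩ := Fin.eq_zero_or_eq_succ k <;>
    obtain rfl | ⟨l, rfl⟩ := Fin.eq_zero_or_eq_succ l
  · exact Commute.refl _
  · exact dunklY_commute_zero_succ κ κ' l
  · exact (dunklY_commute_zero_succ κ κ' k).symm
  · exact dunklY_commute_succ_succ κ κ' k l

theorem dunklAZ_commute (κ κ' : ℝ) (i j : Fin 4) :
    Commute (dunklAZ κ κ' i) (dunklAZ κ κ' j) := by
  rw [dunklAZ_eq_sum, dunklAZ_eq_sum κ κ' j]
  refine Commute.sum_left _ _ _ fun k _ => Commute.sum_right _ _ _ fun l _ => ?_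
  exact ((dunklY_commute κ κ' k l).smul_left _).smul_right _

theorem pairing_yForm_mul (κ κ' : ℝ) (k : Fin 4) (F G : MvPolynomial (Fin 4) ℝ) :
    pairing (dunklAZ κ κ') (yForm k * F) G = pairing (dunklAZ κ κ') F (dunklY κ κ' k G) := by
  rw [yForm_eq, Finset.sum_mul, pairing_sum_left, dunklY, LinearMap.sum_apply, pairing_sum_right]
  refine Finset.sum_congr rfl fun i _ => ?_
  rw [mul_assoc, ← smul_eq_C_mul, pairing_smul_left, pairing_X_mul_left (dunklAZ_commute κ κ'),
    LinearMap.smul_apply, pairing_smul_right]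

theorem normY0_succ (κ' : ℝ) (n : ℕ) :
    normY0 κ' (n + 1) = lowerFactor κ' (n + 1) * normY0 κ' n := by
  rcases Nat.even_or_odd' n with ⟨m, rfl | rfl⟩
  · rw [normY0, normY0, lowerFactor, if_pos ⟨m, rfl⟩,
      show (2 * m + 1) / 2 = m by omega, show (2 * m + 1 + 1) / 2 = m + 1 by omega,
      show 2 * m / 2 = m by omega, Finset.prod_range_succ]
    push_cast
    ring
  · rw [normY0, normY0, lowerFactor, if_neg (by rw [Nat.not_odd_iff_even]; exact ⟨m + 1, by ring⟩),
      show (2 * m + 1) / 2 = m by omega, show (2 * m + 1 + 1) / 2 = m + 1 by omega,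
      show (2 * m + 1 + 1 + 1) / 2 = m + 1 by omega, Nat.factorial_succ]
    push_cast
    ring

theorem normY0_pos {κ' : ℝ} (hκ' : 0 ≤ κ') (n : ℕ) : 0 < normY0 κ' n := by
  have : 0 < ∏ j ∈ Finset.range ((n + 1) / 2), (κ' + 1 / 2 + (j : ℝ)) :=
    Finset.prod_pos fun j _ => by positivity
  rw [normY0]
  positivity

theorem pairing_pow_mul (κ κ' : ℝ) (n m : ℕ) (g : MvPolynomial (Fin 3) ℝ) :
    pairing (dunklAZ κ κ') (yForm 0 ^ n) (inX g * yForm 0 ^ m)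
      = if n = m then constantCoeff g * normY0 κ' n else 0 := by
  induction n generalizing m with
  | zero =>
    rw [pow_zero, ← C_1, pairing_C_left, map_mul, map_pow, constantCoeff_inX, constantCoeff_yForm]
    rcases m.eq_zero_or_pos with rfl | hm
    · simp [normY0]
    · simp [hm.ne', hm.ne]
  | succ n ih =>
    rw [pow_succ', pairing_yForm_mul, dunklY_zero, pairing_smul_right, ih]
    cases m with
    | zero => simp [lowerFactor]
    | succ m =>
      rw [Nat.add_sub_cancel]
      by_cases h : n = m
      · subst h; simp only [if_true]; rw [normY0_succ]; ring
      · simp [h]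

/-- The variables y_1, y_2, y_3 are peeled off f, each turning into D^B_k on g; what remains is the
one-variable pairing of powers of y_0. -/
theorem pairing_inX_mul_pow (κ κ' : ℝ) (f g : MvPolynomial (Fin 3) ℝ) (n m : ℕ) :
    pairing (dunklAZ κ κ') (inX f * yForm 0 ^ n) (inX g * yForm 0 ^ m)
      = if n = m then pairing (dunklD κ) f g * normY0 κ' n else 0 := by
  induction f using MvPolynomial.induction_on generalizing g with
  | C a =>
    rw [inX_C, ← smul_eq_C_mul, pairing_smul_left, pairing_pow_mul, pairing_C_left]
    split_ifs <;> ring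
  | add p q hp hq =>
    rw [map_add, add_mul, pairing_add_left, hp, hq, pairing_add_left]
    split_ifs <;> ring
  | mul_X p k hp =>
    rw [mul_comm p, map_mul, inX_X, mul_assoc, pairing_yForm_mul, dunklY_succ, hp,
      pairing_X_mul_left (dunklD_commute κ)]

theorem dunklAZ_zero (κ : ℝ) : dunklAZ κ 0 = dunklA κ := by
  funext i
  simp [dunklAZ]

/-- The case κ' = 0, n = m = 0 of the factorization, where the factor for y_0 is 1. -/
theorem pairing_inX (κ : ℝ) (f g : MvPolynomial (Fin 3) ℝ) :
    pairing (dunklA κ) (inX f) (inX g) = pairing (dunklD κ) f g := by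
  have h := pairing_inX_mul_pow κ 0 f g 0 0
  rw [dunklAZ_zero] at h
  simpa [normY0] using h

theorem span_inX_p {κ : ℝ} (hκ : 0 ≤ κ) :
    Submodule.span ℝ (Set.range fun γ : Fin 3 → ℕ => inX (p κ γ))
      = Subalgebra.toSubmodule
        (Algebra.adjoin ℝ (Set.range fun i : Fin 3 => yForm i.succ)) := by
  have h : (Set.range fun γ : Fin 3 → ℕ => inX (p κ γ))
      = inX.toLinearMap '' Set.range (p κ) := by
    rw [← Set.range_comp]; rfl
  rw [h, Submodule.span_image, span_p hκ, Algebra.adjoin_range_eq_range_aeval]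
  ext F
  simp only [Submodule.mem_map, Submodule.mem_top, true_and, Subalgebra.mem_toSubmodule,
    AlgHom.mem_range]
  rfl

theorem isOrthoBasis_inX_p {κ : ℝ} (hκ : 0 ≤ κ) :
    IsOrthoBasis (pairing (dunklA κ))
      (Subalgebra.toSubmodule (Algebra.adjoin ℝ (Set.range fun i : Fin 3 => yForm i.succ)))
      (fun γ : Fin 3 → ℕ => inX (p κ γ)) (normP κ) where
  linearIndependent := linearIndependent_of_pairing (pairingForm (dunklA κ)) _
    (fun _ _ h => by rw [pairingForm_apply, pairing_inX, pairing_p_eq_zero hκ h])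
    (fun γ => by
      rw [pairingForm_apply, pairing_inX, pairing_p_self hκ]; exact (normP_pos hκ γ).ne')
  span_eq := span_inX_p hκ
  orthogonal _ _ h := by rw [pairing_inX, pairing_p_eq_zero hκ h]
  norm_eq γ := by rw [pairing_inX, pairing_p_self hκ]
  norm_pos := normP_pos hκ

theorem span_inX_p_mul_pow {κ : ℝ} (hκ : 0 ≤ κ) :
    Submodule.span ℝ (Set.range fun γ : (Fin 3 → ℕ) × ℕ => inX (p κ γ.1) * yForm 0 ^ γ.2)
      = ⊤ := by
  rw [eq_top_iff, ← span_inX_mul_pow, Submodule.span_le]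
  rintro _ ⟨⟨f, n⟩, rfl⟩
  have h : (⊤ : Submodule ℝ _) ≤ (Submodule.span ℝ
      (Set.range fun γ : (Fin 3 → ℕ) × ℕ => inX (p κ γ.1) * yForm 0 ^ γ.2)).comap
      (LinearMap.mulRight ℝ (yForm 0 ^ n) ∘ₗ inX.toLinearMap) := by
    rw [← span_p hκ, Submodule.span_le]
    rintro _ ⟨γ, rfl⟩
    exact Submodule.subset_span ⟨(γ, n), rfl⟩
  exact h (Submodule.mem_top (x := f))

theorem pairing_inX_p_mul_pow_eq_zero {κ : ℝ} (hκ : 0 ≤ κ) (κ' : ℝ) {a b : (Fin 3 → ℕ) × ℕ}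
    (h : a ≠ b) : pairing (dunklAZ κ κ') (inX (p κ a.1) * yForm 0 ^ a.2)
      (inX (p κ b.1) * yForm 0 ^ b.2) = 0 := by
  rw [pairing_inX_mul_pow]
  split_ifs with h2
  · rw [pairing_p_eq_zero hκ fun h1 => h (Prod.ext h1 h2), zero_mul]
  · rfl

theorem pairing_inX_p_mul_pow_self {κ : ℝ} (hκ : 0 ≤ κ) (κ' : ℝ) (a : (Fin 3 → ℕ) × ℕ) :
    pairing (dunklAZ κ κ') (inX (p κ a.1) * yForm 0 ^ a.2) (inX (p κ a.1) * yForm 0 ^ a.2)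
      = normP κ a.1 * normY0 κ' a.2 := by
  rw [pairing_inX_mul_pow, if_pos rfl, pairing_p_self hκ]

theorem isOrthoBasis_inX_p_mul_pow {κ κ' : ℝ} (hκ : 0 ≤ κ) (hκ' : 0 ≤ κ') :
    IsOrthoBasis (pairing (dunklAZ κ κ')) ⊤
      (fun γ : (Fin 3 → ℕ) × ℕ => inX (p κ γ.1) * yForm 0 ^ γ.2)
      (fun γ => normP κ γ.1 * normY0 κ' γ.2) where
  linearIndependent := linearIndependent_of_pairing (pairingForm (dunklAZ κ κ')) _
    (fun _ _ h => pairing_inX_p_mul_pow_eq_zero hκ κ' h)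
    (fun γ => by
      rw [pairingForm_apply, pairing_inX_p_mul_pow_self hκ]
      exact (mul_pos (normP_pos hκ _) (normY0_pos hκ' _)).ne')
  span_eq := span_inX_p_mul_pow hκ
  orthogonal _ _ h := pairing_inX_p_mul_pow_eq_zero hκ κ' h
  norm_eq := pairing_inX_p_mul_pow_self hκ κ'
  norm_pos _ := mul_pos (normP_pos hκ _) (normY0_pos hκ' _)

/-! ### The action of the symmetric group in the coordinates `y` -/

/-- The point of the hyperplane `y_0 = 0` with the coordinates `y_1, y_2, y_3`. -/
def xPoint (y : EuclideanSpace ℝ (Fin 3)) : Fin 4 → ℝ :=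
  fun i => ∑ k : Fin 3, hadamard k.succ i * y k

theorem yPoint_eq (x : Fin 4 → ℝ) :
    yPoint x = !₂[(x 0 + x 1 - x 2 - x 3) / 2, (x 0 - x 1 + x 2 - x 3) / 2,
      (x 0 - x 1 - x 2 + x 3) / 2] := by
  ext k
  fin_cases k <;>
    simp [yPoint, hadamard, Matrix.mulVec, dotProduct, Fin.sum_univ_four] <;> ring

theorem xPoint_eq (y : EuclideanSpace ℝ (Fin 3)) :
    xPoint y = ![(y 0 + y 1 + y 2) / 2, (y 0 - y 1 - y 2) / 2, (-y 0 + y 1 - y 2) / 2,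
      (-y 0 - y 1 + y 2) / 2] := by
  ext i
  fin_cases i <;> simp [xPoint, hadamard, Fin.sum_univ_three] <;> ring

theorem yPoint_xPoint (y : EuclideanSpace ℝ (Fin 3)) : yPoint (xPoint y) = y := by
  rw [yPoint_eq, xPoint_eq]
  ext k
  fin_cases k <;> simp <;> ring

theorem hadamard_mulVec_zero (x : Fin 4 → ℝ) : hadamard.mulVec x 0 = (∑ i, x i) / 2 := by
  simp [Matrix.mulVec, dotProduct, hadamard_apply_zero, ← Finset.mul_sum]
  ring

theorem xPoint_yPoint (x : Fin 4 → ℝ) (i : Fin 4) :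
    xPoint (yPoint x) i = x i - (∑ j, x j) / 4 := by
  rw [yPoint_eq, xPoint_eq, Fin.sum_univ_four]
  fin_cases i <;> simp <;> ring

theorem yPoint_sub_const (x : Fin 4 → ℝ) (c : ℝ) : yPoint (fun i => x i - c) = yPoint x := by
  rw [yPoint_eq, yPoint_eq]
  ext k
  fin_cases k <;> simp <;> ring

theorem yPoint_add (x z : Fin 4 → ℝ) : yPoint (fun i => x i + z i) = yPoint x + yPoint z := by
  rw [yPoint_eq, yPoint_eq, yPoint_eq]
  ext k
  fin_cases k <;> simp <;> ring

theorem yPoint_smul (c : ℝ) (x : Fin 4 → ℝ) : yPoint (fun i => c * x i) = c • yPoint x := by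
  rw [yPoint_eq, yPoint_eq]
  ext k
  fin_cases k <;> simp <;> ring

theorem norm_sq_yPoint (x : Fin 4 → ℝ) :
    ‖yPoint x‖ ^ 2 = ∑ i, x i ^ 2 - (∑ i, x i) ^ 2 / 4 := by
  rw [yPoint_eq, EuclideanSpace.norm_sq_eq]
  simp [Fin.sum_univ_three, Fin.sum_univ_four]
  ring

/-- Passing to y_1, y_2, y_3 and back subtracts the mean of x. That constant survives permutations
and is invisible to `yPoint`, so the action of S_4 descends to ℝ³. -/
theorem yPoint_xPoint_yPoint_comp (w : Equiv.Perm (Fin 4)) (x : Fin 4 → ℝ) :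
    yPoint (fun i => xPoint (yPoint x) (w i)) = yPoint (fun i => x (w i)) := by
  simp only [xPoint_yPoint]
  exact yPoint_sub_const _ _

theorem norm_yPoint_comp (w : Equiv.Perm (Fin 4)) (x : Fin 4 → ℝ) :
    ‖yPoint (fun i => x (w i))‖ = ‖yPoint x‖ := by
  rw [← sq_eq_sq₀ (norm_nonneg _) (norm_nonneg _), norm_sq_yPoint, norm_sq_yPoint,
    Equiv.sum_comp w x, Equiv.sum_comp w fun i => x i ^ 2]

/-- The isometry of `ℝ³` by which a permutation of `x_1, …, x_4` acts on `(y_1, y_2, y_3)`. -/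
def permIsometry (w : Equiv.Perm (Fin 4)) :
    EuclideanSpace ℝ (Fin 3) ≃ₗᵢ[ℝ] EuclideanSpace ℝ (Fin 3) where
  toFun y := yPoint fun i => xPoint y (w⁻¹ i)
  invFun y := yPoint fun i => xPoint y (w i)
  map_add' y z := by
    rw [← yPoint_add]
    congr 1; funext i
    simp [xPoint, mul_add, Finset.sum_add_distrib]
  map_smul' c y := by
    rw [RingHom.id_apply, ← yPoint_smul]
    congr 1; funext i
    simp only [xPoint, Finset.mul_sum, PiLp.smul_apply, smul_eq_mul]
    exact Finset.sum_congr rfl fun k _ => by ring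
  left_inv y := by
    refine (yPoint_xPoint_yPoint_comp w fun i => xPoint y (w⁻¹ i)).trans ?_
    simp [yPoint_xPoint]
  right_inv y := by
    refine (yPoint_xPoint_yPoint_comp w⁻¹ fun i => xPoint y (w i)).trans ?_
    simp [yPoint_xPoint]
  norm_map' y := by
    change ‖yPoint fun i => xPoint y (w⁻¹ i)‖ = ‖y‖
    rw [norm_yPoint_comp, yPoint_xPoint]

theorem permIsometry_yPoint (w : Equiv.Perm (Fin 4)) (x : Fin 4 → ℝ) :
    permIsometry w (yPoint x) = yPoint fun i => x (w⁻¹ i) :=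
  yPoint_xPoint_yPoint_comp w⁻¹ x

/-- The action of the symmetric group `S_4` on `(y_1, y_2, y_3)`. -/
def permHom : Equiv.Perm (Fin 4) →*
    (EuclideanSpace ℝ (Fin 3) ≃ₗᵢ[ℝ] EuclideanSpace ℝ (Fin 3)) where
  toFun := permIsometry
  map_one' := by
    ext1 y
    rw [← yPoint_xPoint y, permIsometry_yPoint]
    simp
  map_mul' w v := by
    ext1 y
    rw [LinearIsometryEquiv.coe_mul, Function.comp_apply, ← yPoint_xPoint y, permIsometry_yPoint,
      permIsometry_yPoint, permIsometry_yPoint]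
    simp

theorem permHom_yPoint (w : Equiv.Perm (Fin 4)) (x : Fin 4 → ℝ) :
    permHom w (yPoint x) = yPoint fun i => x (w⁻¹ i) := permIsometry_yPoint w x

theorem permHom_injective : Function.Injective permHom := by
  rw [injective_iff_map_eq_one]
  intro w hw
  have h : ∀ x : Fin 4 → ℝ, (fun i => x (w⁻¹ i)) = x := by
    intro x
    have h1 := permHom_yPoint w x
    rw [hw, LinearIsometryEquiv.coe_one, id_eq] at h1
    funext i
    have h2 := xPoint_yPoint (fun i => x (w⁻¹ i)) i
    rw [← h1, xPoint_yPoint, Equiv.sum_comp w⁻¹ x] at h2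
    linarith
  rw [← inv_eq_one]
  ext i
  -- A point with distinct coordinates detects the permutation.
  have h3 := congrFun (h fun j => ((j : ℕ) : ℝ)) i
  simpa using h3

/-- For ‖v‖² = 2 the reflection along v is y ↦ y - ⟨v, y⟩ v. -/
theorem permHom_swap (i j : Fin 4) (v : EuclideanSpace ℝ (Fin 3)) (hv : ‖v‖ ^ 2 = 2)
    (h : ∀ x : Fin 4 → ℝ, yPoint (fun l => x (Equiv.swap i j l))
      = yPoint x - inner ℝ v (yPoint x) • v) :
    permHom (Equiv.swap i j) = (ℝ ∙ v)ᗮ.reflection := by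
  ext1 y
  rw [← yPoint_xPoint y, permHom_yPoint, Equiv.swap_inv, h, Submodule.reflection_orthogonal_apply,
    Submodule.reflection_singleton_apply]
  simp only [RCLike.ofReal_real_eq_id, id_eq, hv]
  module

theorem permHom_swap_one_two :
    permHom (Equiv.swap 1 2) = (ℝ ∙ (!₂[1, -1, 0] : EuclideanSpace ℝ (Fin 3)))ᗮ.reflection := by
  apply permHom_swap
  · simp [EuclideanSpace.norm_sq_eq, Fin.sum_univ_three]; norm_num
  · intro x
    rw [yPoint_eq, yPoint_eq]
    ext k
    fin_cases k <;> simp [Fin.sum_univ_three, PiLp.inner_apply, Equiv.swap_apply_def] <;> ring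

theorem permHom_swap_two_three :
    permHom (Equiv.swap 2 3) = (ℝ ∙ (!₂[0, 1, -1] : EuclideanSpace ℝ (Fin 3)))ᗮ.reflection := by
  apply permHom_swap
  · simp [EuclideanSpace.norm_sq_eq, Fin.sum_univ_three]; norm_num
  · intro x
    rw [yPoint_eq, yPoint_eq]
    ext k
    fin_cases k <;> simp [Fin.sum_univ_three, PiLp.inner_apply, Equiv.swap_apply_def] <;> ring

theorem permHom_swap_zero_one :
    permHom (Equiv.swap 0 1) = (ℝ ∙ (!₂[0, 1, 1] : EuclideanSpace ℝ (Fin 3)))ᗮ.reflection := by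
  apply permHom_swap
  · simp [EuclideanSpace.norm_sq_eq, Fin.sum_univ_three]; norm_num
  · intro x
    rw [yPoint_eq, yPoint_eq]
    ext k
    fin_cases k <;> simp [Fin.sum_univ_three, PiLp.inner_apply, Equiv.swap_apply_def] <;> ring

theorem closure_swap_eq_top :
    Subgroup.closure {Equiv.swap 1 2, Equiv.swap 2 3, Equiv.swap 0 1}
      = (⊤ : Subgroup (Equiv.Perm (Fin 4))) := by
  have h : (Set.range fun i : Fin 3 => Equiv.swap i.castSucc i.succ)
      ⊆ ({Equiv.swap 1 2, Equiv.swap 2 3, Equiv.swap 0 1} : Set (Equiv.Perm (Fin 4))) := by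
    rintro _ ⟨i, rfl⟩
    fin_cases i <;> simp
  rw [eq_top_iff]
  intro w _
  have hw : w ∈ Submonoid.closure (Set.range fun i : Fin 3 => Equiv.swap i.castSucc i.succ) := by
    rw [Equiv.Perm.mclosure_swap_castSucc_succ]; trivial
  exact Subgroup.closure_mono h (Subgroup.le_closure_toSubmonoid _ hw)

/-- The adjacent transpositions generate S_4 and act as the three reflections that generate
`groupD3`. -/
theorem permHom_range : permHom.range = groupD3 := by
  rw [MonoidHom.range_eq_map, ← closure_swap_eq_top, MonoidHom.map_closure, groupD3]
  congr 1
  simp only [Set.image_insert_eq, Set.image_singleton, permHom_swap_one_two,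
    permHom_swap_two_three, permHom_swap_zero_one]

/-- The isomorphism of `S_4` onto `D_3`. -/
def permEquivD3 : Equiv.Perm (Fin 4) ≃* groupD3 :=
  (MonoidHom.ofInjective permHom_injective).trans (MulEquiv.subgroupCongr permHom_range)

theorem permEquivD3_yPoint (w : Equiv.Perm (Fin 4)) (x : Fin 4 → ℝ) :
    (permEquivD3 w : EuclideanSpace ℝ (Fin 3) ≃ₗᵢ[ℝ] EuclideanSpace ℝ (Fin 3)) (yPoint x)
      = yPoint fun i => x (w⁻¹ i) := permHom_yPoint w x

theorem hadamard_mulVec_comp_zero (w : Equiv.Perm (Fin 4)) (x : Fin 4 → ℝ) :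
    (hadamard.mulVec fun i => x (w i)) 0 = (hadamard.mulVec x) 0 := by
  rw [hadamard_mulVec_zero, hadamard_mulVec_zero, Equiv.sum_comp w x]

end DunklFour

end

open DunklFour in
theorem mainTheorem1 (κ κ' : ℝ) (hκ : 0 ≤ κ) (hκ' : 0 ≤ κ') :
    -- the change of variables `y = H x` is an isometry and identifies `S_4` with `D_3`
    (hadamard * hadamard.transpose = 1 ∧
      ∃ φ : Equiv.Perm (Fin 4) ≃* groupD3, ∀ (w : Equiv.Perm (Fin 4)) (x : Fin 4 → ℝ),
        (φ w : EuclideanSpace ℝ (Fin 3) ≃ₗᵢ[ℝ] EuclideanSpace ℝ (Fin 3)) (yPoint x)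
          = yPoint (fun i => x (w⁻¹ i)) ∧
        (hadamard.mulVec fun i => x (w⁻¹ i)) 0 = (hadamard.mulVec x) 0) ∧
    -- the nonsymmetric Jack polynomials are well defined
    (∀ α : Fin 3 → ℕ, ∃! ζ, IsNSJack κ α ζ) ∧
    -- `{p_γ}` in the coordinates `y`, for the pairing of `D_3`
    IsOrthoBasis (pairing (dunklD κ)) ⊤ (p κ) (normP κ) ∧
    -- `{p_γ}` in the coordinates `x`, for the pairing of `S_4`
    IsOrthoBasis (pairing (dunklA κ))
      (Subalgebra.toSubmodule
        (Algebra.adjoin ℝ (Set.range fun i : Fin 3 => yForm i.succ)))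
      (fun γ : Fin 3 → ℕ => inX (p κ γ)) (normP κ) ∧
    -- `{p_γ y_0^n}`, for the pairing of `S_4 × Z_2`
    IsOrthoBasis (pairing (dunklAZ κ κ')) ⊤
      (fun γ : (Fin 3 → ℕ) × ℕ => inX (p κ γ.1) * yForm 0 ^ γ.2)
      (fun γ => normP κ γ.1 * normY0 κ' γ.2) := by
  exact ⟨⟨hadamard_mul_transpose, permEquivD3, fun w x =>
      ⟨permEquivD3_yPoint w x, hadamard_mulVec_comp_zero w⁻¹ x⟩⟩,
    existsUnique_isNSJack hκ, isOrthoBasis_p hκ, isOrthoBasis_inX_p hκ,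
    isOrthoBasis_inX_p_mul_pow hκ hκ'⟩
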